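/- \textbf{Notions.} Let $D$ be a probability distribution on $\{0,1\}^n$, $n\ge 1$. A literal is a variable $x_i$ or its negation; a clause is a finite set of literals (a disjunction), its width is the number of its literals; a CNF is a finite conjunction of clauses. The masking process $M_\mu$ replaces each coordinate of $x$ independently by $*$ with probability $1-\mu$ (and keeps it with probability $\mu$); $M_\mu(D)$ is the law of $M_\mu(x)$, $x\sim D$. A clause is \emph{witnessed true} on $\rho\in\{0,1,*\}^n$ if one of its literals is unmasked and true, and \emph{falsified} on $\rho$ if all of its literals are unmasked and false; a CNF is witnessed true if all its clauses are. The \emph{restriction} of a CNF under $\rho$ drops the clauses that are witnessed true and deletes the unmasked literals from the others. $D$ has a \emph{width-$w$ $(\beta,1-\eta)$ correlation gap} if for every conjunction $T$ of at most $w$ literals with $\Pr_D[T]>0$ and every variable $x_i$, either $\Pr[x_i=b\mid T]\ge\beta$ for both $b\in\{0,1\}$, or $\Pr[x_i=b\mid T]\ge 1-\eta$ for some $b$. $D$ is \emph{affine} if it is uniform on the solution set of a solvable linear system over $\mathbb F_2$. A \emph{resolution refutation of size $p$} is a sequence of at most $p$ clauses ending with the empty clause, each of which is an input clause, a superset of an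 earlier clause (weakening), or of the form $A\vee B$ for earlier clauses $A\vee x$ and $B\vee\neg x$ (cut). \textbf{Parameters.} Let $p\ge 1$ be an integer and $\mu,\epsilon,\gamma,\delta,\beta\in(0,1)$. Put $$m_1=\Big\lceil\tfrac{1}{2\gamma^2}\ln\tfrac2\delta\Big\rceil,\quad w=\min\Big\{n,\Big\lceil\tfrac1{\mu\beta}\ln\tfrac{2m_1p}{\delta}\Big\rceil\Big\},\quad m_0=\Big\lceil\tfrac{2w(2n+1)^{2w}}{\mu^{2w}\gamma^2}\ln\tfrac{4(2n+1)}{\delta}\Big\rceil,\quad \eta=\frac{\gamma}{4n(2n+1)^w}.$$ \textbf{Algorithm Learn+RES.} Input: a CNF $\varphi$ in $n$ variables and partial assignments $\rho^{(1)},\dots,\rho^{(m_0+m_1)}$ drawn independently from $M_\mu(D)$. (1) Let $\psi$ be the conjunction of all clauses on distinct variables of width at most $w$ that are falsified on at most $\frac{\gamma\mu^w}{2(2n+1)^w}m_0$ of the first $m_0$ examples. (2) For each clause $C$ of $\varphi$, go through the clauses $C'$ of $\psi$; whenever $C'=C''\vee\ell$ with $C''\vee\neg\ell\subseteq C$, delete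 $\neg\ell$ from $C$. Let $\varphi'$ be the conjunction of the resulting clauses. (3) For each of the last $m_1$ examples $\rho$, decide by exhaustive search whether the restriction of $\varphi'\wedge\psi$ under $\rho$ has a resolution refutation with all clauses of width at most $2w$. Reject if there is none for more than $\lfloor\epsilon m_1\rfloor$ of these examples; otherwise accept. \textbf{Theorem.} Suppose that $D$ has a width-$w$ $(\beta,1-\eta)$ correlation gap. Consider the two cases \begin{itemize} \item[(i)] $\varphi$ is satisfied by $D$ with probability at least $\epsilon+2\gamma$; \item[(ii)] there are CNFs $\psi_0,\psi_1$ such that every clause of $\psi_0$ is satisfied by $D$ with probability at least $1-\eta$, $\psi_1$ is witnessed true with probability at least $1-\epsilon+2\gamma$ under $M_\mu(D)$, and $\psi_0\wedge\psi_1\wedge\varphi$ has a resolution refutation of size $p$. \end{itemize} In case (i) Learn+RES rejects with probability at least $1-\delta$, and in case (ii) it accepts with probability at least $1-\delta$. The same holds with $\beta=1/2$ for every affine distribution $D$, without any further assumption on $D$. Moreover there is an absolute constant $K$ such that, whenever $n\ge 2$ and $\gamma\le 1/2$ (either case forces $\gamma<1/2$), Learn+RES takes on every sample at most $$(|\varphi|+1)\cdot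 n^{\,K\frac{1}{\mu\beta}\ln\frac{p}{\gamma\delta}}$$ elementary steps, where $|\varphi|$ is the number of clauses of $\varphi$. -/

import Mathlib

open MeasureTheory ProbabilityTheory

namespace PACRes

/-! ### Step-counted computations -/

/-- The result of a computation together with the number of elementary steps it took. -/
structure Timed (α : Type) where
  val : α
  steps : ℕ

instance : Monad Timed where
  pure a := ⟨a, 0⟩
  bind x f := ⟨(f x.val).val, x.steps + (f x.val).steps⟩

/-- One elementary operation with result `a`. The elementary operations used below are those of a
random access machine in which a clause is an array of `2n` bits and a partial assignment an array
of `n` entries: looking up or setting one entry of such an array, comparing two literals,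
incrementing or comparing a counter, a Boolean connective, putting one item on a list. -/
def op {α : Type} (a : α) : Timed α := ⟨a, 1⟩

/-- A `for` loop over a list; besides the steps of its body, each iteration costs one step. -/
def loop {σ α : Type} : List α → σ → (σ → α → Timed σ) → Timed σ
  | [], s, _ => op s
  | a :: l, s, body => do
    let s ← op s
    let s' ← body s a
    loop l s' body

/-! ### Literals, clauses, CNFs, assignments -/

/-- `(i, true)` is the literal `x_i`, and `(i, false)` is the literal `¬ x_i`. -/
abbrev Literal (n : ℕ) := Fin n × Bool

/-- A clause is a set of literals; its width is its cardinality. -/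
abbrev Clause (n : ℕ) := Finset (Literal n)

abbrev CNF (n : ℕ) := List (Clause n)

abbrev Assignment (n : ℕ) := Fin n → Bool

/-- `none` is the masked value `*`. -/
abbrev PartialAssignment (n : ℕ) := Fin n → Option Bool

def Literal.neg {n : ℕ} (l : Literal n) : Literal n := (l.1, !l.2)

def Literal.Sat {n : ℕ} (l : Literal n) (x : Assignment n) : Prop := x l.1 = l.2

def Clause.Sat {n : ℕ} (C : Clause n) (x : Assignment n) : Prop := ∃ l ∈ C, Literal.Sat l x

def CNF.Sat {n : ℕ} (φ : CNF n) (x : Assignment n) : Prop := ∀ C ∈ φ, Clause.Sat C x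

/-- The clause is witnessed to evaluate to true on `ρ`. -/
def Clause.WitnessedTrue {n : ℕ} (C : Clause n) (ρ : PartialAssignment n) : Prop :=
  ∃ l ∈ C, ρ l.1 = some l.2

/-- Every clause of the CNF is witnessed to evaluate to true on `ρ`. -/
def CNF.WitnessedTrue {n : ℕ} (φ : CNF n) (ρ : PartialAssignment n) : Prop :=
  ∀ C ∈ φ, Clause.WitnessedTrue C ρ

/-! ### Resolution -/

/-- `C 0, …, C k` is a resolution refutation of `φ`. -/
def IsRefutation {n : ℕ} (φ : CNF n) {k : ℕ} (C : Fin (k + 1) → Clause n) : Prop :=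
  C (Fin.last k) = ∅ ∧
  ∀ i, C i ∈ φ ∨ (∃ j < i, C j ⊆ C i) ∨
    ∃ j < i, ∃ l < i, ∃ (v : Fin n) (D E : Clause n),
      C j = insert (v, true) D ∧ C l = insert (v, false) E ∧ C i = D ∪ E

/-- `φ` has a resolution refutation that consists of at most `p` clauses. -/
def HasRefutation {n : ℕ} (φ : CNF n) (p : ℕ) : Prop :=
  ∃ (k : ℕ) (C : Fin (k + 1) → Clause n), k + 1 ≤ p ∧ IsRefutation φ C

/-! ### Distributions, masking, correlation gaps -/

instance : MeasurableSpace (Option Bool) := ⊤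

/-- The conjunction of the literals in `T` holds. -/
def conjEvent {n : ℕ} (T : Finset (Literal n)) : Set (Assignment n) :=
  {x | ∀ l ∈ T, Literal.Sat l x}

/-- Width-`w` `(β, τ)` correlation gap. -/
def HasCorrelationGap {n : ℕ} (D : Measure (Assignment n)) (w : ℕ) (β τ : ℝ) : Prop :=
  ∀ T : Finset (Literal n), T.card ≤ w → D (conjEvent T) ≠ 0 → ∀ i : Fin n,
    (∀ b : Bool, β ≤ (cond D (conjEvent T)).real {x | x i = b}) ∨
    (∃ b : Bool, τ ≤ (cond D (conjEvent T)).real {x | x i = b})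

/-- Uniform distribution over the solutions of a solvable linear system over `𝔽₂`. -/
def IsAffineDistribution {n : ℕ} (D : Measure (Assignment n)) : Prop :=
  ∃ (m : ℕ) (A : Matrix (Fin m) (Fin n) (ZMod 2)) (b : Fin m → ZMod 2),
    let S : Set (Assignment n) := {x | A.mulVec (fun i => if x i then 1 else 0) = b}
    S.Nonempty ∧ D = uniformOn S

/-- The law of the independent masks: each entry is `true` (revealed) with probability `μ`. -/
noncomputable def maskLaw (n : ℕ) (μ : ℝ) : Measure (Fin n → Bool) :=
  Measure.pi fun _ => ENNReal.ofReal μ • Measure.dirac true +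
    ENNReal.ofReal (1 - μ) • Measure.dirac false

def applyMask {n : ℕ} (x : Assignment n) (m : Fin n → Bool) : PartialAssignment n :=
  fun i => if m i then some (x i) else none

/-- The distribution `M_μ(D)` of masked examples. -/
noncomputable def maskedLaw {n : ℕ} (D : Measure (Assignment n)) (μ : ℝ) :
    Measure (PartialAssignment n) :=
  (D.prod (maskLaw n μ)).map fun q => applyMask q.1 q.2

/-- The law of `m` independent examples from `M_μ(D)`. -/
noncomputable def sampleLaw {n : ℕ} (D : Measure (Assignment n)) (μ : ℝ) (m : ℕ) :
    Measure (Fin m → PartialAssignment n) :=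
  Measure.pi fun _ => maskedLaw D μ

/-! ### Operations on clauses, with their step counts -/

/-- All `2n` literals. -/
def literals (n : ℕ) : List (Literal n) :=
  (List.finRange n).flatMap fun i => [(i, false), (i, true)]

/-- Whether `C` is witnessed to evaluate to false on `ρ`. -/
def isFalsified {n : ℕ} (C : Clause n) (ρ : PartialAssignment n) : Timed Bool :=
  loop (literals n) true fun r l => do
    let c ← op (decide (l ∈ C))
    let f ← op (decide (ρ l.1 = some (!l.2)))
    op (r && (!c || f))

/-- Whether `C` is witnessed to evaluate to true on `ρ`. -/
def isWitnessed {n : ℕ} (C : Clause n) (ρ : PartialAssignment n) : Timed Bool :=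
  loop (literals n) false fun r l => do
    let c ← op (decide (l ∈ C))
    let t ← op (decide (ρ l.1 = some l.2))
    op (r || (c && t))

/-- The literals of `C` whose variables are masked in `ρ`. -/
def maskedPart {n : ℕ} (C : Clause n) (ρ : PartialAssignment n) : Timed (Clause n) :=
  loop (literals n) ∅ fun R l => do
    let c ← op (decide (l ∈ C))
    let u ← op (decide (ρ l.1 = none))
    if c && u then op (insert l R) else op R

/-- The restriction `φ|_ρ`. A clause that is witnessed to evaluate to false becomes the empty
clause. -/
def restrict {n : ℕ} (φ : CNF n) (ρ : PartialAssignment n) : Timed (CNF n) :=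
  loop φ [] fun R C => do
    let t ← isWitnessed C ρ
    if t then pure R else do
      let C' ← maskedPart C ρ
      op (C' :: R)

def width {n : ℕ} (C : Clause n) : Timed ℕ :=
  loop (literals n) 0 fun k l => do
    let c ← op (decide (l ∈ C))
    if c then op (k + 1) else op k

def sameClause {n : ℕ} (A B : Clause n) : Timed Bool :=
  loop (literals n) true fun r l => do
    let a ← op (decide (l ∈ A))
    let b ← op (decide (l ∈ B))
    op (r && (a == b))

def insertLiteral {n : ℕ} (C : Clause n) (l₀ : Literal n) : Timed (Clause n) :=
  loop (literals n) ∅ fun R l => do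
    let c ← op (decide (l ∈ C))
    let e ← op (decide (l = l₀))
    if c || e then op (insert l R) else op R

def deleteLiteral {n : ℕ} (C : Clause n) (l₀ : Literal n) : Timed (Clause n) :=
  loop (literals n) ∅ fun R l => do
    let c ← op (decide (l ∈ C))
    let e ← op (decide (l = l₀))
    if c && !e then op (insert l R) else op R

/-- The clause `D ∨ E` for `A = D ∨ x_v` and `B = E ∨ ¬ x_v`. -/
def resolvent {n : ℕ} (A B : Clause n) (v : Fin n) : Timed (Clause n) :=
  loop (literals n) ∅ fun R l => do
    let a ← op (decide (l ∈ A))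
    let a' ← op (decide (l = (v, true)))
    let b ← op (decide (l ∈ B))
    let b' ← op (decide (l = (v, false)))
    if (a && !a') || (b && !b') then op (insert l R) else op R

/-- Adds a clause to a table unless it is already there. -/
def addNew {n : ℕ} (T : CNF n) (C : Clause n) : Timed (CNF n) := do
  let found ← loop T false fun r B => do
    let e ← sameClause C B
    op (r || e)
  if found then pure T else op (C :: T)

/-- Adds a clause of width at most `k` to a table; wider clauses are discarded. -/
def addNarrow {n : ℕ} (k : ℕ) (T : CNF n) (C : Clause n) : Timed (CNF n) := do
  let c ← width C
  let small ← op (decide (c ≤ k))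
  if small then addNew T C else pure T

/-! ### The algorithm Learn+RES -/

/-- One round of the width-`k` search: all cuts between clauses of the table. -/
def resolveRound {n : ℕ} (k : ℕ) (T : CNF n) : Timed (CNF n) :=
  loop T T fun T₁ A => loop T T₁ fun T₂ B => loop (List.finRange n) T₂ fun T₃ v => do
    let a ← op (decide ((v, true) ∈ A))
    let b ← op (decide ((v, false) ∈ B))
    if a && b then do
      let R ← resolvent A B v
      addNarrow k T₃ R
    else pure T₃

/-- Decides whether `φ` has a refutation in which all clauses have width at most `k`. There are at
most `(2n+1)^k` such clauses, so that the table is saturated after that many rounds. -/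
def wRefute {n : ℕ} (φ : CNF n) (k : ℕ) : Timed Bool := do
  let T₀ ← loop φ [] (addNarrow k)
  let T ← loop (List.range ((2 * n + 1) ^ k)) T₀ fun T _ => resolveRound k T
  loop T false fun r C => do
    let e ← sameClause C ∅
    op (r || e)

/-- All clauses with at most `w` literals, on distinct variables from the list. -/
def narrowClauses {n : ℕ} : List (Fin n) → ℕ → Timed (CNF n)
  | _, 0 => op [∅]
  | [], _ + 1 => op [∅]
  | v :: vs, w + 1 => do
    let T ← narrowClauses vs (w + 1)
    let S ← narrowClauses vs w
    loop S T fun R C => do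
      let P ← insertLiteral C (v, true)
      let N ← insertLiteral C (v, false)
      op (P :: N :: R)

/-- First phase: the CNF of all clauses of width at most `w` that are falsified on at most
`t` of the given examples. -/
def learn {n : ℕ} (w t : ℕ) {m : ℕ} (ρ : Fin m → PartialAssignment n) : Timed (CNF n) := do
  let cs ← narrowClauses (List.finRange n) w
  loop cs [] fun ψ C => do
    let falsified ← loop (List.finRange m) 0 fun f i => do
      let b ← isFalsified C (ρ i)
      if b then op (f + 1) else pure f
    let good ← op (decide (falsified ≤ t))
    if good then op (C :: ψ) else pure ψ

/-- If `C' = C'' ∨ l` (`l ∉ C''`) and `C'' ∨ ¬ l` is a subclause of `C`, deletes `¬ l` from `C`. -/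
def reduceAt {n : ℕ} (C C' : Clause n) (l : Literal n) : Timed (Clause n) := do
  let a ← op (decide (l ∈ C'))
  let b ← op (decide (Literal.neg l ∈ C))
  if a && b then do
    let s ← loop (literals n) true fun r l' => do
      let c' ← op (decide (l' ∈ C'))
      let e ← op (decide (l' = l))
      let c ← op (decide (l' ∈ C))
      op (r && (!c' || e || c))
    if s then deleteLiteral C (Literal.neg l) else pure C
  else pure C

/-- Second phase: the CNF `φ'`, obtained by reducing each clause of `φ` with the clauses of `ψ`. -/
def reduceCNF {n : ℕ} (φ ψ : CNF n) : Timed (CNF n) :=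
  loop φ [] fun R C => do
    let C₁ ← loop ψ C fun C C' => loop (literals n) C fun C l => reduceAt C C' l
    op (C₁ :: R)

/-- The algorithm with width bound `w`, `m₀` examples for learning, `m₁` examples for the
refutation phase, and thresholds `t₀`, `t₁`. The value `true` means "Accept" and `false` means
"Reject". -/
def learnRESCore {n : ℕ} (φ : CNF n) (w m₀ m₁ t₀ t₁ : ℕ)
    (ρ : Fin (m₀ + m₁) → PartialAssignment n) : Timed Bool := do
  let ψ ← learn w t₀ fun i : Fin m₀ => ρ (Fin.castAdd m₁ i)
  let φ' ← reduceCNF φ ψ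
  let χ ← loop ψ φ' fun R C => op (C :: R)
  let failed ← loop (List.finRange m₁) 0 fun f i => do
    let χr ← restrict χ (ρ (Fin.natAdd m₀ i))
    let r ← wRefute χr (2 * w)
    if r then pure f else op (f + 1)
  op (decide (failed ≤ t₁))

/-! ### The parameters -/

/-- `m₁ = (1 / (2γ²)) ln (2/δ)`, rounded up. -/
noncomputable def numTest (γ δ : ℝ) : ℕ := ⌈1 / (2 * γ ^ 2) * Real.log (2 / δ)⌉₊

/-- `w = (1 / (μβ)) ln (2 m₁ p / δ)`, rounded up, and at most the number `n` of variables. -/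
noncomputable def gapWidth (n p : ℕ) (μ γ δ β : ℝ) : ℕ :=
  min n ⌈1 / (μ * β) * Real.log (2 * numTest γ δ * p / δ)⌉₊

/-- `m₀ = (2w(2n+1)^{2w} / (μ^{2w}γ²)) ln (4(2n+1)/δ)`, rounded up. -/
noncomputable def numLearn (n w : ℕ) (μ γ δ : ℝ) : ℕ :=
  ⌈2 * w * (2 * n + 1 : ℝ) ^ (2 * w) / (μ ^ (2 * w) * γ ^ 2) *
    Real.log (4 * (2 * n + 1) / δ)⌉₊

/-- The number of examples that Learn+RES uses. -/
noncomputable def numExamples (n p : ℕ) (μ γ δ β : ℝ) : ℕ :=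
  numLearn n (gapWidth n p μ γ δ β) μ γ δ + numTest γ δ

/-- Learn+RES. A clause is learned if it is falsified on at most `(γμ^w / (2(2n+1)^w)) m₀` of the
first `m₀` examples, and the algorithm rejects if and only if the width-`2w` search fails on more
than `⌊ε m₁⌋` of the other examples. -/
noncomputable def learnRES {n : ℕ} (φ : CNF n) (p : ℕ) (μ ε γ δ β : ℝ)
    (ρ : Fin (numExamples n p μ γ δ β) → PartialAssignment n) : Timed Bool :=
  learnRESCore φ (gapWidth n p μ γ δ β)
    (numLearn n (gapWidth n p μ γ δ β) μ γ δ) (numTest γ δ)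
    ⌊γ * μ ^ gapWidth n p μ γ δ β / (2 * (2 * n + 1 : ℝ) ^ gapWidth n p μ γ δ β) *
      numLearn n (gapWidth n p μ γ δ β) μ γ δ⌋₊
    ⌊ε * numTest γ δ⌋₊ ρ

/-! ### The promise problem -/

/-- `γ / (4n(2n+1)^w)`. -/
noncomputable def gapError (n p : ℕ) (μ γ δ β : ℝ) : ℝ :=
  γ / (4 * n * (2 * n + 1 : ℝ) ^ gapWidth n p μ γ δ β)

/-- First case: `φ` is satisfied with probability at least `ε + 2γ`. -/
def SatisfiedCase {n : ℕ} (D : Measure (Assignment n)) (φ : CNF n) (ε γ : ℝ) : Prop :=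
  ε + 2 * γ ≤ D.real {x | CNF.Sat φ x}

/-- Second case: `ψ₀ ∧ ψ₁ ∧ φ` has a refutation of size at most `p` for some `ψ₀` that consists of
almost perfectly valid clauses and some `ψ₁` that is witnessed to evaluate to true with probability
at least `1 - ε + 2γ`. -/
def RefutableCase {n : ℕ} (D : Measure (Assignment n)) (φ : CNF n) (p : ℕ) (μ ε γ δ β : ℝ) :
    Prop :=
  ∃ ψ₀ ψ₁ : CNF n,
    (∀ C ∈ ψ₀, 1 - gapError n p μ γ δ β ≤ D.real {x | Clause.Sat C x}) ∧
    1 - ε + 2 * γ ≤ (maskedLaw D μ).real {ρ | CNF.WitnessedTrue ψ₁ ρ} ∧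
    HasRefutation (ψ₀ ++ ψ₁ ++ φ) p

/-- With probability at least `1 - δ` over the examples, Learn+RES rejects in the first case and
accepts in the second. -/
def LearnRESDecides {n : ℕ} (D : Measure (Assignment n)) (φ : CNF n) (p : ℕ)
    (μ ε γ δ β : ℝ) : Prop :=
  (SatisfiedCase D φ ε γ →
    1 - δ ≤ (sampleLaw D μ (numExamples n p μ γ δ β)).real
      {ρ | (learnRES φ p μ ε γ δ β ρ).val = false}) ∧
  (RefutableCase D φ p μ ε γ δ β →
    1 - δ ≤ (sampleLaw D μ (numExamples n p μ γ δ β)).real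
      {ρ | (learnRES φ p μ ε γ δ β ρ).val = true})

end PACRes

namespace PACRes

/-! ### Values of the step-counted computations -/

/-! A clause `C` on distinct variables is falsified on a masked example with probability `μ ^ C.card
* u C`, where `u C` is the probability that `C` is unsatisfied (`measureReal_falsified`). Counting
falsifications therefore estimates validity, and a union bound over the at most `(2n+1)^w` narrow
clauses controls all of them together.

Soundness, case (i): with high probability every learned clause has `u C ≤ γ/(2n+1)^w`, so all
learned clauses hold jointly up to an error `γ`, and `φ ∧ ψ` holds with probability at least `ε +
γ`. The reduced CNF `φ'` follows from `φ ∧ ψ`, so an assignment satisfying both also satisfies every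
restriction obtained by masking it, and no refutation exists there (`not_refuted_of_sat`).
Hoeffding's inequality finishes this case.

Completeness, case (ii): with high probability all clauses of width `w` with `u C ≤ nη` are learned.
A clause is settled on `ρ` if fewer than `w` of its literals can be examined so that, with `R` the
revealed ones among them, no other literal `l` is true with conditional probability at least `β`
given that `R` fails. A search that keeps examining literals of conditional probability at least `β`
reveals a true one with chance at least `μβ` each time. So a clause is neither witnessed true nor
settled with probability at most `(1-μβ)^w` (`measureReal_not_settles_le`), and the choice of `w`
allows a union bound over `p` lines and `m₁` examples.

On an example where all wide lines are witnessed true or settled and `ψ₁` is witnessed true, the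
given refutation becomes narrow: by induction every non-tautological line is witnessed true or has a
subclause of width at most `w` derivable in width `2w` (`refuted_of_settles`). By the correlation
gap, in a settled line either some `l ∨ R` is almost valid, and this is a narrow subclause, or every
`¬l ∨ R` is. Since `R` is false on `ρ`, the latter clauses yield unit clauses `¬l`, which trim a
wide resolvent down to the examined literals. For a clause of `ψ₀`, a union bound shows that the
examined literals and one more already form an almost valid clause. A wide clause of `φ'` in the
second situation would have been reduced further by a learned clause, which is impossible.

Affine distributions have the gap with `β = 1/2` because conditioning on literals leaves an affine
set, on which each variable is constant or unbiased. The step bound multiplies the sizes of the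
nested loops; the factor `μ^{-2w}` in `m₀` is absorbed into a power of `n` because `w ≤ n`. -/

@[simp] theorem Timed.bind_val {α β : Type} (x : Timed α) (f : α → Timed β) :
    (x >>= f).val = (f x.val).val := rfl

@[simp] theorem Timed.bind_steps {α β : Type} (x : Timed α) (f : α → Timed β) :
    (x >>= f).steps = x.steps + (f x.val).steps := rfl

@[simp] theorem Timed.pure_val {α : Type} (a : α) : (pure a : Timed α).val = a := rfl

@[simp] theorem op_val {α : Type} (a : α) : (op a).val = a := rfl

@[simp] theorem op_steps {α : Type} (a : α) : (op a).steps = 1 := rfl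

theorem loop_val {σ α : Type} (l : List α) (s : σ) (f : σ → α → Timed σ) :
    (loop l s f).val = l.foldl (fun s a => (f s a).val) s := by
  induction l generalizing s with
  | nil => rfl
  | cons a l ih => simp [loop, ih]

/-- The invariant `I` is there because the cost of a body may depend on the state, for instance on
the length of a growing table. -/
theorem loop_steps_le {σ α : Type} (I : σ → Prop) (c : ℕ) (f : σ → α → Timed σ) (l : List α)
    (s : σ) (hs : I s) (hI : ∀ s, I s → ∀ a ∈ l, I (f s a).val)
    (hc : ∀ s, I s → ∀ a ∈ l, (f s a).steps ≤ c) :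
    (loop l s f).steps ≤ l.length * (c + 1) + 1 := by
  induction l generalizing s with
  | nil => simp [loop]
  | cons a l ih =>
    have h₁ := hc s hs a (by simp)
    have h₂ := ih (f s a).val (hI s hs a (by simp))
      (fun s hs b hb => hI s hs b (by simp [hb])) (fun s hs b hb => hc s hs b (by simp [hb]))
    simp only [loop, Timed.bind_steps, op_steps, op_val, List.length_cons]
    linarith [Nat.add_mul l.length 1 (c + 1)]

theorem loop_steps_le' {σ α : Type} (c : ℕ) (f : σ → α → Timed σ) (l : List α)
    (s : σ) (hc : ∀ s, ∀ a ∈ l, (f s a).steps ≤ c) :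
    (loop l s f).steps ≤ l.length * (c + 1) + 1 :=
  loop_steps_le (fun _ => True) c f l s trivial (fun _ _ _ _ => trivial) fun s _ => hc s

theorem mem_literals {n : ℕ} (l : Literal n) : l ∈ literals n := by
  obtain ⟨i, b⟩ := l
  cases b <;> simp [literals]

theorem length_literals (n : ℕ) : (literals n).length = 2 * n := by
  simp [literals, mul_comm]

theorem foldl_and {α : Type} (q : α → Bool) (l : List α) (r : Bool) :
    l.foldl (fun r a => r && q a) r = true ↔ r = true ∧ ∀ a ∈ l, q a = true := by
  induction l generalizing r with
  | nil => simp
  | cons a l ih => simp [ih, and_assoc]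

theorem foldl_or {α : Type} (q : α → Bool) (l : List α) (r : Bool) :
    l.foldl (fun r a => r || q a) r = true ↔ r = true ∨ ∃ a ∈ l, q a = true := by
  induction l generalizing r with
  | nil => simp
  | cons a l ih => simp [ih, or_assoc]

theorem mem_foldl_insert {α : Type} [DecidableEq α] (q : α → Bool) (l : List α) (R : Finset α)
    (x : α) :
    x ∈ l.foldl (fun R a => if q a = true then insert a R else R) R ↔
      x ∈ R ∨ (x ∈ l ∧ q x = true) := by
  induction l generalizing R with
  | nil => simp
  | cons a l ih =>
    rw [List.foldl_cons, ih]
    by_cases h : q a = true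
    · simp only [h, if_true, Finset.mem_insert, List.mem_cons]
      constructor
      · rintro ((rfl | h') | h')
        · exact Or.inr ⟨Or.inl rfl, h⟩
        · exact Or.inl h'
        · exact Or.inr ⟨Or.inr h'.1, h'.2⟩
      · rintro (h' | ⟨rfl | h', h''⟩)
        · exact Or.inl (Or.inr h')
        · exact Or.inl (Or.inl rfl)
        · exact Or.inr ⟨h', h''⟩
    · simp only [h, List.mem_cons]
      constructor
      · rintro (h' | h')
        · exact Or.inl h'
        · exact Or.inr ⟨Or.inr h'.1, h'.2⟩
      · rintro (h' | ⟨rfl | h', h''⟩)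
        · exact Or.inl h'
        · exact absurd h'' h
        · exact Or.inr ⟨h', h''⟩

theorem Timed.ite_val {α : Type} (p : Prop) [Decidable p] (x y : Timed α) :
    (if p then x else y).val = if p then x.val else y.val := by split <;> rfl

theorem Timed.ite_steps_le {α : Type} (p : Prop) [Decidable p] (x y : Timed α) {c : ℕ}
    (hx : x.steps ≤ c) (hy : y.steps ≤ c) : (if p then x else y).steps ≤ c := by
  split <;> assumption

theorem mem_loop_insert {α : Type} [DecidableEq α] (q : α → Bool) (l : List α) (R : Finset α)
    (f : Finset α → α → Timed (Finset α))
    (hf : ∀ R a, (f R a).val = if q a = true then insert a R else R) (x : α) :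
    x ∈ (loop l R f).val ↔ x ∈ R ∨ (x ∈ l ∧ q x = true) := by
  simp only [loop_val, hf, mem_foldl_insert]

variable {n : ℕ}

/-- All literals of the clause are unmasked and false. -/
def Clause.Falsified (C : Clause n) (ρ : PartialAssignment n) : Prop :=
  ∀ l ∈ C, ρ l.1 = some (!l.2)

theorem isFalsified_val (C : Clause n) (ρ : PartialAssignment n) :
    (isFalsified C ρ).val = true ↔ Clause.Falsified C ρ := by
  simp only [isFalsified, loop_val, Timed.bind_val, op_val]
  rw [foldl_and (fun l => !decide (l ∈ C) || decide (ρ l.1 = some (!l.2)))]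
  simp only [true_and, Bool.or_eq_true, Bool.not_eq_true', decide_eq_false_iff_not,
    decide_eq_true_eq, Clause.Falsified, mem_literals, forall_const, imp_iff_not_or]

theorem isWitnessed_val (C : Clause n) (ρ : PartialAssignment n) :
    (isWitnessed C ρ).val = true ↔ Clause.WitnessedTrue C ρ := by
  simp only [isWitnessed, loop_val, Timed.bind_val, op_val]
  rw [foldl_or (fun l => decide (l ∈ C) && decide (ρ l.1 = some l.2))]
  simp [Clause.WitnessedTrue, mem_literals]

theorem mem_maskedPart (C : Clause n) (ρ : PartialAssignment n) (l : Literal n) :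
    l ∈ (maskedPart C ρ).val ↔ l ∈ C ∧ ρ l.1 = none := by
  rw [maskedPart, mem_loop_insert (fun l => decide (l ∈ C) && decide (ρ l.1 = none))
    _ _ _ fun _ _ => Timed.ite_val _ _ _]
  simp [mem_literals]

theorem mem_restrict (φ : CNF n) (ρ : PartialAssignment n) (B : Clause n) :
    B ∈ (restrict φ ρ).val ↔
      ∃ C ∈ φ, ¬ Clause.WitnessedTrue C ρ ∧ B = (maskedPart C ρ).val := by
  have key : ∀ R : CNF n, B ∈ φ.foldl (fun R C => if (isWitnessed C ρ).val = true then R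
      else (maskedPart C ρ).val :: R) R ↔
      B ∈ R ∨ ∃ C ∈ φ, ¬ Clause.WitnessedTrue C ρ ∧ B = (maskedPart C ρ).val := by
    induction φ with
    | nil => simp
    | cons C φ ih =>
      intro R
      rw [List.foldl_cons, ih]
      by_cases h : Clause.WitnessedTrue C ρ
      · simp [(isWitnessed_val C ρ).2 h, h]
      · simp [mt (isWitnessed_val C ρ).1 h, h]
        tauto
  simp only [restrict, loop_val, Timed.bind_val, op_val, Timed.ite_val, Timed.pure_val]
  simpa using key []

theorem foldl_count {α : Type} (q : α → Bool) (l : List α) (k : ℕ) :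
    l.foldl (fun k a => if q a = true then k + 1 else k) k = k + l.countP q := by
  induction l generalizing k with
  | nil => simp
  | cons a l ih =>
    rw [List.foldl_cons, ih]
    by_cases h : q a = true
    · simp [h]; omega
    · simp [h]

theorem nodup_literals (n : ℕ) : (literals n).Nodup := by
  rw [literals, List.nodup_flatMap]
  refine ⟨by simp, ?_⟩
  refine (List.nodup_finRange n).imp ?_
  intro a b hab
  simp [Function.onFun, hab.symm]

theorem width_val (C : Clause n) : (width C).val = C.card := by
  have h : ∀ k l, (fun (k : ℕ) (l : Literal n) => (do
      let c ← op (decide (l ∈ C))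
      if c then op (k + 1) else op k : Timed ℕ).val) k l =
      if decide (l ∈ C) = true then k + 1 else k := fun _ _ => Timed.ite_val _ _ _
  rw [width, loop_val, funext₂ h, foldl_count (fun l => decide (l ∈ C)), zero_add,
    List.countP_eq_length_filter,
    ← List.toFinset_card_of_nodup ((nodup_literals n).filter _)]
  congr 1
  ext l
  simp [mem_literals]

theorem sameClause_val (A B : Clause n) : (sameClause A B).val = true ↔ A = B := by
  simp only [sameClause, loop_val, Timed.bind_val, op_val]
  rw [foldl_and (fun l => decide (l ∈ A) == decide (l ∈ B))]
  simp [mem_literals, Finset.ext_iff]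

theorem insertLiteral_val (C : Clause n) (l₀ : Literal n) :
    (insertLiteral C l₀).val = insert l₀ C := by
  ext l
  rw [insertLiteral, mem_loop_insert (fun l => decide (l ∈ C) || decide (l = l₀))
    _ _ _ fun _ _ => Timed.ite_val _ _ _]
  simp [mem_literals, or_comm]

theorem deleteLiteral_val (C : Clause n) (l₀ : Literal n) :
    (deleteLiteral C l₀).val = C.erase l₀ := by
  ext l
  rw [deleteLiteral, mem_loop_insert (fun l => decide (l ∈ C) && !decide (l = l₀))
    _ _ _ fun _ _ => Timed.ite_val _ _ _]
  simp [mem_literals, and_comm]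

theorem resolvent_val (A B : Clause n) (v : Fin n) :
    (resolvent A B v).val = A.erase (v, true) ∪ B.erase (v, false) := by
  ext l
  rw [resolvent, mem_loop_insert (fun l => (decide (l ∈ A) && !decide (l = (v, true))) ||
    (decide (l ∈ B) && !decide (l = (v, false))))
    _ _ _ fun _ _ => Timed.ite_val _ _ _]
  simp only [Finset.notMem_empty, mem_literals, true_and, false_or, Finset.mem_union,
    Finset.mem_erase, Bool.or_eq_true, Bool.and_eq_true, decide_eq_true_eq, Bool.not_eq_true',
    decide_eq_false_iff_not, ne_eq]
  tauto

theorem addNew_val (T : CNF n) (C : Clause n) :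
    (addNew T C).val = if C ∈ T then T else C :: T := by
  have h : (loop T false fun r B => do
      let e ← sameClause C B
      op (r || e)).val = true ↔ C ∈ T := by
    simp only [loop_val, Timed.bind_val, op_val]
    rw [foldl_or (fun B => (sameClause C B).val)]
    simp [sameClause_val]
  simp only [addNew, Timed.bind_val, Timed.ite_val, Timed.pure_val, op_val, h]

theorem addNarrow_val (k : ℕ) (T : CNF n) (C : Clause n) :
    (addNarrow k T C).val = if C.card ≤ k ∧ C ∉ T then C :: T else T := by
  simp only [addNarrow, Timed.bind_val, Timed.ite_val, Timed.pure_val, op_val, width_val,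
    addNew_val, decide_eq_true_eq]
  by_cases h₁ : C.card ≤ k <;> by_cases h₂ : C ∈ T <;> simp [h₁, h₂]

/-! ### Bounded-width derivability and the exhaustive search -/

/-- The clauses obtained from `φ` by cuts in which all clauses have width at most `k`. -/
inductive Derivable (φ : CNF n) (k : ℕ) : Clause n → Prop
  | ax {C : Clause n} : C ∈ φ → C.card ≤ k → Derivable φ k C
  | cut {A B : Clause n} {v : Fin n} : Derivable φ k A → Derivable φ k B →
      (v, true) ∈ A → (v, false) ∈ B →
      (A.erase (v, true) ∪ B.erase (v, false)).card ≤ k →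
      Derivable φ k (A.erase (v, true) ∪ B.erase (v, false))

theorem Derivable.card_le {φ : CNF n} {k : ℕ} {C : Clause n} (h : Derivable φ k C) :
    C.card ≤ k := by
  cases h <;> assumption

theorem Derivable.sat {φ : CNF n} {k : ℕ} {C : Clause n} (h : Derivable φ k C)
    {x : Assignment n} (hx : CNF.Sat φ x) : Clause.Sat C x := by
  induction h with
  | ax h _ => exact hx _ h
  | @cut A B v _ _ _ _ _ ihA ihB =>
    obtain ⟨a, ha, ha'⟩ := ihA
    obtain ⟨b, hb, hb'⟩ := ihB
    by_cases h₁ : a = (v, true)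
    · have h₂ : b ≠ (v, false) := by
        rintro rfl
        subst h₁
        simp only [Literal.Sat] at ha' hb'
        simp [ha'] at hb'
      exact ⟨b, by simp [hb, h₂], hb'⟩
    · exact ⟨a, by simp [ha, h₁], ha'⟩

/-- The table `T'` arises from `T` by prepending new clauses with the property `P`. -/
structure Extends (P : Clause n → Prop) (T T' : CNF n) : Prop where
  suffix : T <:+ T'
  nodup : T.Nodup → T'.Nodup
  prop : (∀ C ∈ T, P C) → ∀ C ∈ T', P C

theorem Extends.refl (P : Clause n → Prop) (T : CNF n) : Extends P T T :=
  ⟨List.suffix_refl T, id, id⟩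

theorem Extends.trans {P : Clause n → Prop} {T₁ T₂ T₃ : CNF n} (h : Extends P T₁ T₂)
    (h' : Extends P T₂ T₃) : Extends P T₁ T₃ :=
  ⟨h.suffix.trans h'.suffix, h'.nodup ∘ h.nodup, h'.prop ∘ h.prop⟩

theorem Extends.foldl {α : Type} {P : Clause n → Prop} (f : CNF n → α → CNF n) (l : List α)
    (T : CNF n) (hf : ∀ T, ∀ a ∈ l, Extends P T (f T a)) : Extends P T (l.foldl f T) := by
  induction l generalizing T with
  | nil => exact Extends.refl P T
  | cons a l ih =>
    exact (hf T a (by simp)).trans (ih _ fun T b hb => hf T b (by simp [hb]))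

/-- Later iterations only prepend, so what the iteration at `a` guarantees survives to the end,
whatever the state was when `a` was reached. -/
theorem mem_foldl_of_extends {α : Type} {P : Clause n → Prop} (f : CNF n → α → CNF n)
    (l : List α) (T : CNF n) (hf : ∀ T, ∀ a ∈ l, Extends P T (f T a)) {a : α} (ha : a ∈ l)
    {C : Clause n} (hC : ∀ T, C ∈ f T a) : C ∈ l.foldl f T := by
  induction l generalizing T with
  | nil => simp at ha
  | cons b l ih =>
    rcases List.mem_cons.1 ha with rfl | ha
    · exact (Extends.foldl f l (f T a) fun T b hb => hf T b (by simp [hb])).suffix.subset (hC T)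
    · exact ih (f T b) (fun T b hb => hf T b (by simp [hb])) ha

theorem extends_addNarrow {P : Clause n → Prop} {k : ℕ} {C : Clause n} (hC : C.card ≤ k → P C)
    (T : CNF n) : Extends P T (addNarrow k T C).val := by
  rw [addNarrow_val]
  split_ifs with h
  · refine ⟨List.suffix_cons C T, fun hT => List.nodup_cons.2 ⟨h.2, hT⟩, fun hT B hB => ?_⟩
    rcases List.mem_cons.1 hB with rfl | hB
    · exact hC h.1
    · exact hT B hB
  · exact Extends.refl P T

theorem mem_addNarrow {k : ℕ} {C : Clause n} (hC : C.card ≤ k) (T : CNF n) :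
    C ∈ (addNarrow k T C).val := by
  rw [addNarrow_val]
  split_ifs with h
  · simp
  · by_contra hmem
    exact h ⟨hC, hmem⟩

/-- One step of a round of the search. -/
def resolveStep (k : ℕ) (A B : Clause n) (T : CNF n) (v : Fin n) : CNF n :=
  if (v, true) ∈ A ∧ (v, false) ∈ B then
    (addNarrow k T (A.erase (v, true) ∪ B.erase (v, false))).val
  else T

theorem resolveRound_body_val (k : ℕ) (A B : Clause n) (T : CNF n) (v : Fin n) :
    (do
      let a ← op (decide ((v, true) ∈ A))
      let b ← op (decide ((v, false) ∈ B))
      if a && b then do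
        let R ← resolvent A B v
        addNarrow k T R
      else pure T : Timed (CNF n)).val = resolveStep k A B T v := by
  by_cases h₁ : (v, true) ∈ A <;> by_cases h₂ : (v, false) ∈ B <;>
    simp [resolveStep, h₁, h₂, resolvent_val]

theorem resolveRound_val (k : ℕ) (T : CNF n) :
    (resolveRound k T).val = T.foldl (fun T₁ A => T.foldl (fun T₂ B =>
      (List.finRange n).foldl (resolveStep k A B) T₂) T₁) T := by
  simp only [resolveRound, loop_val, resolveRound_body_val]

theorem extends_resolveStep {P : Clause n → Prop} {k : ℕ} {A B : Clause n}
    (hP : ∀ v, (v, true) ∈ A → (v, false) ∈ B →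
      (A.erase (v, true) ∪ B.erase (v, false)).card ≤ k →
      P (A.erase (v, true) ∪ B.erase (v, false))) (T : CNF n) (v : Fin n) :
    Extends P T (resolveStep k A B T v) := by
  rw [resolveStep]
  split_ifs with h
  · exact extends_addNarrow (hP v h.1 h.2) T
  · exact Extends.refl P T

theorem extends_resolveRound {P : Clause n → Prop} {k : ℕ} {T : CNF n}
    (hP : ∀ A ∈ T, ∀ B ∈ T, ∀ v, (v, true) ∈ A → (v, false) ∈ B →
      (A.erase (v, true) ∪ B.erase (v, false)).card ≤ k →
      P (A.erase (v, true) ∪ B.erase (v, false))) :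
    Extends P T (resolveRound k T).val := by
  rw [resolveRound_val]
  exact Extends.foldl _ _ _ fun T₁ A hA => Extends.foldl _ _ _ fun T₂ B hB =>
    Extends.foldl _ _ _ fun T₃ v _ => extends_resolveStep (hP A hA B hB) T₃ v

theorem mem_resolveRound {k : ℕ} {T : CNF n} {A B : Clause n} {v : Fin n} (hA : A ∈ T)
    (hB : B ∈ T) (hv : (v, true) ∈ A) (hv' : (v, false) ∈ B)
    (hk : (A.erase (v, true) ∪ B.erase (v, false)).card ≤ k) :
    A.erase (v, true) ∪ B.erase (v, false) ∈ (resolveRound k T).val := by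
  have hs : ∀ (A B : Clause n) (T : CNF n) (v : Fin n),
      Extends (fun _ => True) T (resolveStep k A B T v) :=
    fun A B => extends_resolveStep fun _ _ _ _ => trivial
  rw [resolveRound_val]
  refine mem_foldl_of_extends (P := fun _ => True) _ _ _ (fun T₁ A _ =>
    Extends.foldl _ _ _ fun T₂ B _ => Extends.foldl _ _ _ fun T₃ v _ => hs A B T₃ v) hA fun T₁ => ?_
  refine mem_foldl_of_extends (P := fun _ => True) _ _ _ (fun T₂ B _ =>
    Extends.foldl _ _ _ fun T₃ v _ => hs A B T₃ v) hB fun T₂ => ?_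
  refine mem_foldl_of_extends (P := fun _ => True) _ _ _ (fun T₃ v _ => hs A B T₃ v)
    (List.mem_finRange v) fun T₃ => ?_
  rw [resolveStep, if_pos ⟨hv, hv'⟩]
  exact mem_addNarrow hk T₃

/-- Such a clause is the set of entries of `k` slots, each holding one of the `2n` literals or left
blank. -/
theorem card_narrow_le (n k : ℕ) :
    (Finset.univ.filter fun C : Clause n => C.card ≤ k).card ≤ (2 * n + 1) ^ k := by
  let f : (Fin k → Option (Literal n)) → Clause n := fun g =>
    Finset.univ.filter fun l => ∃ i, g i = some l
  have hsub : (Finset.univ.filter fun C : Clause n => C.card ≤ k) ⊆ Finset.univ.image f := by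
    intro C hC
    have hC : C.card ≤ k := (Finset.mem_filter.1 hC).2
    refine Finset.mem_image.2 ⟨fun i => if h : i.1 < C.card then some (C.equivFin.symm ⟨i, h⟩).1
      else none, Finset.mem_univ _, ?_⟩
    ext l
    simp only [f, Finset.mem_filter, Finset.mem_univ, true_and]
    constructor
    · rintro ⟨i, hi⟩
      split_ifs at hi with h
      · simp only [Option.some.injEq] at hi
        rw [← hi]
        exact (C.equivFin.symm ⟨i, h⟩).2
    · intro hl
      refine ⟨⟨C.equivFin ⟨l, hl⟩, lt_of_lt_of_le (Fin.is_lt _) hC⟩, ?_⟩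
      simp
  calc _ ≤ (Finset.univ.image f).card := Finset.card_le_card hsub
    _ ≤ (Finset.univ : Finset (Fin k → Option (Literal n))).card := Finset.card_image_le
    _ = (2 * n + 1) ^ k := by simp [mul_comm]

theorem length_le_of_narrow {k : ℕ} {T : CNF n} (hT : T.Nodup) (hk : ∀ C ∈ T, C.card ≤ k) :
    T.length ≤ (2 * n + 1) ^ k := by
  rw [← List.toFinset_card_of_nodup hT]
  refine (Finset.card_le_card ?_).trans (card_narrow_le n k)
  intro C hC
  simpa using hk C (List.mem_toFinset.1 hC)

/-- The table of the search after its initialization and `r` rounds. -/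
def searchTable (φ : CNF n) (k r : ℕ) : CNF n :=
  (fun T => (resolveRound k T).val)^[r] (φ.foldl (fun T C => (addNarrow k T C).val) [])

theorem foldl_range_iterate {σ : Type} (f : σ → σ) (r : ℕ) (s : σ) :
    (List.range r).foldl (fun s _ => f s) s = f^[r] s := by
  induction r with
  | zero => rfl
  | succ r ih => rw [List.range_succ, List.foldl_append, ih, Function.iterate_succ_apply']; rfl

theorem wRefute_val_iff_mem (φ : CNF n) (k : ℕ) :
    (wRefute φ k).val = true ↔ ∅ ∈ searchTable φ k ((2 * n + 1) ^ k) := by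
  simp only [wRefute, Timed.bind_val, loop_val, op_val, foldl_range_iterate]
  rw [foldl_or (fun C => (sameClause C ∅).val)]
  simp [sameClause_val, searchTable]

theorem searchTable_succ (φ : CNF n) (k r : ℕ) :
    searchTable φ k (r + 1) = (resolveRound k (searchTable φ k r)).val :=
  Function.iterate_succ_apply' _ _ _

theorem searchTable_zero_extends (φ : CNF n) (k : ℕ) :
    Extends (Derivable φ k) [] (searchTable φ k 0) :=
  Extends.foldl _ _ _ fun T _ hC => extends_addNarrow (Derivable.ax hC) T

theorem mem_searchTable_zero {φ : CNF n} {k : ℕ} {C : Clause n} (hC : C ∈ φ) (hk : C.card ≤ k) :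
    C ∈ searchTable φ k 0 :=
  mem_foldl_of_extends (P := fun _ => True) _ _ _
    (fun T _ _ => extends_addNarrow (fun _ => trivial) T) hC fun T => mem_addNarrow hk T

theorem searchTable_inv (φ : CNF n) (k r : ℕ) :
    (searchTable φ k r).Nodup ∧ ∀ C ∈ searchTable φ k r, Derivable φ k C := by
  induction r with
  | zero =>
    exact ⟨(searchTable_zero_extends φ k).nodup List.nodup_nil,
      (searchTable_zero_extends φ k).prop (by simp)⟩
  | succ r ih =>
    have h : Extends (Derivable φ k) (searchTable φ k r) (searchTable φ k (r + 1)) := by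
      rw [searchTable_succ]
      exact extends_resolveRound fun A hA B hB v => Derivable.cut (ih.2 A hA) (ih.2 B hB)
    exact ⟨h.nodup ih.1, h.prop ih.2⟩

theorem searchTable_suffix_succ (φ : CNF n) (k r : ℕ) :
    searchTable φ k r <:+ searchTable φ k (r + 1) := by
  rw [searchTable_succ]
  exact (extends_resolveRound (P := fun _ => True) fun _ _ _ _ _ _ _ _ => trivial).suffix

theorem searchTable_length_le (φ : CNF n) (k r : ℕ) :
    (searchTable φ k r).length ≤ (2 * n + 1) ^ k :=
  length_le_of_narrow (searchTable_inv φ k r).1 fun C hC =>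
    ((searchTable_inv φ k r).2 C hC).card_le

/-- A round that changes the table adds at least one clause, and once a round changes nothing no
later round does. Together with the length bound, this forces saturation after `(2n+1)^k` rounds. -/
theorem searchTable_stable_or_le_length (φ : CNF n) (k r : ℕ) :
    searchTable φ k (r + 1) = searchTable φ k r ∨ r < (searchTable φ k (r + 1)).length := by
  induction r with
  | zero =>
    by_cases h : (searchTable φ k (0 + 1)).length = 0
    · left
      have h' := (searchTable_suffix_succ φ k 0).length_le
      rw [List.length_eq_zero_iff.1 h, eq_comm]
      exact List.length_eq_zero_iff.1 (by omega)
    · right; omega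
  | succ r ih =>
    have hs := searchTable_suffix_succ φ k (r + 1)
    rcases ih with ih | ih
    · left
      rw [searchTable_succ _ _ (r + 1), ih, ← searchTable_succ, ih]
    · by_cases h : (searchTable φ k (r + 1)).length = (searchTable φ k (r + 1 + 1)).length
      · exact Or.inl (hs.eq_of_length h).symm
      · right
        have := hs.length_le
        omega

theorem searchTable_stable (φ : CNF n) (k : ℕ) :
    searchTable φ k ((2 * n + 1) ^ k + 1) = searchTable φ k ((2 * n + 1) ^ k) := by
  rcases searchTable_stable_or_le_length φ k ((2 * n + 1) ^ k) with h | h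
  · exact h
  · exact absurd (searchTable_length_le φ k _) (not_le.2 h)

theorem searchTable_subset (φ : CNF n) (k r : ℕ) : searchTable φ k 0 ⊆ searchTable φ k r := by
  induction r with
  | zero => exact fun _ => id
  | succ r ih => exact fun _ h => (searchTable_suffix_succ φ k r).subset (ih h)

/-- Completeness is an induction on derivations: the final table contains the narrow axioms and,
being unchanged by a further round, is closed under narrow cuts. -/
theorem wRefute_val (φ : CNF n) (k : ℕ) :
    (wRefute φ k).val = true ↔ Derivable φ k ∅ := by
  rw [wRefute_val_iff_mem]
  refine ⟨(searchTable_inv φ k _).2 ∅, ?_⟩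
  suffices h : ∀ C, Derivable φ k C → C ∈ searchTable φ k ((2 * n + 1) ^ k) from h ∅
  intro C hC
  induction hC with
  | ax h hk => exact searchTable_subset φ k _ (mem_searchTable_zero h hk)
  | cut _ _ hv hv' hk ihA ihB =>
    rw [← searchTable_stable, searchTable_succ]
    exact mem_resolveRound ihA ihB hv hv' hk

/-! ### The learned clauses -/

/-- The literals of the clause are on distinct variables. -/
def Clause.Proper (C : Clause n) : Prop := ∀ v, ¬ ((v, true) ∈ C ∧ (v, false) ∈ C)

theorem Clause.Proper.mono {C C' : Clause n} (h : Clause.Proper C') (hC : C ⊆ C') :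
    Clause.Proper C := fun v hv => h v ⟨hC hv.1, hC hv.2⟩

theorem Clause.Proper.eq_of_fst_eq {C : Clause n} (h : Clause.Proper C) {l l' : Literal n}
    (hl : l ∈ C) (hl' : l' ∈ C) (he : l.1 = l'.1) : l = l' := by
  obtain ⟨v, b⟩ := l
  obtain ⟨v', b'⟩ := l'
  obtain rfl : v = v' := he
  cases b <;> cases b'
  · rfl
  · exact absurd ⟨hl', hl⟩ (h v)
  · exact absurd ⟨hl, hl'⟩ (h v)
  · rfl

theorem Clause.Proper.injOn {C : Clause n} (h : Clause.Proper C) :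
    Set.InjOn Prod.fst (C : Set (Literal n)) :=
  fun _ hl _ hl' he => h.eq_of_fst_eq hl hl' he

theorem Clause.Proper.card_le {C : Clause n} (h : Clause.Proper C) : C.card ≤ n := by
  rw [← Finset.card_image_of_injOn h.injOn]
  exact (Finset.card_le_univ _).trans (by simp)

theorem Clause.Proper.insert {C : Clause n} (h : Clause.Proper C) {l : Literal n}
    (hl : ∀ l' ∈ C, l'.1 ≠ l.1) : Clause.Proper (insert l C) := by
  rintro v ⟨h₁, h₂⟩
  rcases Finset.mem_insert.1 h₁ with h₁ | h₁ <;> rcases Finset.mem_insert.1 h₂ with h₂ | h₂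
  · simp [← h₁] at h₂
  · exact hl _ h₂ (by rw [← h₁])
  · exact hl _ h₁ (by rw [← h₂])
  · exact h v ⟨h₁, h₂⟩

theorem mem_foldl_cons_cons {α : Type} (f g : α → α) (S T : List α) (x : α) :
    x ∈ S.foldl (fun R C => f C :: g C :: R) T ↔ x ∈ T ∨ ∃ C ∈ S, x = f C ∨ x = g C := by
  induction S generalizing T with
  | nil => simp
  | cons C S ih =>
    rw [List.foldl_cons, ih]
    simp only [List.mem_cons, exists_eq_or_imp]
    generalize (∃ C ∈ S, x = f C ∨ x = g C) = p
    tauto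

theorem mem_narrowClauses (vs : List (Fin n)) (hvs : vs.Nodup) (w : ℕ) (C : Clause n) :
    C ∈ (narrowClauses vs w).val ↔
      C.card ≤ w ∧ Clause.Proper C ∧ ∀ l ∈ C, l.1 ∈ vs := by
  have hempty : ∀ C : Clause n, C = ∅ → Clause.Proper C ∧ ∀ l ∈ C, l.1 ∈ vs := by
    rintro _ rfl
    simp [Clause.Proper]
  induction vs generalizing w C with
  | nil =>
    have h : (narrowClauses ([] : List (Fin n)) w).val = [∅] := by cases w <;> rfl
    rw [h, List.mem_singleton]
    constructor
    · rintro rfl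
      simp [Clause.Proper]
    · rintro ⟨_, _, h⟩
      exact Finset.eq_empty_of_forall_notMem fun l hl => by simpa using h l hl
  | cons v vs ih =>
    cases w with
    | zero =>
      simp only [narrowClauses, op_val, List.mem_singleton, Nat.le_zero, Finset.card_eq_zero]
      exact ⟨fun h => ⟨h, hempty C h⟩, fun h => h.1⟩
    | succ w =>
      have hv := (List.nodup_cons.1 hvs).1
      have ih' : ∀ (w : ℕ) (C : Clause n), C ∈ (narrowClauses vs w).val ↔
          C.card ≤ w ∧ Clause.Proper C ∧ ∀ l ∈ C, l.1 ∈ vs := fun w C =>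
        ih (List.nodup_cons.1 hvs).2 w C (by rintro _ rfl; simp [Clause.Proper])
      simp only [narrowClauses, Timed.bind_val, loop_val, op_val, insertLiteral_val]
      rw [mem_foldl_cons_cons, ih']
      simp only [ih']
      constructor
      · have aux : ∀ (C₀ : Clause n) (b : Bool),
            (C₀.card ≤ w ∧ Clause.Proper C₀ ∧ ∀ l ∈ C₀, l.1 ∈ vs) →
            (insert (v, b) C₀).card ≤ w + 1 ∧ Clause.Proper (insert (v, b) C₀) ∧
              ∀ l ∈ insert (v, b) C₀, l.1 ∈ v :: vs := by
          rintro C₀ b ⟨h₁, h₂, h₃⟩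
          refine ⟨(Finset.card_insert_le _ _).trans (by omega), h₂.insert fun l hl he => ?_, ?_⟩
          · exact hv ((show l.1 = v from he) ▸ h₃ l hl)
          · intro l hl
            rcases Finset.mem_insert.1 hl with rfl | hl
            · simp
            · simp [h₃ l hl]
        rintro (⟨h₁, h₂, h₃⟩ | ⟨C₀, h, rfl | rfl⟩)
        · exact ⟨h₁, h₂, fun l hl => by simp [h₃ l hl]⟩
        · exact aux C₀ true h
        · exact aux C₀ false h
      · rintro ⟨h₁, h₂, h₃⟩
        by_cases h : ∃ b, (v, b) ∈ C
        · right
          obtain ⟨b, hb⟩ := h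
          refine ⟨C.erase (v, b), ⟨?_, h₂.mono (Finset.erase_subset _ _), ?_⟩, ?_⟩
          · rw [Finset.card_erase_of_mem hb]; omega
          · intro l hl
            have hl' := Finset.mem_of_mem_erase hl
            rcases List.mem_cons.1 (h₃ l hl') with h | h
            · exact absurd (h₂.eq_of_fst_eq hl' hb h) (Finset.ne_of_mem_erase hl)
            · exact h
          · cases b
            · right; rw [Finset.insert_erase hb]
            · left; rw [Finset.insert_erase hb]
        · left
          refine ⟨h₁, h₂, fun l hl => ?_⟩
          rcases List.mem_cons.1 (h₃ l hl) with h' | h'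
          · exact absurd ⟨l.2, by rw [← h']; exact hl⟩ h
          · exact h'

open Classical in
theorem countP_finRange {m : ℕ} (P : Fin m → Prop) (q : Fin m → Bool)
    (h : ∀ i, q i = true ↔ P i) :
    (List.finRange m).countP q = (Finset.univ.filter P).card := by
  rw [List.countP_eq_length_filter, ← List.toFinset_card_of_nodup
    ((List.nodup_finRange m).filter _)]
  congr 1
  ext i
  simp [h]

theorem mem_foldl_filter {α : Type} (q : α → Bool) (l R : List α) (x : α) :
    x ∈ l.foldl (fun R a => if q a = true then a :: R else R) R ↔
      x ∈ R ∨ (x ∈ l ∧ q x = true) := by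
  induction l generalizing R with
  | nil => simp
  | cons a l ih =>
    rw [List.foldl_cons, ih]
    by_cases h : q a = true
    · simp only [h, if_true, List.mem_cons]
      constructor
      · rintro ((rfl | h') | h')
        · exact Or.inr ⟨Or.inl rfl, h⟩
        · exact Or.inl h'
        · exact Or.inr ⟨Or.inr h'.1, h'.2⟩
      · rintro (h' | ⟨rfl | h', h''⟩)
        · exact Or.inl (Or.inr h')
        · exact Or.inl (Or.inl rfl)
        · exact Or.inr ⟨h', h''⟩
    · simp only [h, List.mem_cons]
      constructor
      · rintro (h' | h')
        · exact Or.inl h'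
        · exact Or.inr ⟨Or.inr h'.1, h'.2⟩
      · rintro (h' | ⟨rfl | h', h''⟩)
        · exact Or.inl h'
        · exact absurd h'' h
        · exact Or.inr ⟨h', h''⟩

open Classical in
theorem mem_learn {w t m : ℕ} (ρ : Fin m → PartialAssignment n) (C : Clause n) :
    C ∈ (learn w t ρ).val ↔ C.card ≤ w ∧ Clause.Proper C ∧
      (Finset.univ.filter fun i => Clause.Falsified C (ρ i)).card ≤ t := by
  have h : ∀ C : Clause n, (loop (List.finRange m) 0 fun f i => do
      let b ← isFalsified C (ρ i)
      if b then op (f + 1) else pure f).val =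
      (Finset.univ.filter fun i => Clause.Falsified C (ρ i)).card := by
    intro C
    simp only [loop_val, Timed.bind_val, Timed.ite_val, op_val, Timed.pure_val]
    rw [foldl_count (fun i => (isFalsified C (ρ i)).val), zero_add]
    exact countP_finRange _ _ fun i => isFalsified_val C (ρ i)
  have h' : (learn w t ρ).val = (narrowClauses (List.finRange n) w).val.foldl
      (fun ψ C => if decide ((Finset.univ.filter fun i => Clause.Falsified C (ρ i)).card ≤ t) = true
        then C :: ψ else ψ) [] := by
    rw [learn, Timed.bind_val, loop_val]
    congr 1
    funext ψ C
    rw [Timed.bind_val, h]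
    exact Timed.ite_val _ _ _
  rw [h', mem_foldl_filter (fun C =>
    decide ((Finset.univ.filter fun i => Clause.Falsified C (ρ i)).card ≤ t)),
    mem_narrowClauses _ (List.nodup_finRange n)]
  simp [and_assoc]

/-! ### The reduced clauses -/

theorem reduceAt_val (C C' : Clause n) (l : Literal n) :
    (reduceAt C C' l).val =
      if l ∈ C' ∧ Literal.neg l ∈ C ∧ C'.erase l ⊆ C then C.erase (Literal.neg l) else C := by
  have h : (loop (literals n) true fun r l' => do
      let c' ← op (decide (l' ∈ C'))
      let e ← op (decide (l' = l))
      let c ← op (decide (l' ∈ C))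
      op (r && (!c' || e || c))).val = true ↔ C'.erase l ⊆ C := by
    simp only [loop_val, Timed.bind_val, op_val]
    rw [foldl_and (fun l' => !decide (l' ∈ C') || decide (l' = l) || decide (l' ∈ C))]
    simp only [true_and, mem_literals, forall_const, Bool.or_eq_true, Bool.not_eq_true',
      decide_eq_false_iff_not, decide_eq_true_eq, Finset.subset_iff, Finset.mem_erase]
    refine forall_congr' fun l' => ?_
    tauto
  by_cases h₁ : l ∈ C' <;> by_cases h₂ : Literal.neg l ∈ C <;> by_cases h₃ : C'.erase l ⊆ C <;>
    simp [reduceAt, h₁, h₂, h₃, h, deleteLiteral_val]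

/-- The clause that the second phase makes out of `C`. -/
def reduceClause (ψ : CNF n) (C : Clause n) : Clause n :=
  ψ.foldl (fun C C' => (literals n).foldl (fun C l => (reduceAt C C' l).val) C) C

theorem mem_reduceCNF (φ ψ : CNF n) (B : Clause n) :
    B ∈ (reduceCNF φ ψ).val ↔ ∃ C ∈ φ, B = reduceClause ψ C := by
  have key : ∀ R : CNF n, B ∈ φ.foldl (fun R C => reduceClause ψ C :: R) R ↔
      B ∈ R ∨ ∃ C ∈ φ, B = reduceClause ψ C := by
    induction φ with
    | nil => simp
    | cons C φ ih =>
      intro R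
      rw [List.foldl_cons, ih]
      simp only [List.mem_cons, exists_eq_or_imp]
      tauto
  simp only [reduceCNF, loop_val, Timed.bind_val, op_val]
  exact (key []).trans (by simp)

theorem reduceAt_subset (C C' : Clause n) (l : Literal n) : (reduceAt C C' l).val ⊆ C := by
  rw [reduceAt_val]
  split_ifs
  · exact Finset.erase_subset _ _
  · exact subset_rfl

theorem foldl_subset {α β : Type} [DecidableEq β] (f : Finset β → α → Finset β) (l : List α)
    (hf : ∀ C, ∀ a ∈ l, f C a ⊆ C) (C : Finset β) : l.foldl f C ⊆ C := by
  induction l generalizing C with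
  | nil => exact subset_rfl
  | cons a l ih =>
    exact (ih (fun C b hb => hf C b (by simp [hb])) _).trans (hf C a (by simp))

/-- Isolates the accumulator at the moment `a` is processed; everything that follows only shrinks
the result. -/
theorem foldl_subset_step {α β : Type} [DecidableEq β] (f : Finset β → α → Finset β) (l : List α)
    (hf : ∀ C, ∀ a ∈ l, f C a ⊆ C) (C : Finset β) {a : α} (ha : a ∈ l) :
    ∃ C', l.foldl f C ⊆ f C' a := by
  induction l generalizing C with
  | nil => simp at ha
  | cons b l ih =>
    rcases List.mem_cons.1 ha with rfl | ha
    · exact ⟨C, foldl_subset f l (fun C b hb => hf C b (by simp [hb])) _⟩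
    · exact ih (fun C b hb => hf C b (by simp [hb])) _ ha

theorem reduceClause_subset (ψ : CNF n) (C : Clause n) : reduceClause ψ C ⊆ C :=
  foldl_subset _ _ (fun C C' _ => foldl_subset _ _ (fun C l _ => reduceAt_subset C C' l) C) C

/-- No learned clause reduces the clause any further. -/
theorem reduceClause_irreducible (ψ : CNF n) (C : Clause n) {C' : Clause n} (hC' : C' ∈ ψ)
    {l : Literal n} (hl : l ∈ C') (hneg : Literal.neg l ∈ reduceClause ψ C) :
    ¬ C'.erase l ⊆ reduceClause ψ C := by
  intro hsub
  obtain ⟨C₁, h₁⟩ := foldl_subset_step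
    (fun C C' => (literals n).foldl (fun C l => (reduceAt C C' l).val) C) ψ
    (fun C C' _ => foldl_subset _ _ (fun C l _ => reduceAt_subset C C' l) C) C hC'
  obtain ⟨C₂, h₂⟩ := foldl_subset_step (fun C l => (reduceAt C C' l).val) (literals n)
    (fun C l _ => reduceAt_subset C C' l) C₁ (mem_literals l)
  have h₃ : reduceClause ψ C ⊆ (reduceAt C₂ C' l).val := h₁.trans h₂
  have h₄ := h₃.trans (reduceAt_subset _ _ _)
  -- `C₂` is the clause just before `C'` is tried at `l`. It contains the final clause, so the test
  -- succeeds there and `¬ l` is deleted for good. This is why a single pass leaves nothing to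
  -- reduce.
  rw [reduceAt_val, if_pos ⟨hl, h₄ hneg, hsub.trans h₄⟩] at h₃
  simpa using h₃ hneg

theorem Literal.Sat.not_neg {l : Literal n} {x : Assignment n} (h : Literal.Sat l x) :
    ¬ Literal.Sat (Literal.neg l) x := by
  simp only [Literal.Sat, Literal.neg] at h ⊢
  simp [h]

theorem Clause.Proper.neg_notMem {C : Clause n} (hC : Clause.Proper C) {l : Literal n}
    (hl : l ∈ C) : Literal.neg l ∉ C := by
  intro hl'
  have := congrArg Prod.snd (hC.eq_of_fst_eq hl hl' rfl)
  simp [Literal.neg] at this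

/-- The shortened clause is the resolvent of `C` and `C'` on `l`, as the rest of `C'` lies in `C`.
Properness of `C'` excludes that its true literal is the deleted `¬ l`. -/
theorem reduceAt_sat {C C' : Clause n} {l : Literal n} {x : Assignment n}
    (hC : Clause.Sat C x) (hC' : Clause.Sat C' x) (hp : Clause.Proper C') :
    Clause.Sat (reduceAt C C' l).val x := by
  rw [reduceAt_val]
  split_ifs with h
  · obtain ⟨a, ha, hx⟩ := hC
    by_cases he : a = Literal.neg l
    · obtain ⟨b, hb, hx'⟩ := hC'
      have hbl : b ≠ l := by
        rintro rfl
        exact hx'.not_neg (he ▸ hx)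
      refine ⟨b, Finset.mem_erase.2 ⟨?_, h.2.2 (Finset.mem_erase.2 ⟨hbl, hb⟩)⟩, hx'⟩
      rintro rfl
      exact hp.neg_notMem h.1 hb
    · exact ⟨a, Finset.mem_erase.2 ⟨he, ha⟩, hx⟩
  · exact hC

theorem reduceClause_sat {ψ : CNF n} {C : Clause n} {x : Assignment n} (hC : Clause.Sat C x)
    (hψ : CNF.Sat ψ x) (hp : ∀ C' ∈ ψ, Clause.Proper C') :
    Clause.Sat (reduceClause ψ C) x := by
  have fold : ∀ {α : Type} (f : Clause n → α → Clause n) (l : List α),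
      (∀ C, ∀ a ∈ l, Clause.Sat C x → Clause.Sat (f C a) x) →
      ∀ C, Clause.Sat C x → Clause.Sat (l.foldl f C) x := by
    intro α f l hf
    induction l with
    | nil => exact fun C hC => hC
    | cons a l ih =>
      exact fun C hC => ih (fun C b hb => hf C b (by simp [hb])) _ (hf C a (by simp) hC)
  exact fold _ _ (fun C C' hC' => fold _ _ (fun C l _ h =>
    reduceAt_sat h (hψ C' hC') (hp C' hC')) C) C hC

/-! ### The value of the algorithm -/

theorem mem_foldl_cons {α : Type} (l R : List α) (x : α) :
    x ∈ l.foldl (fun R a => a :: R) R ↔ x ∈ R ∨ x ∈ l := by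
  induction l generalizing R with
  | nil => simp
  | cons a l ih =>
    rw [List.foldl_cons, ih]
    simp only [List.mem_cons]
    tauto

/-- The CNF `φ' ∧ ψ` that is refuted in the third phase. -/
def testCNF (φ ψ : CNF n) : CNF n := ψ.foldl (fun R C => C :: R) (reduceCNF φ ψ).val

theorem mem_testCNF (φ ψ : CNF n) (B : Clause n) :
    B ∈ testCNF φ ψ ↔ (∃ C ∈ φ, B = reduceClause ψ C) ∨ B ∈ ψ := by
  rw [testCNF, mem_foldl_cons, mem_reduceCNF]

/-- The width-`2w` search refutes the restriction of `φ' ∧ ψ` under `ρ`. -/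
def Refuted (φ ψ : CNF n) (w : ℕ) (ρ : PartialAssignment n) : Prop :=
  Derivable (restrict (testCNF φ ψ) ρ).val (2 * w) ∅

open Classical in
theorem learnRESCore_val (φ : CNF n) (w m₀ m₁ t₀ t₁ : ℕ)
    (ρ : Fin (m₀ + m₁) → PartialAssignment n) :
    (learnRESCore φ w m₀ m₁ t₀ t₁ ρ).val = true ↔
      (Finset.univ.filter fun i : Fin m₁ => ¬ Refuted φ
        (learn w t₀ fun i : Fin m₀ => ρ (Fin.castAdd m₁ i)).val w (ρ (Fin.natAdd m₀ i))).card
        ≤ t₁ := by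
  simp only [learnRESCore, Timed.bind_val, op_val, loop_val, decide_eq_true_eq]
  generalize (learn w t₀ fun i : Fin m₀ => ρ (Fin.castAdd m₁ i)).val = ψ
  have h : ∀ (f : ℕ) (i : Fin m₁), (if (wRefute (restrict (testCNF φ ψ)
      (ρ (Fin.natAdd m₀ i))).val (2 * w)).val = true then pure f else op (f + 1) : Timed ℕ).val =
      if (!(wRefute (restrict (testCNF φ ψ) (ρ (Fin.natAdd m₀ i))).val (2 * w)).val) = true
        then f + 1 else f := by
    intro f i
    cases (wRefute (restrict (testCNF φ ψ) (ρ (Fin.natAdd m₀ i))).val (2 * w)).val <;> simp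
  rw [show ψ.foldl (fun s a => a :: s) (reduceCNF φ ψ).val = testCNF φ ψ from rfl]
  simp only [h]
  rw [foldl_count (fun i => !(wRefute (restrict (testCNF φ ψ)
    (ρ (Fin.natAdd m₀ i))).val (2 * w)).val), zero_add,
    countP_finRange (fun i => ¬ Refuted φ ψ w (ρ (Fin.natAdd m₀ i)))]
  · convert Iff.rfl
  · intro i
    rw [Bool.not_eq_true', ← Bool.not_eq_true, wRefute_val, Refuted]

/-- An assignment that satisfies `φ` and the learned clauses prevents a refutation. -/
theorem not_refuted_of_sat {φ ψ : CNF n} {w : ℕ} {ρ : PartialAssignment n} {x : Assignment n}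
    (hρ : ∀ i b, ρ i = some b → x i = b) (hφ : CNF.Sat φ x) (hψ : CNF.Sat ψ x)
    (hp : ∀ C ∈ ψ, Clause.Proper C) : ¬ Refuted φ ψ w ρ := by
  intro h
  have hsat : CNF.Sat (restrict (testCNF φ ψ) ρ).val x := by
    intro B hB
    obtain ⟨C, hC, hw, rfl⟩ := (mem_restrict _ _ _).1 hB
    have hCx : Clause.Sat C x := by
      rcases (mem_testCNF φ ψ C).1 hC with ⟨C₀, hC₀, rfl⟩ | hC
      · exact reduceClause_sat (hφ C₀ hC₀) hψ hp
      · exact hψ C hC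
    obtain ⟨l, hl, hx⟩ := hCx
    refine ⟨l, (mem_maskedPart C ρ l).2 ⟨hl, ?_⟩, hx⟩
    -- An unmasked true literal would witness `C`, and witnessed clauses are dropped by the
    -- restriction.
    by_contra hne
    obtain ⟨b, hb⟩ := Option.ne_none_iff_exists'.1 hne
    have : b = l.2 := (hρ _ _ hb).symm.trans hx
    exact hw ⟨l, hl, this ▸ hb⟩
  obtain ⟨l, hl, _⟩ := Derivable.sat h hsat
  simp at hl

/-! ### Narrow refutations of restrictions -/

theorem Literal.neg_neg (l : Literal n) : Literal.neg (Literal.neg l) = l := by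
  simp [Literal.neg]

/-- Cutting with a unit clause never increases the width, so the bound `k` is respected
automatically. The two cases only reflect the orientation of a cut. -/
theorem Derivable.erase_of_neg {φ : CNF n} {k : ℕ} {S : Clause n} {l : Literal n}
    (hS : Derivable φ k S) (hl : l ∈ S) (hu : Derivable φ k {Literal.neg l}) :
    Derivable φ k (S.erase l) := by
  have hk : (S.erase l).card ≤ k := (Finset.card_le_card (Finset.erase_subset _ _)).trans hS.card_le
  obtain ⟨v, b⟩ := l
  cases b
  · have he : (({Literal.neg (v, false)} : Clause n).erase (v, true)) ∪ S.erase (v, false) =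
        S.erase (v, false) := by
      simp [Literal.neg]
    have h := Derivable.cut (v := v) hu hS (by simp [Literal.neg]) hl (by rw [he]; exact hk)
    rwa [he] at h
  · have he : S.erase (v, true) ∪ (({Literal.neg (v, true)} : Clause n).erase (v, false)) =
        S.erase (v, true) := by
      simp [Literal.neg]
    have h := Derivable.cut (v := v) hS hu hl (by simp [Literal.neg]) (by rw [he]; exact hk)
    rwa [he] at h

/-- On `ρ`, the clause is true or has a subclause on masked variables of width at most `w` that the
width-`2w` search derives from the restriction of `χ`. -/
def Narrow (χ : CNF n) (w : ℕ) (ρ : PartialAssignment n) (C : Clause n) : Prop :=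
  Clause.WitnessedTrue C ρ ∨ ∃ B ⊆ C, (∀ l ∈ B, ρ l.1 = none) ∧ B.card ≤ w ∧
    Derivable (restrict χ ρ).val (2 * w) B

theorem Clause.WitnessedTrue.mono {C C' : Clause n} {ρ : PartialAssignment n}
    (h : Clause.WitnessedTrue C ρ) (hC : C ⊆ C') : Clause.WitnessedTrue C' ρ :=
  let ⟨l, hl, hρ⟩ := h
  ⟨l, hC hl, hρ⟩

/-- Weakening costs nothing because only a subclause has to be derived; hence the search can do
without a weakening rule. -/
theorem Narrow.mono {χ : CNF n} {w : ℕ} {ρ : PartialAssignment n} {C C' : Clause n}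
    (h : Narrow χ w ρ C) (hC : C ⊆ C') : Narrow χ w ρ C' := by
  rcases h with h | ⟨B, hB, h⟩
  · exact Or.inl (h.mono hC)
  · exact Or.inr ⟨B, hB.trans hC, h⟩

theorem narrow_of_mem {χ : CNF n} {w : ℕ} (ρ : PartialAssignment n) {C : Clause n} (hC : C ∈ χ)
    (hw : C.card ≤ w) : Narrow χ w ρ C := by
  by_cases h : Clause.WitnessedTrue C ρ
  · exact Or.inl h
  · have hsub : (maskedPart C ρ).val ⊆ C := fun l hl => ((mem_maskedPart C ρ l).1 hl).1
    have hc := (Finset.card_le_card hsub).trans hw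
    exact Or.inr ⟨(maskedPart C ρ).val, hsub, fun l hl => ((mem_maskedPart C ρ l).1 hl).2, hc,
      Derivable.ax ((mem_restrict χ ρ _).2 ⟨C, hC, h, rfl⟩) (by omega)⟩

/-- The width `2 * w` is needed here, for the resolvent of two clauses of width at most `w`. The
bound `w` is lost for `S` and must be restored by the user of the lemma. If `v` is unmasked, its
literal in one premise is false on `ρ`, and what is known of that premise passes to the conclusion.
-/
theorem Narrow.cut {χ : CNF n} {w : ℕ} {ρ : PartialAssignment n} {A B : Clause n} {v : Fin n}
    (hA : Narrow χ w ρ (insert (v, true) A)) (hB : Narrow χ w ρ (insert (v, false) B)) :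
    Clause.WitnessedTrue (A ∪ B) ρ ∨ ∃ S ⊆ A ∪ B, (∀ l ∈ S, ρ l.1 = none) ∧
      Derivable (restrict χ ρ).val (2 * w) S := by
  have hsub : ∀ {S A : Clause n} {l : Literal n}, S ⊆ insert l A → l ∉ S → S ⊆ A := by
    intro S A l hS hl a ha
    rcases Finset.mem_insert.1 (hS ha) with rfl | h
    · exact absurd ha hl
    · exact h
  rcases hA with ⟨a, ha, haρ⟩ | ⟨S₁, hS₁, hm₁, hc₁, hd₁⟩
  · rcases Finset.mem_insert.1 ha with rfl | ha
    · rcases hB with ⟨b, hb, hbρ⟩ | ⟨S₂, hS₂, hm₂, hc₂, hd₂⟩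
      · rcases Finset.mem_insert.1 hb with rfl | hb
        · simp only at haρ hbρ
          simp [haρ] at hbρ
        · exact Or.inl ⟨b, Finset.mem_union_right _ hb, hbρ⟩
      · refine Or.inr ⟨S₂, (hsub hS₂ fun h => ?_).trans Finset.subset_union_right, hm₂, hd₂⟩
        have := hm₂ _ h
        simp only at haρ this
        simp [haρ] at this
    · exact Or.inl ⟨a, Finset.mem_union_left _ ha, haρ⟩
  · rcases hB with ⟨b, hb, hbρ⟩ | ⟨S₂, hS₂, hm₂, hc₂, hd₂⟩
    · rcases Finset.mem_insert.1 hb with rfl | hb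
      · refine Or.inr ⟨S₁, (hsub hS₁ fun h => ?_).trans Finset.subset_union_left, hm₁, hd₁⟩
        have := hm₁ _ h
        simp only at hbρ this
        simp [hbρ] at this
      · exact Or.inl ⟨b, Finset.mem_union_right _ hb, hbρ⟩
    · by_cases h₁ : (v, true) ∈ S₁
      · by_cases h₂ : (v, false) ∈ S₂
        · right
          have hsub' : S₁.erase (v, true) ∪ S₂.erase (v, false) ⊆ A ∪ B := by
            refine Finset.union_subset_union (hsub ((Finset.erase_subset _ _).trans hS₁) ?_)
              (hsub ((Finset.erase_subset _ _).trans hS₂) ?_) <;> simp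
          refine ⟨_, hsub', ?_, Derivable.cut hd₁ hd₂ h₁ h₂ ?_⟩
          · intro l hl
            rcases Finset.mem_union.1 hl with hl | hl
            · exact hm₁ l (Finset.mem_of_mem_erase hl)
            · exact hm₂ l (Finset.mem_of_mem_erase hl)
          · refine (Finset.card_union_le _ _).trans ?_
            have := Finset.card_erase_le (s := S₁) (a := (v, true))
            have := Finset.card_erase_le (s := S₂) (a := (v, false))
            omega
        · exact Or.inr ⟨S₂, (hsub hS₂ h₂).trans Finset.subset_union_right, hm₂, hd₂⟩
      · exact Or.inr ⟨S₁, (hsub hS₁ h₁).trans Finset.subset_union_left, hm₁, hd₁⟩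

/-! ### Gap functions, settled clauses and the narrowing of refutations -/

/-- `u C` behaves like the probability that `C` is unsatisfied, and it has a correlation gap. -/
structure GapFunction (u : Clause n → ℝ) (w : ℕ) (β η : ℝ) : Prop where
  anti : ∀ {C C'}, C ⊆ C' → u C' ≤ u C
  split : ∀ C l, u C ≤ u (insert l C) + u (insert (Literal.neg l) C)
  -- `u (insert (Literal.neg l) C)` is the mass on which `C` fails and `l` holds. So given that `C`
  -- fails, `l` is true with conditional probability at least `β`, or one of the two values of `l`
  -- has mass at most `η`.
  gap : ∀ C : Clause n, C.card ≤ w → ∀ l, β * u C ≤ u (insert (Literal.neg l) C) ∨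
    u (insert (Literal.neg l) C) ≤ η ∨ u (insert l C) ≤ η

/-- The literals of the clause whose variables are unmasked. -/
def revealedPart (C : Clause n) (ρ : PartialAssignment n) : Clause n :=
  C.filter fun l => ρ l.1 ≠ none

/-- After fewer than `w` literals of `C` have been examined, all others are determined up to a small
error by the values seen. -/
def Settles (u : Clause n → ℝ) (β : ℝ) (w : ℕ) (C : Clause n) (ρ : PartialAssignment n) : Prop :=
  ∃ Q ⊆ C, Q.card < w ∧ ∀ l ∈ C, l ∉ Q →
    ¬ β * u (revealedPart Q ρ) ≤ u (insert (Literal.neg l) (revealedPart Q ρ))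

/-- All sufficiently valid clauses of width `w` are in `ψ`. -/
def LearnsValid (u : Clause n → ℝ) (w : ℕ) (η : ℝ) (ψ : CNF n) : Prop :=
  ∀ C : Clause n, Clause.Proper C → C.card = w → u C ≤ n * η → C ∈ ψ

section

variable {u : Clause n → ℝ} {w : ℕ} {β η : ℝ} {ψ χ : CNF n} {ρ : PartialAssignment n}

/-- The learning threshold is calibrated to `μ^w`, so narrower valid clauses may fail to be learned.
They are recovered by adding fresh variables in both signs up to width `w`, which preserves near
validity, and cutting these variables away again. Fresh variables exist because `w ≤ n`. -/
theorem narrow_of_valid (hu : GapFunction u w β η) (hψ : LearnsValid u w η ψ) (hχ : ψ ⊆ χ)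
    (hwn : w ≤ n) (ρ : PartialAssignment n) {C : Clause n} (hp : Clause.Proper C)
    (hC : C.card ≤ w) (huC : u C ≤ n * η) : Narrow χ w ρ C := by
  obtain ⟨d, hd⟩ := Nat.exists_eq_add_of_le hC
  induction d generalizing C with
  | zero => exact narrow_of_mem ρ (hχ (hψ C hp (by omega) huC)) hC
  | succ d ih =>
    obtain ⟨v, hv⟩ : ∃ v, v ∉ C.image Prod.fst := by
      by_contra h
      push Not at h
      have h' : (Finset.univ : Finset (Fin n)).card ≤ (C.image Prod.fst).card :=
        Finset.card_le_card fun v _ => h v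
      have := Finset.card_image_le (s := C) (f := Prod.fst)
      simp at h'
      omega
    have hv' : ∀ l ∈ C, l.1 ≠ v := fun l hl he => hv (Finset.mem_image.2 ⟨l, hl, he⟩)
    have key : ∀ b, Narrow χ w ρ (insert (v, b) C) := by
      intro b
      have hcard : (insert (v, b) C).card = C.card + 1 :=
        Finset.card_insert_of_notMem fun h => hv' _ h rfl
      exact ih (hp.insert hv') (by omega) ((hu.anti (Finset.subset_insert _ _)).trans huC)
        (by omega)
    rcases (key true).cut (key false) with h | ⟨S, hS, hm, hd⟩
    · exact Or.inl (by simpa using h)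
    · rw [Finset.union_self] at hS
      exact Or.inr ⟨S, hS, hm, (Finset.card_le_card hS).trans hC, hd⟩

/-- In a settled clause that is not true, the literals outside the examined set `Q` are almost
certainly false, or some narrow subclause is derived. -/
theorem Settles.narrow_or (hu : GapFunction u w β η) (hψ : LearnsValid u w η ψ) (hχ : ψ ⊆ χ)
    (hwn : w ≤ n) (hn : 1 ≤ n) (hη : 0 ≤ η) {C : Clause n} (hp : Clause.Proper C)
    (hs : Settles u β w C ρ) (hC : ¬ Clause.WitnessedTrue C ρ) :
    Narrow χ w ρ C ∨ ∃ Q R, R ⊆ Q ∧ Q ⊆ C ∧ Q.card < w ∧ (∀ l ∈ R, ρ l.1 = some (!l.2)) ∧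
      ∀ l ∈ C, l ∉ Q → u (insert (Literal.neg l) R) ≤ η := by
  obtain ⟨Q, hQC, hQ, h⟩ := hs
  have hRQ : revealedPart Q ρ ⊆ Q := Finset.filter_subset _ _
  have hRw : (revealedPart Q ρ).card < w := (Finset.card_le_card hRQ).trans_lt hQ
  -- If some `l ∨ R` is almost valid, it is itself a narrow subclause of `C`. Otherwise settledness
  -- and the gap leave only the option that every `¬ l ∨ R` with `l` outside `Q` is almost valid.
  by_cases hex : ∃ l ∈ C, u (insert l (revealedPart Q ρ)) ≤ η
  · obtain ⟨l, hl, hle⟩ := hex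
    left
    have hsub : insert l (revealedPart Q ρ) ⊆ C :=
      Finset.insert_subset hl (hRQ.trans hQC)
    refine (narrow_of_valid hu hψ hχ hwn ρ (hp.mono hsub)
      ((Finset.card_insert_le _ _).trans hRw) (hle.trans ?_)).mono hsub
    have : (1 : ℝ) ≤ n := by exact_mod_cast hn
    nlinarith
  · right
    push Not at hex
    refine ⟨Q, revealedPart Q ρ, hRQ, hQC, hQ, fun l hl => ?_, fun l hl hlQ => ?_⟩
    · obtain ⟨b, hb⟩ := Option.ne_none_iff_exists'.1 (Finset.mem_filter.1 hl).2
      have hne : b ≠ l.2 := by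
        rintro rfl
        exact hC ⟨l, hQC (hRQ hl), hb⟩
      rw [hb, Bool.eq_not.2 hne]
    · rcases hu.gap _ hRw.le l with h' | h' | h'
      · exact absurd h' (h l hl hlQ)
      · exact h'
      · exact absurd h' (not_le.2 (hex l hl))

theorem Clause.Proper.insert_neg {C R : Clause n} (hp : Clause.Proper C) (hR : R ⊆ C)
    {l : Literal n} (hl : l ∈ C) (hlR : l ∉ R) :
    Clause.Proper (Insert.insert (Literal.neg l) R) := by
  refine (hp.mono hR).insert fun l' hl' he => hlR ?_
  rwa [← hp.eq_of_fst_eq (hR hl') hl he]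

/-- A derived subclause of a settled clause can be made narrow. -/
theorem Settles.narrow_of_derivable (hu : GapFunction u w β η) (hψ : LearnsValid u w η ψ)
    (hχ : ψ ⊆ χ) (hwn : w ≤ n) (hn : 1 ≤ n) (hη : 0 ≤ η) {C : Clause n} (hp : Clause.Proper C)
    (hs : Settles u β w C ρ) {S : Clause n} (hS : S ⊆ C) (hm : ∀ l ∈ S, ρ l.1 = none)
    (hd : Derivable (restrict χ ρ).val (2 * w) S) : Narrow χ w ρ C := by
  by_cases hC : Clause.WitnessedTrue C ρ
  · exact Or.inl hC
  rcases hs.narrow_or hu hψ hχ hwn hn hη hp hC with h | ⟨Q, R, hRQ, hQC, hQ, hR, h⟩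
  · exact h
  by_cases hempty : Derivable (restrict χ ρ).val (2 * w) ∅
  · exact Or.inr ⟨∅, by simp, by simp, by simp, hempty⟩
  -- `¬ l ∨ R` is almost valid and `R` is false on `ρ`, so the masked subclause derived from it is
  -- `{¬ l}` or empty, and the empty one has been excluded.
  have hunit : ∀ l ∈ C, l ∉ Q → ρ l.1 = none →
      Derivable (restrict χ ρ).val (2 * w) {Literal.neg l} := by
    intro l hl hlQ hlρ
    have hle : u (insert (Literal.neg l) R) ≤ n * η := by
      have : (1 : ℝ) ≤ n := by exact_mod_cast hn
      nlinarith [h l hl hlQ]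
    have hRw : R.card < w := (Finset.card_le_card hRQ).trans_lt hQ
    rcases narrow_of_valid hu hψ hχ hwn ρ (hp.insert_neg (hRQ.trans hQC) hl fun h => hlQ (hRQ h))
      ((Finset.card_insert_le _ _).trans hRw) hle with ⟨a, ha, haρ⟩ | ⟨B, hB, hBm, hBw, hBd⟩
    · rcases Finset.mem_insert.1 ha with rfl | ha
      · have : ρ l.1 = some (!l.2) := haρ
        simp [hlρ] at this
      · rw [hR a ha] at haρ
        simp at haρ
    · have hB' : B ⊆ {Literal.neg l} := by
        intro a ha
        rcases Finset.mem_insert.1 (hB ha) with rfl | ha'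
        · simp
        · have := hBm a ha
          simp [hR a ha'] at this
      rcases Finset.subset_singleton_iff.1 hB' with rfl | rfl
      · exact absurd hBd hempty
      · exact hBd
  -- The unit clauses remove the literals outside `Q` one by one; what remains lies in `Q` and has
  -- width below `w`.
  have helim : ∀ (d : ℕ) (S : Clause n), (S \ Q).card = d → S ⊆ C → (∀ l ∈ S, ρ l.1 = none) →
      Derivable (restrict χ ρ).val (2 * w) S → Narrow χ w ρ C := by
    intro d
    induction d with
    | zero =>
      intro S hd hS hm hS'
      have hSQ : S ⊆ Q := Finset.sdiff_eq_empty_iff_subset.1 (Finset.card_eq_zero.1 hd)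
      exact Or.inr ⟨S, hS, hm, ((Finset.card_le_card hSQ).trans_lt hQ).le, hS'⟩
    | succ d ih =>
      intro S hd hS hm hS'
      obtain ⟨l, hl⟩ : (S \ Q).Nonempty := Finset.card_pos.1 (by omega)
      obtain ⟨hlS, hlQ⟩ := Finset.mem_sdiff.1 hl
      refine ih (S.erase l) ?_ ((Finset.erase_subset _ _).trans hS)
        (fun a ha => hm a (Finset.mem_of_mem_erase ha))
        (hS'.erase_of_neg hlS (hunit l (hS hlS) hlQ (hm l hlS)))
      rw [Finset.erase_sdiff_comm, Finset.card_erase_of_mem hl]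
      omega
  exact helim _ S rfl hS hm hd

/-- A union bound: if `Q` fails, then `Q ∪ S` fails too or some `l ∈ S` is true while `R ⊆ Q` fails.
-/
theorem GapFunction.le_add_sum (hu : GapFunction u w β η) {R Q : Clause n} (hRQ : R ⊆ Q)
    (S : Clause n) : u Q ≤ u (Q ∪ S) + ∑ l ∈ S, u (insert (Literal.neg l) R) := by
  induction S using Finset.induction_on with
  | empty => simp
  | @insert l S hl ih =>
    rw [Finset.sum_insert hl]
    have h₁ := hu.split (Q ∪ S) l
    have h₂ : u (insert (Literal.neg l) (Q ∪ S)) ≤ u (insert (Literal.neg l) R) :=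
      hu.anti (Finset.insert_subset_insert _ (hRQ.trans Finset.subset_union_left))
    rw [Finset.union_insert]
    linarith

/-- A settled clause that is almost valid has a narrow subclause. -/
theorem Settles.narrow_of_valid (hu : GapFunction u w β η) (hψ : LearnsValid u w η ψ)
    (hχ : ψ ⊆ χ) (hwn : w ≤ n) (hn : 1 ≤ n) (hη : 0 ≤ η) {C : Clause n} (hp : Clause.Proper C)
    (hs : Settles u β w C ρ) (hw : w < C.card) (huC : u C ≤ η) : Narrow χ w ρ C := by
  by_cases hC : Clause.WitnessedTrue C ρ
  · exact Or.inl hC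
  rcases hs.narrow_or hu hψ hχ hwn hn hη hp hC with h | ⟨Q, R, hRQ, hQC, hQ, hR, h⟩
  · exact h
  obtain ⟨l, hlC, hlQ⟩ : ∃ l ∈ C, l ∉ Q := by
    by_contra hcon
    push Not at hcon
    have := Finset.card_le_card (show C ⊆ Q from hcon)
    omega
  -- The additional literal `l` saves one error term: at most `n - 1` literals remain outside, and
  -- with `u C ≤ η` the total error is at most `n * η`, the tolerance in `LearnsValid`.
  have hsub : insert l Q ⊆ C := Finset.insert_subset hlC hQC
  have hunion : insert l Q ∪ C \ insert l Q = C := Finset.union_sdiff_of_subset hsub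
  have h₁ := hu.le_add_sum (hRQ.trans (Finset.subset_insert l Q)) (C \ insert l Q)
  rw [hunion] at h₁
  have h₂ : ∑ l' ∈ C \ insert l Q, u (insert (Literal.neg l') R) ≤
      (C \ insert l Q).card • η := by
    refine Finset.sum_le_card_nsmul _ _ _ fun l' hl' => ?_
    obtain ⟨hl₁, hl₂⟩ := Finset.mem_sdiff.1 hl'
    exact h l' hl₁ fun hq => hl₂ (Finset.mem_insert_of_mem hq)
  have h₃ : (C \ insert l Q).card + 1 ≤ n := by
    rw [Finset.card_sdiff_of_subset hsub, Finset.card_insert_of_notMem hlQ]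
    have := hp.card_le
    omega
  have h₄ : ((C \ insert l Q).card : ℝ) + 1 ≤ n := by exact_mod_cast h₃
  refine (PACRes.narrow_of_valid hu hψ hχ hwn ρ (hp.mono hsub)
    ((Finset.card_insert_le _ _).trans hQ) ?_).mono hsub
  rw [nsmul_eq_mul] at h₂
  nlinarith

/-- The reduced input clauses have narrow subclauses. -/
theorem Settles.narrow_reduceClause (hu : GapFunction u w β η) (hψ : LearnsValid u w η ψ)
    (hχ : ψ ⊆ χ) (hwn : w ≤ n) (hn : 1 ≤ n) (hη : 0 ≤ η) {C : Clause n}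
    (hp : Clause.Proper (reduceClause ψ C)) (hs : Settles u β w (reduceClause ψ C) ρ)
    (hw : w < (reduceClause ψ C).card) : Narrow χ w ρ (reduceClause ψ C) := by
  by_cases hC : Clause.WitnessedTrue (reduceClause ψ C) ρ
  · exact Or.inl hC
  rcases hs.narrow_or hu hψ hχ hwn hn hη hp hC with h | ⟨Q, R, hRQ, hQC, hQ, hR, h⟩
  · exact h
  -- Nothing is known about the validity of an input clause, so the argument for `ψ₀` is not
  -- available. Instead, near validity of some `¬ l ∨ R` contradicts irreducibility.
  exfalso
  obtain ⟨l, hlC, hlQ⟩ : ∃ l ∈ reduceClause ψ C, l ∉ Q := by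
    by_contra hcon
    push Not at hcon
    have := Finset.card_le_card (show reduceClause ψ C ⊆ Q from hcon)
    omega
  have hRC : R ⊆ (reduceClause ψ C).erase l := fun a ha =>
    Finset.mem_erase.2 ⟨fun he => hlQ (he ▸ hRQ ha), hQC (hRQ ha)⟩
  have hRw : R.card < w := (Finset.card_le_card hRQ).trans_lt hQ
  -- `R` is padded within the clause to exactly `w - 1` literals because `LearnsValid` speaks only
  -- of width exactly `w`.
  obtain ⟨X, hRX, hXC, hX⟩ := Finset.exists_subsuperset_card_eq hRC (show R.card ≤ w - 1 by omega)
    (by rw [Finset.card_erase_of_mem hlC]; omega)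
  have hXC' : X ⊆ reduceClause ψ C := hXC.trans (Finset.erase_subset _ _)
  have hlX : l ∉ X := fun hl => by simpa using hXC hl
  have hnX : Literal.neg l ∉ X := fun hl => hp.neg_notMem hlC (hXC' hl)
  have hmem : insert (Literal.neg l) X ∈ ψ := by
    refine hψ _ (hp.insert_neg hXC' hlC hlX) ?_ ?_
    · rw [Finset.card_insert_of_notMem hnX]
      omega
    · have h₁ := hu.anti (Finset.insert_subset_insert (Literal.neg l) hRX)
      have h₂ := h l hlC hlQ
      have : (1 : ℝ) ≤ n := by exact_mod_cast hn
      nlinarith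
  -- The learned clause `X ∨ ¬ l`, with `X` inside the reduced clause, would have deleted `l` from
  -- it.
  refine reduceClause_irreducible ψ C hmem (Finset.mem_insert_self _ _)
    (by rwa [Literal.neg_neg]) ?_
  rw [Finset.erase_insert hnX]
  exact hXC'

open Classical in
/-- The clause whose settling is relevant for the line `C` of a refutation. -/
noncomputable def relevantClause (φ ψ : CNF n) (C : Clause n) : Clause n :=
  if C ∈ φ then reduceClause ψ C else C

/-- A refutation turns into a narrow one on every example on which all wide lines settle. -/
theorem refuted_of_settles {φ ψ₀ ψ₁ : CNF n} (hu : GapFunction u w β η)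
    (hψ : LearnsValid u w η ψ) (hwn : w ≤ n) (hn : 1 ≤ n) (hη : 0 ≤ η)
    (hψ₀ : ∀ C ∈ ψ₀, u C ≤ η) (hψ₁ : CNF.WitnessedTrue ψ₁ ρ) {k : ℕ}
    {C : Fin (k + 1) → Clause n} (hC : IsRefutation (ψ₀ ++ ψ₁ ++ φ) C)
    (hs : ∀ i, Clause.Proper (relevantClause φ ψ (C i)) → w < (relevantClause φ ψ (C i)).card →
      ¬ Clause.WitnessedTrue (relevantClause φ ψ (C i)) ρ →
      Settles u β w (relevantClause φ ψ (C i)) ρ) :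
    Refuted φ ψ w ρ := by
  have hχ : ψ ⊆ testCNF φ ψ := fun B hB => (mem_testCNF φ ψ B).2 (Or.inr hB)
  -- Tautological lines are exempt from the claim; the last line is empty, hence proper.
  suffices key : ∀ i, Clause.Proper (C i) → Narrow (testCNF φ ψ) w ρ (C i) by
    have h := key (Fin.last k)
    rw [hC.1] at h
    rcases h (by simp [Clause.Proper]) with ⟨l, hl, _⟩ | ⟨B, hB, _, _, hd⟩
    · simp at hl
    · rwa [Finset.subset_empty.1 hB] at hd
  intro i
  induction i using WellFoundedLT.induction with
  | _ i ih =>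
    intro hp
    by_cases hφ : C i ∈ φ
    · have hsub := reduceClause_subset ψ (C i)
      have hs' := hs i
      rw [relevantClause, if_pos hφ] at hs'
      refine Narrow.mono ?_ hsub
      by_cases hw : (reduceClause ψ (C i)).card ≤ w
      · exact narrow_of_mem ρ ((mem_testCNF φ ψ _).2 (Or.inl ⟨C i, hφ, rfl⟩)) hw
      · by_cases hwit : Clause.WitnessedTrue (reduceClause ψ (C i)) ρ
        · exact Or.inl hwit
        · exact (hs' (hp.mono hsub) (not_le.1 hw) hwit).narrow_reduceClause hu hψ hχ hwn hn hη
            (hp.mono hsub) (not_le.1 hw)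
    have hs' := hs i
    rw [relevantClause, if_neg hφ] at hs'
    by_cases hwit : Clause.WitnessedTrue (C i) ρ
    · exact Or.inl hwit
    rcases hC.2 i with h | ⟨j, hj, hji⟩ | ⟨j, hj, l, hl, v, A, B, hA, hB, hAB⟩
    · rcases List.mem_append.1 h with h | h
      · rcases List.mem_append.1 h with h | h
        · by_cases hw : (C i).card ≤ w
          · refine narrow_of_valid hu hψ hχ hwn ρ hp hw ?_
            have : (1 : ℝ) ≤ n := by exact_mod_cast hn
            nlinarith [hψ₀ _ h]
          · exact (hs' hp (not_le.1 hw) hwit).narrow_of_valid hu hψ hχ hwn hn hη hp (not_le.1 hw)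
              (hψ₀ _ h)
        · exact Or.inl (hψ₁ _ h)
      · exact absurd h hφ
    · exact (ih j hj (hp.mono hji)).mono hji
    · have hsubA : A ⊆ C i := hAB ▸ Finset.subset_union_left
      have hsubB : B ⊆ C i := hAB ▸ Finset.subset_union_right
      -- If a literal of the cut variable occurs in the conclusion, one premise is contained in it.
      -- Otherwise both premises inherit properness from the conclusion and the induction hypothesis
      -- applies to both.
      by_cases hv : (v, true) ∈ C i
      · have hsub : C j ⊆ C i := hA ▸ Finset.insert_subset hv hsubA
        exact (ih j hj (hp.mono hsub)).mono hsub
      by_cases hv' : (v, false) ∈ C i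
      · have hsub : C l ⊆ C i := hB ▸ Finset.insert_subset hv' hsubB
        exact (ih l hl (hp.mono hsub)).mono hsub
      have hne : ∀ l ∈ C i, l.1 ≠ v := by
        rintro ⟨v', b⟩ hb rfl
        cases b
        · exact hv' hb
        · exact hv hb
      have h₁ := ih j hj (hA ▸ (hp.mono hsubA).insert fun l hl => hne l (hsubA hl))
      have h₂ := ih l hl (hB ▸ (hp.mono hsubB).insert fun l hl => hne l (hsubB hl))
      rw [hA] at h₁
      rw [hB] at h₂
      rcases h₁.cut h₂ with h | ⟨S, hS, hm, hd⟩
      · exact absurd (hAB ▸ h) hwit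
      · rw [← hAB] at hS
        by_cases hw : (C i).card ≤ w
        · exact Or.inr ⟨S, hS, hm, (Finset.card_le_card hS).trans hw, hd⟩
        · exact (hs' hp (not_le.1 hw) hwit).narrow_of_derivable hu hψ hχ hwn hn hη hp hS hm hd

end

/-! ### Concentration of the number of hits of a set -/

section Concentration

variable {X : Type}

open Classical in
/-- The number of sample points in `A`. -/
noncomputable def hits {m : ℕ} (A : Set X) (ρ : Fin m → X) : ℕ :=
  (Finset.univ.filter fun i => ρ i ∈ A).card

theorem hits_eq_sum {m : ℕ} (A : Set X) (ρ : Fin m → X) :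
    (hits A ρ : ℝ) = ∑ i, A.indicator (fun _ => (1 : ℝ)) (ρ i) := by
  classical
  simp [hits, Finset.sum_boole, Set.indicator_apply]

theorem hits_add_hits_compl {m : ℕ} (A : Set X) (ρ : Fin m → X) :
    (hits A ρ : ℝ) + hits Aᶜ ρ = m := by
  rw [hits_eq_sum, hits_eq_sum, ← Finset.sum_add_distrib]
  simp

theorem hits_mono {m : ℕ} {A B : Set X} {ρ : Fin m → X} (h : ∀ i, ρ i ∈ A → ρ i ∈ B) :
    hits A ρ ≤ hits B ρ := by
  classical
  exact Finset.card_le_card fun i hi => by simpa using h i (by simpa using hi)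

variable [MeasurableSpace X] [DiscreteMeasurableSpace X]

/-- Upper tail of Hoeffding's inequality. -/
theorem measureReal_hits_ge_le (P : Measure X) [IsProbabilityMeasure P] (A : Set X) (m : ℕ)
    {q s : ℝ} (hq : P.real A ≤ q) (hs : 0 ≤ s) :
    (Measure.pi fun _ : Fin m => P).real {ρ | (q + s) * m ≤ hits A ρ} ≤
      Real.exp (-(2 * s ^ 2 * m)) := by
  have hmeas : Measurable (A.indicator fun _ => (1 : ℝ)) := Measurable.of_discrete
  have hintegral : ∫ x, A.indicator (fun _ => (1 : ℝ)) x ∂P = P.real A := by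
    rw [integral_indicator (MeasurableSet.of_discrete)]
    simp
  have hind : iIndepFun (fun (i : Fin m) (ρ : Fin m → X) =>
      A.indicator (fun _ => (1 : ℝ)) (ρ i) - P.real A) (Measure.pi fun _ => P) :=
    iIndepFun_pi (X := fun _ x => A.indicator (fun _ => (1 : ℝ)) x - P.real A)
      fun _ => (hmeas.sub_const _).aemeasurable
  have hsub : ∀ i : Fin m, HasSubgaussianMGF (fun ρ : Fin m → X =>
      A.indicator (fun _ => (1 : ℝ)) (ρ i) - P.real A) ((‖(1 : ℝ) - 0‖₊ / 2) ^ 2)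
      (Measure.pi fun _ => P) := by
    intro i
    have h := hasSubgaussianMGF_of_mem_Icc (μ := Measure.pi fun _ : Fin m => P) (a := 0) (b := 1)
      (X := fun ρ : Fin m → X => A.indicator (fun _ => (1 : ℝ)) (ρ i))
      (hmeas.comp (measurable_pi_apply i)).aemeasurable
      (Filter.Eventually.of_forall fun ρ => by
        by_cases h : ρ i ∈ A <;> simp [h])
    rwa [integral_comp_eval (μ := fun _ : Fin m => P) (i := i) hmeas.aestronglyMeasurable,
      hintegral] at h
  have h := HasSubgaussianMGF.measure_sum_ge_le_of_iIndepFun hind (s := Finset.univ)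
    (fun i _ => hsub i) (ε := s * m) (by positivity)
  have hexp : -(s * m) ^ 2 / (2 * ((∑ _i : Fin m, (‖(1 : ℝ) - 0‖₊ / 2) ^ 2 : NNReal) : ℝ)) =
      -(2 * s ^ 2 * m) := by
    -- For `m = 0` the denominator vanishes; division by zero gives `0`, which agrees with the
    -- right-hand side.
    rcases Nat.eq_zero_or_pos m with rfl | hm
    · simp
    · have : (0 : ℝ) < m := by exact_mod_cast hm
      simp
      field_simp
  rw [hexp] at h
  refine (measureReal_mono fun ρ hρ => ?_).trans h
  simp only [Set.mem_ofPred_eq] at hρ ⊢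
  rw [Finset.sum_sub_distrib, ← hits_eq_sum]
  simp only [Finset.sum_const, Finset.card_univ, Fintype.card_fin, nsmul_eq_mul]
  nlinarith [Nat.cast_nonneg (α := ℝ) m]

/-- Lower tail of Hoeffding's inequality. -/
theorem measureReal_hits_le_le (P : Measure X) [IsProbabilityMeasure P] (A : Set X) (m : ℕ)
    {q s : ℝ} (hq : q ≤ P.real A) (hs : 0 ≤ s) :
    (Measure.pi fun _ : Fin m => P).real {ρ | (hits A ρ : ℝ) ≤ (q - s) * m} ≤
      Real.exp (-(2 * s ^ 2 * m)) := by
  have hc : P.real Aᶜ ≤ 1 - q := by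
    rw [probReal_compl_eq_one_sub MeasurableSet.of_discrete]
    linarith
  refine (measureReal_mono fun ρ hρ => ?_).trans (measureReal_hits_ge_le P Aᶜ m hc hs)
  simp only [Set.mem_ofPred_eq] at hρ ⊢
  linarith [hits_add_hits_compl A ρ]

/-- A Chernoff bound for exceeding twice the expected number of hits. -/
theorem measureReal_hits_gt_le [Finite X] (P : Measure X) [IsProbabilityMeasure P] (A : Set X)
    (m : ℕ) {t : ℝ} (ht : P.real A ≤ t / 2) :
    (Measure.pi fun _ : Fin m => P).real {ρ | t * m < hits A ρ} ≤
      Real.exp (-((Real.log 2 - 1 / 2) * (t * m))) := by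
  -- Markov's inequality is applied to `2 ^ hits`, a product of independent factors with mean `1 +
  -- P.real A ≤ exp (t / 2)`.
  set f : X → ℝ := fun x => 1 + A.indicator (fun _ => (1 : ℝ)) x
  have hprod : ∀ ρ : Fin m → X, ∏ i, f (ρ i) = (2 : ℝ) ^ (hits A ρ : ℝ) := by
    intro ρ
    classical
    rw [Real.rpow_natCast, hits, ← Finset.prod_const, Finset.prod_filter]
    refine Finset.prod_congr rfl fun i _ => ?_
    by_cases h : ρ i ∈ A <;> simp [f, h]
    norm_num
  have hintegral : ∫ x, f x ∂P = 1 + P.real A := by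
    rw [integral_add Integrable.of_finite Integrable.of_finite,
      integral_indicator (MeasurableSet.of_discrete)]
    simp
  have hE : ∫ ρ, ∏ i, f (ρ i) ∂(Measure.pi fun _ : Fin m => P) = (1 + P.real A) ^ m := by
    rw [integral_fintype_prod_eq_pow, hintegral, Fintype.card_fin]
  have hmark := mul_meas_ge_le_integral_of_nonneg (μ := Measure.pi fun _ : Fin m => P)
    (f := fun ρ => ∏ i, f (ρ i))
    (Filter.Eventually.of_forall fun ρ => Finset.prod_nonneg fun i _ => by
      by_cases h : ρ i ∈ A <;> simp [f, h]) Integrable.of_finite ((2 : ℝ) ^ (t * m))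
  rw [hE] at hmark
  have hpos : (0 : ℝ) < 2 ^ (t * m) := by positivity
  have hsub : (Measure.pi fun _ : Fin m => P).real {ρ | t * m < hits A ρ} ≤
      (Measure.pi fun _ : Fin m => P).real {ρ | (2 : ℝ) ^ (t * m) ≤ ∏ i, f (ρ i)} := by
    refine measureReal_mono fun ρ hρ => ?_
    simp only [Set.mem_ofPred_eq] at hρ ⊢
    rw [hprod]
    exact Real.rpow_le_rpow_of_exponent_le (by norm_num) hρ.le
  have hpow : (1 + P.real A) ^ m ≤ Real.exp (t / 2 * m) := by
    calc (1 + P.real A) ^ m ≤ (Real.exp (t / 2)) ^ m := by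
          refine pow_le_pow_left₀ (by positivity) ?_ m
          linarith [Real.add_one_le_exp (t / 2)]
      _ = Real.exp (t / 2 * m) := by rw [← Real.exp_nat_mul, mul_comm]
  have h2 : (2 : ℝ) ^ (t * m) = Real.exp (Real.log 2 * (t * m)) :=
    Real.rpow_def_of_pos (by norm_num) _
  refine hsub.trans ?_
  rw [← mul_le_mul_iff_right₀ hpos]
  refine (hmark.trans hpow).trans (le_of_eq ?_)
  rw [h2, ← Real.exp_add]
  congr 1
  ring

/-- Joining two independent samples. -/
theorem pi_append (P : Measure X) [IsProbabilityMeasure P] [Finite X] (m₀ m₁ : ℕ) :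
    ((Measure.pi fun _ : Fin m₀ => P).prod (Measure.pi fun _ : Fin m₁ => P)).map
      (fun q => Fin.append q.1 q.2) = Measure.pi fun _ : Fin (m₀ + m₁) => P := by
  refine (Measure.pi_eq fun s _ => ?_).symm
  rw [Measure.map_apply Measurable.of_discrete MeasurableSet.of_discrete]
  have h : (fun q : (Fin m₀ → X) × (Fin m₁ → X) => Fin.append q.1 q.2) ⁻¹' Set.univ.pi s =
      (Set.univ.pi fun i => s (Fin.castAdd m₁ i)) ×ˢ
        (Set.univ.pi fun i => s (Fin.natAdd m₀ i)) := by
    ext q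
    simp [Set.mem_pi, Fin.forall_fin_add]
  rw [h, Measure.prod_prod, Measure.pi_pi, Measure.pi_pi, Fin.prod_univ_add]

/-- Bounds the probability of an event that, unless the first part of the sample is in `A`, has
conditional probability at most `b` given the first part. -/
theorem measureReal_append_le (P : Measure X) [IsProbabilityMeasure P] [Finite X] (m₀ m₁ : ℕ)
    (S : Set (Fin (m₀ + m₁) → X)) (A : Set (Fin m₀ → X)) {a b : ℝ}
    (hA : (Measure.pi fun _ : Fin m₀ => P).real A ≤ a)
    (hS : ∀ α ∉ A, (Measure.pi fun _ : Fin m₁ => P).real {τ | Fin.append α τ ∈ S} ≤ b)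
    (hb : 0 ≤ b) :
    (Measure.pi fun _ : Fin (m₀ + m₁) => P).real S ≤ a + b := by
  set P₀ := Measure.pi fun _ : Fin m₀ => P
  set P₁ := Measure.pi fun _ : Fin m₁ => P
  set S' : Set ((Fin m₀ → X) × (Fin m₁ → X)) := {q | Fin.append q.1 q.2 ∈ S}
  have h₁ : (Measure.pi fun _ : Fin (m₀ + m₁) => P).real S = (P₀.prod P₁).real S' := by
    rw [← pi_append, map_measureReal_apply Measurable.of_discrete MeasurableSet.of_discrete]
    rfl
  have h₂ : (P₀.prod P₁).real (S' ∩ {q | q.1 ∉ A}) ≤ b := by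
    rw [measureReal_def]
    refine ENNReal.toReal_le_of_le_ofReal hb ?_
    rw [Measure.prod_apply MeasurableSet.of_discrete]
    calc _ ≤ ∫⁻ _, ENNReal.ofReal b ∂P₀ := by
          refine lintegral_mono fun α => ?_
          by_cases hα : α ∈ A
          · have : Prod.mk α ⁻¹' (S' ∩ {q | q.1 ∉ A}) = ∅ := by
              ext τ
              simp [hα]
            simp [this]
          · refine (measure_mono (t := {τ | Fin.append α τ ∈ S}) fun τ hτ => hτ.1).trans ?_
            rw [← ENNReal.ofReal_toReal (measure_ne_top P₁ _)]
            exact ENNReal.ofReal_le_ofReal (hS α hα)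
      _ = ENNReal.ofReal b := by simp
  have h₃ : (P₀.prod P₁).real (A ×ˢ Set.univ) = P₀.real A := by
    simp [measureReal_def, Measure.prod_prod]
  rw [h₁]
  calc (P₀.prod P₁).real S' ≤ (P₀.prod P₁).real (A ×ˢ Set.univ ∪ S' ∩ {q | q.1 ∉ A}) := by
        refine measureReal_mono fun q hq => ?_
        by_cases h : q.1 ∈ A
        · exact Or.inl ⟨h, trivial⟩
        · exact Or.inr ⟨hq, h⟩
    _ ≤ _ := measureReal_union_le _ _
    _ ≤ a + b := by linarith

end Concentration

/-! ### Unsatisfied clauses and masked examples -/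

instance : DiscreteMeasurableSpace (Option Bool) := ⟨fun _ => trivial⟩

/-- The probability that the clause is unsatisfied. -/
noncomputable def unsatProb (D : Measure (Assignment n)) (C : Clause n) : ℝ :=
  D.real {x | ¬ Clause.Sat C x}

theorem unsatProb_nonneg (D : Measure (Assignment n)) (C : Clause n) : 0 ≤ unsatProb D C :=
  measureReal_nonneg

theorem unsatProb_eq_one_sub (D : Measure (Assignment n)) [IsProbabilityMeasure D]
    (C : Clause n) : unsatProb D C = 1 - D.real {x | Clause.Sat C x} :=
  probReal_compl_eq_one_sub (s := {x | Clause.Sat C x}) MeasurableSet.of_discrete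

theorem not_sat_neg_iff (l : Literal n) (x : Assignment n) :
    ¬ Literal.Sat (Literal.neg l) x ↔ Literal.Sat l x := by
  simp [Literal.Sat, Literal.neg]

theorem Clause.sat_insert {C : Clause n} {l : Literal n} {x : Assignment n} :
    Clause.Sat (insert l C) x ↔ Literal.Sat l x ∨ Clause.Sat C x := by
  simp only [Clause.Sat, Finset.exists_mem_insert]

theorem conjEvent_image_neg (C : Clause n) :
    conjEvent (C.image Literal.neg) = {x | ¬ Clause.Sat C x} := by
  ext x
  simp only [conjEvent, Finset.mem_image, forall_exists_index, and_imp,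
    forall_apply_eq_imp_iff₂, Clause.Sat, not_exists, not_and, Set.mem_ofPred_eq]
  refine forall₂_congr fun l _ => ?_
  have := not_sat_neg_iff (Literal.neg l) x
  rw [Literal.neg_neg] at this
  exact this.symm

/-- `C` fails exactly when the conjunction of its negated literals holds, which is the `T` of the
correlation gap. If one value has conditional probability at least `1 - η`, the other has joint mass
at most `η * u C ≤ η`. When `C` fails with probability zero, the first alternative of the gap holds
trivially. -/
theorem gapFunction_unsatProb {D : Measure (Assignment n)} [IsProbabilityMeasure D] {w : ℕ}
    {β η : ℝ} (hη : 0 ≤ η) (hD : HasCorrelationGap D w β (1 - η)) :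
    GapFunction (unsatProb D) w β η where
  anti h := measureReal_mono fun _ hx ⟨l, hl, hl'⟩ => hx ⟨l, h hl, hl'⟩
  split C l := by
    refine (measureReal_mono fun x hx => ?_).trans (measureReal_union_le _ _)
    have hx : ¬ Clause.Sat C x := hx
    by_cases h : Literal.Sat l x
    · right
      rintro h'
      exact (Clause.sat_insert.1 h').elim h.not_neg hx
    · left
      rintro h'
      exact (Clause.sat_insert.1 h').elim h hx
  gap C hC l := by
    have hset : ∀ b, {x | ¬ Clause.Sat C x} ∩ {x | x l.1 = b} =
        {x | ¬ Clause.Sat (insert (l.1, !b) C) x} := by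
      intro b
      ext x
      simp only [Set.mem_inter_iff, Set.mem_ofPred_eq, Clause.sat_insert, not_or]
      rw [and_comm]
      refine and_congr_left fun _ => ?_
      exact (not_sat_neg_iff (l.1, b) x).symm
    have hu : ∀ b, (cond D {x | ¬ Clause.Sat C x}).real {x | x l.1 = b} =
        (unsatProb D C)⁻¹ * unsatProb D (insert (l.1, !b) C) := by
      intro b
      rw [measureReal_def, cond_apply MeasurableSet.of_discrete, hset, ENNReal.toReal_mul,
        ENNReal.toReal_inv]
      rfl
    by_cases h0 : D {x | ¬ Clause.Sat C x} = 0
    · left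
      have : unsatProb D C = 0 := by rw [unsatProb, measureReal_def, h0]; rfl
      rw [this, mul_zero]
      exact unsatProb_nonneg _ _
    have hpos : 0 < unsatProb D C := ENNReal.toReal_pos h0 (measure_ne_top _ _)
    have hle : unsatProb D C ≤ 1 := measureReal_le_one
    have hgap := hD (C.image Literal.neg) (Finset.card_image_le.trans hC)
      (by rwa [conjEvent_image_neg]) l.1
    rw [conjEvent_image_neg] at hgap
    simp only [hu] at hgap
    rcases hgap with h | ⟨b, hb⟩
    · left
      have := h l.2
      rw [inv_mul_eq_div, le_div_iff₀ hpos] at this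
      exact this
    · right
      rw [inv_mul_eq_div, le_div_iff₀ hpos] at hb
      have hsum : unsatProb D (insert (l.1, !b) C) + unsatProb D (insert (l.1, b) C) =
          unsatProb D C := by
        have h := hset (!b)
        rw [Bool.not_not] at h
        simp only [unsatProb]
        rw [← hset b, ← h, ← measureReal_inter_add_sdiff (μ := D) (s := {x | ¬ Clause.Sat C x})
          (t := {x | x l.1 = b}) MeasurableSet.of_discrete]
        congr 2
        ext x
        simp [Bool.eq_not]
      have hsmall : unsatProb D (insert (l.1, b) C) ≤ η := by nlinarith
      by_cases hbl : b = l.2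
      · right
        subst hbl
        exact hsmall
      · left
        rw [Bool.eq_not.2 hbl] at hsmall
        exact hsmall

theorem isProbabilityMeasure_bernoulli {μ : ℝ} (h₀ : 0 ≤ μ) (h₁ : μ ≤ 1) :
    IsProbabilityMeasure (ENNReal.ofReal μ • Measure.dirac true +
      ENNReal.ofReal (1 - μ) • Measure.dirac false) := by
  constructor
  simp only [Measure.coe_add, Measure.coe_smul, Pi.add_apply, Pi.smul_apply, measure_univ,
    smul_eq_mul, mul_one]
  rw [← ENNReal.ofReal_add h₀ (by linarith)]
  simp

theorem isProbabilityMeasure_maskLaw (n : ℕ) {μ : ℝ} (h₀ : 0 ≤ μ) (h₁ : μ ≤ 1) :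
    IsProbabilityMeasure (maskLaw n μ) := by
  have := isProbabilityMeasure_bernoulli h₀ h₁
  rw [maskLaw]
  infer_instance

theorem isProbabilityMeasure_maskedLaw (D : Measure (Assignment n)) [IsProbabilityMeasure D]
    {μ : ℝ} (h₀ : 0 ≤ μ) (h₁ : μ ≤ 1) : IsProbabilityMeasure (maskedLaw D μ) := by
  have := isProbabilityMeasure_maskLaw n h₀ h₁
  exact Measure.isProbabilityMeasure_map Measurable.of_discrete.aemeasurable

/-! ### Masking probabilities and the bound for unsettled clauses -/

/-- The examples that reveal the literals of `R` to be false and mask those of `M`. -/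
def cylinder (R M : Clause n) : Set (PartialAssignment n) :=
  {ρ | Clause.Falsified R ρ ∧ ∀ l ∈ M, ρ l.1 = none}

theorem maskLaw_box {μ : ℝ} (h₀ : 0 ≤ μ) (h₁ : μ ≤ 1) {A B : Finset (Fin n)}
    (hAB : Disjoint A B) :
    maskLaw n μ {m | (∀ i ∈ A, m i = true) ∧ ∀ i ∈ B, m i = false} =
      ENNReal.ofReal (μ ^ A.card * (1 - μ) ^ B.card) := by
  have := isProbabilityMeasure_bernoulli h₀ h₁
  have hset : {m : Fin n → Bool | (∀ i ∈ A, m i = true) ∧ ∀ i ∈ B, m i = false} =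
      Set.univ.pi fun i => if i ∈ A then {true} else if i ∈ B then {false} else Set.univ := by
    ext m
    simp only [Set.mem_ofPred_eq, Set.mem_pi, Set.mem_univ, true_imp_iff]
    constructor
    · rintro ⟨h₁, h₂⟩ i
      split_ifs with hA hB
      · exact h₁ i hA
      · exact h₂ i hB
      · trivial
    · intro h
      refine ⟨fun i hi => ?_, fun i hi => ?_⟩
      · simpa [hi] using h i
      · simpa [hi, Finset.disjoint_right.1 hAB hi] using h i
  rw [hset, maskLaw, Measure.pi_pi]
  have hfac : ∀ i, (ENNReal.ofReal μ • Measure.dirac true +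
      ENNReal.ofReal (1 - μ) • Measure.dirac false : Measure Bool)
      (if i ∈ A then {true} else if i ∈ B then {false} else Set.univ) =
      (if i ∈ A then ENNReal.ofReal μ else 1) * (if i ∈ B then ENNReal.ofReal (1 - μ) else 1) := by
    intro i
    by_cases hA : i ∈ A
    · simp [hA, Finset.disjoint_left.1 hAB hA]
    · by_cases hB : i ∈ B
      · simp [hA, hB]
      · rw [if_neg hA, if_neg hB, if_neg hA, if_neg hB, measure_univ, one_mul]
  rw [Finset.prod_congr rfl fun i _ => hfac i, Finset.prod_mul_distrib, Finset.prod_ite_mem,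
    Finset.prod_ite_mem, Finset.univ_inter, Finset.univ_inter, Finset.prod_const,
    Finset.prod_const, ENNReal.ofReal_mul (by positivity), ENNReal.ofReal_pow h₀,
    ENNReal.ofReal_pow (by linarith)]

/-- The mask is independent of the assignment, and properness with disjointness puts the literals on
distinct variables, so each contributes its own mask factor. Only the revealed literals constrain
the assignment. -/
theorem measureReal_cylinder (D : Measure (Assignment n)) [IsProbabilityMeasure D] {μ : ℝ}
    (h₀ : 0 ≤ μ) (h₁ : μ ≤ 1) {R M : Clause n} (hp : Clause.Proper (R ∪ M))
    (hd : Disjoint R M) :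
    (maskedLaw D μ).real (cylinder R M) =
      μ ^ R.card * (1 - μ) ^ M.card * unsatProb D R := by
  have := isProbabilityMeasure_maskLaw n h₀ h₁
  have hpR : Clause.Proper R := hp.mono Finset.subset_union_left
  have hpM : Clause.Proper M := hp.mono Finset.subset_union_right
  have hset : (fun q : Assignment n × (Fin n → Bool) => applyMask q.1 q.2) ⁻¹' cylinder R M =
      {x | ¬ Clause.Sat R x} ×ˢ {m | (∀ i ∈ R.image Prod.fst, m i = true) ∧
        ∀ i ∈ M.image Prod.fst, m i = false} := by
    ext ⟨x, m⟩
    simp only [cylinder, Clause.Falsified, Set.mem_preimage, Set.mem_ofPred_eq, Set.mem_prod,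
      Clause.Sat, not_exists, not_and, Finset.forall_mem_image, applyMask]
    have e₁ : ∀ l : Literal n, (if m l.1 = true then some (x l.1) else none) = some (!l.2) ↔
        ¬ Literal.Sat l x ∧ m l.1 = true := by
      intro l
      by_cases h : m l.1 = true
      · simp only [h, if_true, Option.some.injEq, Literal.Sat, and_true]
        exact Bool.eq_not
      · simp [h]
    have e₂ : ∀ l : Literal n, (if m l.1 = true then some (x l.1) else none) = none ↔
        m l.1 = false := by
      intro l
      by_cases h : m l.1 = true <;> simp [h]
    simp only [e₁, e₂, forall_and]
    exact and_assoc
  have hdisj : Disjoint (R.image Prod.fst) (M.image Prod.fst) := by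
    rw [Finset.disjoint_left]
    intro v hv hv'
    obtain ⟨l, hl, rfl⟩ := Finset.mem_image.1 hv
    obtain ⟨l', hl', he⟩ := Finset.mem_image.1 hv'
    have : l' = l := hp.eq_of_fst_eq (Finset.mem_union_right _ hl') (Finset.mem_union_left _ hl) he
    exact Finset.disjoint_left.1 hd hl (this ▸ hl')
  rw [maskedLaw, map_measureReal_apply Measurable.of_discrete MeasurableSet.of_discrete, hset,
    measureReal_prod_prod, measureReal_def (maskLaw n μ), maskLaw_box h₀ h₁ hdisj,
    ENNReal.toReal_ofReal (mul_nonneg (pow_nonneg h₀ _) (pow_nonneg (by linarith) _)),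
    Finset.card_image_of_injOn hpR.injOn, Finset.card_image_of_injOn hpM.injOn, mul_comm]
  rfl

theorem measureReal_falsified (D : Measure (Assignment n)) [IsProbabilityMeasure D] {μ : ℝ}
    (h₀ : 0 ≤ μ) (h₁ : μ ≤ 1) {C : Clause n} (hp : Clause.Proper C) :
    (maskedLaw D μ).real {ρ | Clause.Falsified C ρ} = μ ^ C.card * unsatProb D C := by
  have h := measureReal_cylinder D h₀ h₁ (R := C) (M := ∅) (by simpa using hp) (by simp)
  simpa [cylinder] using h

/-- A clause is neither true nor settled with exponentially small probability only. -/
theorem measureReal_not_settles_le (D : Measure (Assignment n)) [IsProbabilityMeasure D]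
    {μ β : ℝ} (h₀ : 0 ≤ μ) (h₁ : μ ≤ 1) (hβ₁ : β ≤ 1) {C : Clause n}
    (hp : Clause.Proper C) (w : ℕ) :
    (maskedLaw D μ).real {ρ | ¬ Clause.WitnessedTrue C ρ ∧ ¬ Settles (unsatProb D) β w C ρ} ≤
      (1 - μ * β) ^ w := by
  have := isProbabilityMeasure_maskedLaw D h₀ h₁
  have hnn : 0 ≤ 1 - μ * β := by nlinarith
  -- The induction follows a decision tree: `R` and `M` are the literals examined so far and found
  -- false or masked, and `k` examinations remain.
  suffices key : ∀ (k : ℕ) (R M : Clause n), R ∪ M ⊆ C → Disjoint R M →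
      R.card + M.card + k = w →
      (maskedLaw D μ).real (cylinder R M ∩ {ρ | ¬ Clause.WitnessedTrue C ρ ∧
        ¬ Settles (unsatProb D) β w C ρ}) ≤
      (1 - μ * β) ^ k * (maskedLaw D μ).real (cylinder R M) by
    have h := key w ∅ ∅ (by simp) (by simp) (by simp)
    have hc : cylinder (∅ : Clause n) ∅ = Set.univ := by
      ext ρ
      simp [cylinder, Clause.Falsified]
    simpa [hc] using h
  intro k
  induction k with
  | zero =>
    intro R M _ _ _
    rw [pow_zero, one_mul]
    exact measureReal_mono Set.inter_subset_left
  | succ k ih =>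
    intro R M hsub hd hk
    by_cases hsettled : ∀ l ∈ C, l ∉ R ∪ M →
        ¬ β * unsatProb D R ≤ unsatProb D (insert (Literal.neg l) R)
    · have hempty : cylinder R M ∩ {ρ | ¬ Clause.WitnessedTrue C ρ ∧
          ¬ Settles (unsatProb D) β w C ρ} = ∅ := by
        ext ρ
        simp only [Set.mem_inter_iff, Set.mem_ofPred_eq, Set.mem_empty_iff_false, iff_false,
          not_and, not_not]
        rintro ⟨hR, hM⟩ _
        have hrev : revealedPart (R ∪ M) ρ = R := by
          ext l
          simp only [revealedPart, Finset.mem_filter, Finset.mem_union]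
          constructor
          · rintro ⟨h | h, h'⟩
            · exact h
            · exact absurd (hM l h) h'
          · intro h
            exact ⟨Or.inl h, by simp [hR l h]⟩
        refine ⟨R ∪ M, hsub, ?_, by rwa [hrev]⟩
        have := Finset.card_union_le R M
        omega
      rw [hempty, measureReal_empty]
      positivity
    · push Not at hsettled
      -- Examine such an `l`. Revealed true, it witnesses `C`; revealed false costs a factor at most
      -- `μ(1-β)`, and masked a factor `1-μ`. The sum is `1 - μβ`.
      obtain ⟨l, hlC, hl, hbal⟩ := hsettled
      have hlR : l ∉ R := fun h => hl (Finset.mem_union_left _ h)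
      have hlM : l ∉ M := fun h => hl (Finset.mem_union_right _ h)
      have hs₁ : insert l R ∪ M ⊆ C := by
        rw [Finset.insert_union]
        exact Finset.insert_subset hlC hsub
      have hs₂ : R ∪ insert l M ⊆ C := by
        rw [Finset.union_insert]
        exact Finset.insert_subset hlC hsub
      have hd₁ : Disjoint (insert l R) M := by simp [hlM, hd]
      have hd₂ : Disjoint R (insert l M) := by simp [hlR, hd]
      have ih₁ := ih (insert l R) M hs₁ hd₁ (by rw [Finset.card_insert_of_notMem hlR]; omega)
      have ih₂ := ih R (insert l M) hs₂ hd₂ (by rw [Finset.card_insert_of_notMem hlM]; omega)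
      have hcover : cylinder R M ∩ {ρ | ¬ Clause.WitnessedTrue C ρ ∧
          ¬ Settles (unsatProb D) β w C ρ} ⊆
          (cylinder (insert l R) M ∩ {ρ | ¬ Clause.WitnessedTrue C ρ ∧
            ¬ Settles (unsatProb D) β w C ρ}) ∪
          (cylinder R (insert l M) ∩ {ρ | ¬ Clause.WitnessedTrue C ρ ∧
            ¬ Settles (unsatProb D) β w C ρ}) := by
        rintro ρ ⟨⟨hR, hM⟩, hρ⟩
        rcases hρl : ρ l.1 with _ | b
        · exact Or.inr ⟨⟨hR, Finset.forall_mem_insert _ _ _ |>.2 ⟨hρl, hM⟩⟩, hρ⟩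
        · have hb : b ≠ l.2 := by
            rintro rfl
            exact hρ.1 ⟨l, hlC, hρl⟩
          refine Or.inl ⟨⟨Finset.forall_mem_insert _ _ _ |>.2 ⟨?_, hR⟩, hM⟩, hρ⟩
          rw [hρl, Bool.eq_not.2 hb]
      rw [measureReal_cylinder D h₀ h₁ (hp.mono hs₁) hd₁, Finset.card_insert_of_notMem hlR] at ih₁
      rw [measureReal_cylinder D h₀ h₁ (hp.mono hs₂) hd₂, Finset.card_insert_of_notMem hlM] at ih₂
      rw [measureReal_cylinder D h₀ h₁ (hp.mono hsub) hd]
      have hsum : unsatProb D (insert l R) + unsatProb D (insert (Literal.neg l) R) =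
          unsatProb D R := by
        rw [add_comm]
        simp only [unsatProb]
        rw [← measureReal_inter_add_sdiff (μ := D) (s := {x | ¬ Clause.Sat R x})
          (t := {x | Literal.Sat l x}) MeasurableSet.of_discrete]
        congr 2
        · ext x
          simp only [Set.mem_inter_iff, Set.mem_ofPred_eq, Clause.sat_insert, not_or,
            not_sat_neg_iff]
          exact and_comm
        · ext x
          simp only [Set.mem_sdiff, Set.mem_ofPred_eq, Clause.sat_insert, not_or]
          exact and_comm
      have hu : unsatProb D (insert l R) ≤ (1 - β) * unsatProb D R := by linarith
      refine (measureReal_mono hcover).trans ((measureReal_union_le _ _).trans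
        ((add_le_add ih₁ ih₂).trans ?_))
      have hfac : 0 ≤ (1 - μ * β) ^ k * (μ ^ R.card * (1 - μ) ^ M.card) := by
        have : 0 ≤ 1 - μ := by linarith
        positivity
      calc _ = (1 - μ * β) ^ k * (μ ^ R.card * (1 - μ) ^ M.card) *
            (μ * unsatProb D (insert l R) + (1 - μ) * unsatProb D R) := by ring
        _ ≤ (1 - μ * β) ^ k * (μ ^ R.card * (1 - μ) ^ M.card) *
            ((1 - μ * β) * unsatProb D R) := by
            refine mul_le_mul_of_nonneg_left ?_ hfac
            nlinarith
        _ = _ := by ring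

/-! ### Estimates for the parameters -/

theorem numTest_ge {γ δ : ℝ} (hγ : 0 < γ) :
    Real.log (2 / δ) ≤ 2 * γ ^ 2 * numTest γ δ := by
  have h : 1 / (2 * γ ^ 2) * Real.log (2 / δ) ≤ numTest γ δ := Nat.le_ceil _
  rw [one_div_mul_eq_div, div_le_iff₀ (by positivity)] at h
  linarith

theorem exp_neg_numTest_le {γ δ : ℝ} (hγ : 0 < γ) (hδ : 0 < δ) :
    Real.exp (-(2 * γ ^ 2 * numTest γ δ)) ≤ δ / 2 := by
  have h := numTest_ge (δ := δ) hγ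
  calc _ ≤ Real.exp (-Real.log (2 / δ)) := Real.exp_le_exp.2 (by linarith)
    _ = δ / 2 := by rw [Real.exp_neg, Real.exp_log (by positivity), inv_div]

/-- In case (ii), `ψ₁` fails to be witnessed with probability at most `ε - 2γ`, so the deviation is
`2γ`. The better bound leaves room for the other failure events. -/
theorem exp_neg_four_mul_numTest_le {γ δ : ℝ} (hγ : 0 < γ) (hδ : 0 < δ) (hδ₁ : δ < 1) :
    Real.exp (-(2 * (2 * γ) ^ 2 * numTest γ δ)) ≤ δ / 4 := by
  have h := exp_neg_numTest_le hγ hδ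
  have h' : Real.exp (-(2 * (2 * γ) ^ 2 * numTest γ δ)) =
      Real.exp (-(2 * γ ^ 2 * numTest γ δ)) ^ 4 := by
    rw [← Real.exp_nat_mul]
    congr 1
    push_cast
    ring
  rw [h']
  calc _ ≤ (δ / 2) ^ 4 := pow_le_pow_left₀ (Real.exp_pos _).le h 4
    _ = δ / 4 * (δ ^ 3 / 4) := by ring
    _ ≤ δ / 4 * 1 := by
        have : δ ^ 3 ≤ 1 := pow_le_one₀ hδ.le hδ₁.le
        gcongr
        linarith
    _ = δ / 4 := mul_one _

theorem numTest_pos {γ δ : ℝ} (hγ : 0 < γ) (hδ : 0 < δ) (hδ₁ : δ < 1) : 1 ≤ numTest γ δ := by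
  refine Nat.one_le_ceil_iff.2 ?_
  have : 0 < Real.log (2 / δ) := Real.log_pos (by rw [lt_div_iff₀ hδ]; linarith)
  positivity

section Parameters

variable {p : ℕ} {μ γ δ β : ℝ}

theorem gapWidth_le : gapWidth n p μ γ δ β ≤ n := min_le_left _ _

theorem one_lt_failure_ratio (hp : 1 ≤ p) (hγ : 0 < γ) (hδ : 0 < δ) (hδ₁ : δ < 1) :
    1 < 2 * numTest γ δ * p / δ := by
  have h₁ : (1 : ℝ) ≤ numTest γ δ := by exact_mod_cast numTest_pos hγ hδ hδ₁
  have h₂ : (1 : ℝ) ≤ p := by exact_mod_cast hp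
  rw [lt_div_iff₀ hδ]
  nlinarith

theorem gapWidth_pos (hn : 1 ≤ n) (hp : 1 ≤ p) (hμ : 0 < μ) (hγ : 0 < γ) (hδ : 0 < δ)
    (hδ₁ : δ < 1) (hβ : 0 < β) : 1 ≤ gapWidth n p μ γ δ β := by
  refine le_min hn (Nat.one_le_ceil_iff.2 ?_)
  have := Real.log_pos (one_lt_failure_ratio hp hγ hδ hδ₁)
  positivity

/-- When the minimum in `gapWidth` is `n`, no such estimate is needed: no proper clause is wider
than `n`. -/
theorem pow_gapWidth_le (hp : 1 ≤ p) (hμ : 0 < μ) (hμ₁ : μ < 1) (hγ : 0 < γ) (hδ : 0 < δ)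
    (hδ₁ : δ < 1) (hβ : 0 < β) (hβ₁ : β < 1) (hw : gapWidth n p μ γ δ β < n) :
    (1 - μ * β) ^ gapWidth n p μ γ δ β ≤ δ / (2 * numTest γ δ * p) := by
  have hlt := one_lt_failure_ratio hp hγ hδ hδ₁
  have hge : 1 / (μ * β) * Real.log (2 * numTest γ δ * p / δ) ≤ gapWidth n p μ γ δ β := by
    have : gapWidth n p μ γ δ β = ⌈1 / (μ * β) * Real.log (2 * numTest γ δ * p / δ)⌉₊ :=
      min_eq_right ((min_lt_iff.1 hw).resolve_left (lt_irrefl _)).le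
    rw [this]
    exact Nat.le_ceil _
  rw [one_div_mul_eq_div, div_le_iff₀ (by positivity)] at hge
  calc (1 - μ * β) ^ gapWidth n p μ γ δ β
      ≤ Real.exp (-(μ * β)) ^ gapWidth n p μ γ δ β := by
        refine pow_le_pow_left₀ (by nlinarith) ?_ _
        linarith [Real.add_one_le_exp (-(μ * β))]
    _ = Real.exp (-(gapWidth n p μ γ δ β * (μ * β))) := by
        rw [← Real.exp_nat_mul]
        congr 1
        ring
    _ ≤ Real.exp (-Real.log (2 * numTest γ δ * p / δ)) := Real.exp_le_exp.2 (by linarith)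
    _ = δ / (2 * numTest γ δ * p) := by
        rw [Real.exp_neg, Real.exp_log (by linarith), inv_div]

end Parameters

section Learning

variable {w : ℕ} {μ γ δ : ℝ}

/-- The threshold, as a fraction of the examples, for a clause to be learned. -/
noncomputable def learnRate (n w : ℕ) (μ γ : ℝ) : ℝ := γ * μ ^ w / (2 * (2 * n + 1 : ℝ) ^ w)

theorem learnRate_pos (hμ : 0 < μ) (hγ : 0 < γ) : 0 < learnRate n w μ γ := by
  rw [learnRate]
  positivity

/-- This estimate serves both tail bounds of the learning phase. Hoeffding's exponent contributes
`learnRate` once more and cancels the fraction; in Chernoff's exponent the fraction is only bounded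
below. -/
theorem learnRate_mul_numLearn_ge (hμ : 0 < μ) (hγ : 0 < γ) :
    w * ((2 * n + 1 : ℝ) ^ w / (μ ^ w * γ)) * Real.log (4 * (2 * n + 1) / δ) ≤
      learnRate n w μ γ * numLearn n w μ γ δ := by
  have h : 2 * w * (2 * n + 1 : ℝ) ^ (2 * w) / (μ ^ (2 * w) * γ ^ 2) *
    Real.log (4 * (2 * n + 1) / δ) ≤ numLearn n w μ γ δ := Nat.le_ceil _
  refine le_trans (le_of_eq ?_) (mul_le_mul_of_nonneg_left h (learnRate_pos hμ hγ).le)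
  rw [learnRate, pow_mul', pow_mul']
  field_simp

theorem exp_neg_le_of_le {w : ℕ} {a L : ℝ} (hδ : 0 < δ) (hL : L = Real.log (4 * (2 * n + 1) / δ))
    (h : w * L ≤ a) : Real.exp (-a) ≤ (δ / (4 * (2 * n + 1))) ^ w := by
  calc Real.exp (-a) ≤ Real.exp (w * -L) := Real.exp_le_exp.2 (by linarith)
    _ = (δ / (4 * (2 * n + 1))) ^ w := by
      rw [Real.exp_nat_mul, Real.exp_neg, hL, Real.exp_log (by positivity), inv_div]

theorem log_pos_of_delta (hδ : 0 < δ) (hδ₁ : δ < 1) : 0 < Real.log (4 * (2 * n + 1) / δ) := by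
  refine Real.log_pos ?_
  rw [lt_div_iff₀ hδ]
  have : (0 : ℝ) ≤ n := Nat.cast_nonneg n
  linarith

theorem exp_neg_hoeffding_le (hμ : 0 < μ) (hγ : 0 < γ) (hδ : 0 < δ) :
    Real.exp (-(2 * learnRate n w μ γ ^ 2 * numLearn n w μ γ δ)) ≤
      (δ / (4 * (2 * n + 1))) ^ w := by
  refine exp_neg_le_of_le hδ rfl ?_
  have h := mul_le_mul_of_nonneg_left
    (learnRate_mul_numLearn_ge (n := n) (w := w) (δ := δ) hμ hγ)
    (learnRate_pos (n := n) (w := w) hμ hγ).le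
  have he : learnRate n w μ γ * (w * ((2 * n + 1 : ℝ) ^ w / (μ ^ w * γ)) *
      Real.log (4 * (2 * n + 1) / δ)) = w * Real.log (4 * (2 * n + 1) / δ) / 2 := by
    rw [learnRate]
    field_simp
  rw [he] at h
  linarith [h]

/-- The constant is `6` because `6 * (log 2 - 1/2) > 1`; it comes from `2n + 1 ≥ 3` and `γ ≤ 1/2`.
Hoeffding's inequality would be too weak here, since the gap between mean and threshold is only half
of `learnRate`. -/
theorem exp_neg_chernoff_le (hn : 1 ≤ n) (hw : 1 ≤ w) (hμ : 0 < μ) (hμ₁ : μ < 1) (hγ : 0 < γ)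
    (hγ₁ : γ ≤ 1 / 2) (hδ : 0 < δ) (hδ₁ : δ < 1) :
    Real.exp (-((Real.log 2 - 1 / 2) * (learnRate n w μ γ * numLearn n w μ γ δ))) ≤
      (δ / (4 * (2 * n + 1))) ^ w := by
  refine exp_neg_le_of_le hδ rfl ?_
  have h := learnRate_mul_numLearn_ge (n := n) (w := w) (δ := δ) hμ hγ
  have hL := log_pos_of_delta (n := n) hδ hδ₁
  have hn' : (1 : ℝ) ≤ n := by exact_mod_cast hn
  have h3 : (3 : ℝ) ≤ (2 * n + 1) ^ w := by
    calc (3 : ℝ) ≤ 2 * n + 1 := by linarith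
      _ = (2 * n + 1) ^ 1 := (pow_one _).symm
      _ ≤ (2 * n + 1) ^ w := pow_le_pow_right₀ (by linarith) hw
  have h6 : (6 : ℝ) ≤ (2 * n + 1) ^ w / (μ ^ w * γ) := by
    rw [le_div_iff₀ (by positivity)]
    have : μ ^ w ≤ 1 := pow_le_one₀ hμ.le hμ₁.le
    have : μ ^ w * γ ≤ 1 / 2 := by nlinarith
    linarith
  have h7 : (w : ℝ) * 6 * Real.log (4 * (2 * n + 1) / δ) ≤
      learnRate n w μ γ * numLearn n w μ γ δ := le_trans (by gcongr) h
  have hlog := Real.log_two_gt_d9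
  have hw0 : 0 ≤ (w : ℝ) * Real.log (4 * (2 * n + 1) / δ) := by positivity
  nlinarith

theorem pow_mul_pow_le (hw : 1 ≤ w) (hδ : 0 < δ) (hδ₁ : δ < 1) :
    (2 * n + 1 : ℝ) ^ w * (δ / (4 * (2 * n + 1))) ^ w ≤ δ / 4 := by
  rw [← mul_pow]
  have h : (2 * n + 1 : ℝ) * (δ / (4 * (2 * n + 1))) = δ / 4 := by field_simp
  rw [h]
  exact pow_le_of_le_one (by positivity) (by linarith) (by omega)

theorem measureReal_exists_narrow_le {X : Type} [MeasurableSpace X] (P : Measure X)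
    [IsFiniteMeasure P] (w : ℕ) (E : Clause n → Set X) {b : ℝ} (hb : 0 ≤ b)
    (hE : ∀ C : Clause n, C.card ≤ w → P.real (E C) ≤ b) :
    P.real {x | ∃ C : Clause n, C.card ≤ w ∧ x ∈ E C} ≤ (2 * n + 1 : ℝ) ^ w * b := by
  have hset : {x | ∃ C : Clause n, C.card ≤ w ∧ x ∈ E C} =
      ⋃ C ∈ Finset.univ.filter (fun C : Clause n => C.card ≤ w), E C := by
    ext x
    simp
  rw [hset]
  refine (measureReal_biUnion_finset_le _ _).trans ?_
  refine (Finset.sum_le_card_nsmul _ _ b fun C hC => hE C (Finset.mem_filter.1 hC).2).trans ?_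
  rw [nsmul_eq_mul]
  refine mul_le_mul_of_nonneg_right ?_ hb
  exact_mod_cast card_narrow_le n w

theorem mem_learn_iff {t m : ℕ} (ρ : Fin m → PartialAssignment n) (C : Clause n) :
    C ∈ (learn w t ρ).val ↔ C.card ≤ w ∧ Clause.Proper C ∧
      hits {ρ | Clause.Falsified C ρ} ρ ≤ t :=
  mem_learn ρ C

/-- With high probability, only almost valid clauses are learned. -/
theorem measureReal_learns_invalid_le (D : Measure (Assignment n)) [IsProbabilityMeasure D]
    (hw : 1 ≤ w) (hμ : 0 < μ) (hμ₁ : μ < 1) (hγ : 0 < γ) (hδ : 0 < δ) (hδ₁ : δ < 1) :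
    (sampleLaw D μ (numLearn n w μ γ δ)).real
      {α | ¬ ∀ C ∈ (learn w ⌊learnRate n w μ γ * numLearn n w μ γ δ⌋₊ α).val,
        unsatProb D C ≤ γ / (2 * n + 1 : ℝ) ^ w} ≤ δ / 4 := by
  have := isProbabilityMeasure_maskedLaw D hμ.le hμ₁.le
  have hprob : IsProbabilityMeasure (sampleLaw D μ (numLearn n w μ γ δ)) := by
    rw [sampleLaw]; infer_instance
  have ht := learnRate_pos (n := n) (w := w) hμ hγ
  refine le_trans ?_ (pow_mul_pow_le (n := n) hw hδ hδ₁)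
  refine (measureReal_mono ?_).trans (measureReal_exists_narrow_le _ w
    (fun C => {α | (Clause.Proper C ∧ γ / (2 * n + 1 : ℝ) ^ w < unsatProb D C) ∧
      (hits {ρ | Clause.Falsified C ρ} α : ℝ) ≤
        (2 * learnRate n w μ γ - learnRate n w μ γ) * numLearn n w μ γ δ})
    (by positivity) fun C hC => ?_)
  · intro α hα
    have hα : ¬ ∀ C ∈ (learn w ⌊learnRate n w μ γ * numLearn n w μ γ δ⌋₊ α).val,
        unsatProb D C ≤ γ / (2 * n + 1 : ℝ) ^ w := hα
    push Not at hα
    obtain ⟨C, hC, hlt⟩ := hα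
    obtain ⟨h₁, h₂, h₃⟩ := (mem_learn_iff α C).1 hC
    refine ⟨C, h₁, ⟨h₂, hlt⟩, ?_⟩
    have := (Nat.le_floor_iff (by positivity)).1 h₃
    linarith
  · by_cases h : Clause.Proper C ∧ γ / (2 * n + 1 : ℝ) ^ w < unsatProb D C
    · refine le_trans (measureReal_mono fun α hα => hα.2) ((measureReal_hits_le_le _ _ _ ?_
        ht.le).trans (exp_neg_hoeffding_le hμ hγ hδ))
      rw [measureReal_falsified D hμ.le hμ₁.le h.1]
      -- An invalid clause is falsified at no less than twice the threshold rate; smaller width only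
      -- makes falsification more frequent.
      calc 2 * learnRate n w μ γ = μ ^ w * (γ / (2 * n + 1 : ℝ) ^ w) := by
            rw [learnRate]
            field_simp
        _ ≤ μ ^ C.card * unsatProb D C := by
            refine mul_le_mul (pow_le_pow_of_le_one hμ.le hμ₁.le hC) h.2.le (by positivity)
              (by positivity)
    · have hempty : {α : Fin (numLearn n w μ γ δ) → PartialAssignment n |
          (Clause.Proper C ∧ γ / (2 * n + 1 : ℝ) ^ w < unsatProb D C) ∧
          (hits {ρ | Clause.Falsified C ρ} α : ℝ) ≤
          (2 * learnRate n w μ γ - learnRate n w μ γ) * numLearn n w μ γ δ} = ∅ := by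
        ext α
        simp [h]
      rw [hempty, measureReal_empty]
      positivity

/-- With high probability, all sufficiently valid clauses of width `w` are learned. -/
theorem measureReal_not_learnsValid_le (D : Measure (Assignment n)) [IsProbabilityMeasure D]
    (hn : 1 ≤ n) (hw : 1 ≤ w) (hμ : 0 < μ) (hμ₁ : μ < 1) (hγ : 0 < γ) (hγ₁ : γ ≤ 1 / 2)
    (hδ : 0 < δ) (hδ₁ : δ < 1) {η : ℝ} (hη : n * η = γ / (4 * (2 * n + 1 : ℝ) ^ w)) :
    (sampleLaw D μ (numLearn n w μ γ δ)).real
      {α | ¬ LearnsValid (unsatProb D) w η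
        (learn w ⌊learnRate n w μ γ * numLearn n w μ γ δ⌋₊ α).val} ≤ δ / 4 := by
  have := isProbabilityMeasure_maskedLaw D hμ.le hμ₁.le
  have hprob : IsProbabilityMeasure (sampleLaw D μ (numLearn n w μ γ δ)) := by
    rw [sampleLaw]; infer_instance
  refine le_trans ?_ (pow_mul_pow_le (n := n) hw hδ hδ₁)
  refine (measureReal_mono ?_).trans (measureReal_exists_narrow_le _ w
    (fun C => {α | (Clause.Proper C ∧ C.card = w ∧ unsatProb D C ≤ n * η) ∧
      learnRate n w μ γ * numLearn n w μ γ δ < hits {ρ | Clause.Falsified C ρ} α})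
    (by positivity) fun C hC => ?_)
  · intro α hα
    have hα : ¬ LearnsValid (unsatProb D) w η
        (learn w ⌊learnRate n w μ γ * numLearn n w μ γ δ⌋₊ α).val := hα
    rw [LearnsValid] at hα
    push Not at hα
    obtain ⟨C, h₁, h₂, h₃, h₄⟩ := hα
    refine ⟨C, h₂.le, ⟨h₁, h₂, h₃⟩, ?_⟩
    rw [mem_learn_iff] at h₄
    by_contra hcon
    exact h₄ ⟨h₂.le, h₁, Nat.le_floor (not_lt.1 hcon)⟩
  · by_cases h : Clause.Proper C ∧ C.card = w ∧ unsatProb D C ≤ n * η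
    · refine le_trans (measureReal_mono fun α hα => hα.2) ((measureReal_hits_gt_le _ _ _ ?_).trans
        (exp_neg_chernoff_le hn hw hμ hμ₁ hγ hγ₁ hδ hδ₁))
      rw [measureReal_falsified D hμ.le hμ₁.le h.1, h.2.1]
      -- Here the width must be exactly `w`: a narrower clause would carry a larger power of `μ` and
      -- might exceed the threshold.
      calc μ ^ w * unsatProb D C ≤ μ ^ w * (n * η) := by
            gcongr
            exact h.2.2
        _ = learnRate n w μ γ / 2 := by
            rw [hη, learnRate]
            field_simp
            norm_num
    · have hempty : {α : Fin (numLearn n w μ γ δ) → PartialAssignment n |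
          (Clause.Proper C ∧ C.card = w ∧ unsatProb D C ≤ n * η) ∧
          learnRate n w μ γ * numLearn n w μ γ δ < hits {ρ | Clause.Falsified C ρ} α} = ∅ := by
        ext α
        simp [h]
      rw [hempty, measureReal_empty]
      positivity

end Learning

/-! ### The third phase -/

section Testing

variable {w : ℕ} {μ γ δ ε β : ℝ}

/-- If `φ` and the learned clauses are simultaneously satisfied often enough, the third phase
rarely ends with acceptance. -/
theorem measureReal_few_unrefuted_le (D : Measure (Assignment n)) [IsProbabilityMeasure D]
    (φ ψ : CNF n) (hψw : ∀ C ∈ ψ, C.card ≤ w) (hψp : ∀ C ∈ ψ, Clause.Proper C)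
    (hψ : ∀ C ∈ ψ, unsatProb D C ≤ γ / (2 * n + 1 : ℝ) ^ w) (hμ : 0 < μ) (hμ₁ : μ < 1)
    (hε : 0 < ε) (hγ : 0 < γ) (hδ : 0 < δ)
    (hφ : ε + 2 * γ ≤ D.real {x | CNF.Sat φ x}) :
    (sampleLaw D μ (numTest γ δ)).real
      {τ | hits {ρ | ¬ Refuted φ ψ w ρ} τ ≤ ⌊ε * numTest γ δ⌋₊} ≤ δ / 2 := by
  have := isProbabilityMeasure_maskedLaw D hμ.le hμ₁.le
  have := isProbabilityMeasure_maskLaw n hμ.le hμ₁.le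
  have hprob : IsProbabilityMeasure (sampleLaw D μ (numTest γ δ)) := by
    rw [sampleLaw]; infer_instance
  -- At most `(2n+1)^w` clauses are learned, each with error `γ / (2n+1)^w`.
  have hunsat : D.real {x | ¬ CNF.Sat ψ x} ≤ γ := by
    have h := measureReal_exists_narrow_le D w
      (fun C => {x | C ∈ ψ ∧ ¬ Clause.Sat C x}) (b := γ / (2 * n + 1 : ℝ) ^ w) (by positivity)
      (fun C _ => by
        by_cases hC : C ∈ ψ
        · exact (measureReal_mono fun x hx => hx.2).trans (hψ C hC)
        · simp only [hC, false_and]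
          refine le_of_eq_of_le measureReal_empty ?_
          positivity)
    rw [mul_div_cancel₀ _ (by positivity)] at h
    refine (measureReal_mono fun x hx => ?_).trans h
    have hx : ¬ CNF.Sat ψ x := hx
    rw [CNF.Sat] at hx
    push Not at hx
    obtain ⟨C, hC, hCx⟩ := hx
    exact ⟨C, hψw C hC, hC, hCx⟩
  have hsat : ε + γ ≤ D.real {x | CNF.Sat φ x ∧ CNF.Sat ψ x} := by
    have h : D.real {x | CNF.Sat φ x} ≤ D.real {x | CNF.Sat φ x ∧ CNF.Sat ψ x} +
        D.real {x | ¬ CNF.Sat ψ x} := by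
      refine (measureReal_mono fun x hx => ?_).trans (measureReal_union_le _ _)
      by_cases h : CNF.Sat ψ x
      · exact Or.inl ⟨hx, h⟩
      · exact Or.inr h
    linarith
  have hP : ε + γ ≤ (maskedLaw D μ).real {ρ | ¬ Refuted φ ψ w ρ} := by
    rw [maskedLaw, map_measureReal_apply Measurable.of_discrete MeasurableSet.of_discrete]
    have h : (D.prod (maskLaw n μ)).real ({x | CNF.Sat φ x ∧ CNF.Sat ψ x} ×ˢ Set.univ) =
        D.real {x | CNF.Sat φ x ∧ CNF.Sat ψ x} := by
      rw [measureReal_prod_prod, probReal_univ, mul_one]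
    refine (hsat.trans_eq h.symm).trans (measureReal_mono ?_)
    rintro ⟨x, m⟩ ⟨hx, _⟩
    refine not_refuted_of_sat (x := x) (fun i b hib => ?_) hx.1 hx.2 hψp
    by_cases hm : m i = true
    · simpa [applyMask, hm] using hib
    · simp [applyMask, hm] at hib
  refine (measureReal_mono fun τ hτ => ?_).trans
    ((measureReal_hits_le_le (maskedLaw D μ) _ _ hP hγ.le).trans (exp_neg_numTest_le hγ hδ))
  have := (Nat.le_floor_iff (by positivity)).1 hτ
  simpa using this

/-- If a short refutation exists and enough clauses have been learned, the third phase rarely ends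
with rejection. -/
theorem measureReal_many_unrefuted_le {p : ℕ} (D : Measure (Assignment n))
    [IsProbabilityMeasure D] {φ ψ ψ₀ ψ₁ : CNF n} {η : ℝ} (hn : 1 ≤ n) (hp : 1 ≤ p)
    (hμ : 0 < μ) (hμ₁ : μ < 1) (hε : 0 < ε) (hγ : 0 < γ) (hδ : 0 < δ) (hδ₁ : δ < 1)
    (hβ₁ : β < 1) (hη : 0 ≤ η) (hwn : w ≤ n)
    (hw : w < n → (1 - μ * β) ^ w ≤ δ / (2 * numTest γ δ * p))
    (hu : GapFunction (unsatProb D) w β η) (hψ : LearnsValid (unsatProb D) w η ψ)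
    (hψ₀ : ∀ C ∈ ψ₀, unsatProb D C ≤ η)
    (hψ₁ : 1 - ε + 2 * γ ≤ (maskedLaw D μ).real {ρ | CNF.WitnessedTrue ψ₁ ρ})
    (href : HasRefutation (ψ₀ ++ ψ₁ ++ φ) p) :
    (sampleLaw D μ (numTest γ δ)).real
      {τ | ⌊ε * numTest γ δ⌋₊ < hits {ρ | ¬ Refuted φ ψ w ρ} τ} ≤ 3 * δ / 4 := by
  have := isProbabilityMeasure_maskedLaw D hμ.le hμ₁.le
  have hprob : IsProbabilityMeasure (sampleLaw D μ (numTest γ δ)) := by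
    rw [sampleLaw]; infer_instance
  have hm₁ : (1 : ℝ) ≤ numTest γ δ := by exact_mod_cast numTest_pos hγ hδ hδ₁
  have hp' : (1 : ℝ) ≤ p := by exact_mod_cast hp
  obtain ⟨k, C, hk, hC⟩ := href
  -- The relevant clauses depend on `ψ`, but `ψ` is fixed before the test examples are drawn, so
  -- these are fixed events for a union bound over lines and examples.
  set bad : Fin (k + 1) → Set (PartialAssignment n) := fun i =>
    {ρ | (Clause.Proper (relevantClause φ ψ (C i)) ∧ w < (relevantClause φ ψ (C i)).card) ∧
      ¬ Clause.WitnessedTrue (relevantClause φ ψ (C i)) ρ ∧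
      ¬ Settles (unsatProb D) β w (relevantClause φ ψ (C i)) ρ} with hbad
  have hbad_le : ∀ i, (maskedLaw D μ).real (bad i) ≤ δ / (2 * numTest γ δ * p) := by
    intro i
    by_cases h : Clause.Proper (relevantClause φ ψ (C i)) ∧ w < (relevantClause φ ψ (C i)).card
    · exact ((measureReal_mono fun ρ hρ => hρ.2).trans
        (measureReal_not_settles_le D hμ.le hμ₁.le hβ₁.le h.1 w)).trans
        (hw (h.2.trans_le h.1.card_le))
    · have : bad i = ∅ := by
        ext ρ
        simp [hbad, h]
      rw [this, measureReal_empty]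
      positivity
  have hwit : (maskedLaw D μ).real {ρ | ¬ CNF.WitnessedTrue ψ₁ ρ} ≤ ε - 2 * γ := by
    have := probReal_compl_eq_one_sub (μ := maskedLaw D μ) (s := {ρ | CNF.WitnessedTrue ψ₁ ρ})
      MeasurableSet.of_discrete
    have h' : {ρ : PartialAssignment n | CNF.WitnessedTrue ψ₁ ρ}ᶜ =
      {ρ | ¬ CNF.WitnessedTrue ψ₁ ρ} := rfl
    rw [h'] at this
    linarith
  -- If no line is bad on any test example, the search can fail only where `ψ₁` is not witnessed
  -- true.
  have hcover : {τ : Fin (numTest γ δ) → PartialAssignment n |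
      ⌊ε * numTest γ δ⌋₊ < hits {ρ | ¬ Refuted φ ψ w ρ} τ} ⊆
      {τ | (ε - 2 * γ + 2 * γ) * numTest γ δ ≤ hits {ρ | ¬ CNF.WitnessedTrue ψ₁ ρ} τ} ∪
      ⋃ q ∈ (Finset.univ : Finset (Fin (numTest γ δ) × Fin (k + 1))), {τ | τ q.1 ∈ bad q.2} := by
    intro τ hτ
    by_cases hb : ∃ j i, τ j ∈ bad i
    · obtain ⟨j, i, hji⟩ := hb
      right
      simp only [Finset.mem_univ, Set.iUnion_true, Set.mem_iUnion]
      exact ⟨(j, i), hji⟩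
    · left
      push Not at hb
      have hle : hits {ρ | ¬ Refuted φ ψ w ρ} τ ≤ hits {ρ | ¬ CNF.WitnessedTrue ψ₁ ρ} τ := by
        refine hits_mono fun j hj hψj => hj ?_
        refine refuted_of_settles hu hψ hwn hn hη hψ₀ hψj hC fun i h₁ h₂ h₃ => ?_
        by_contra h₄
        exact hb j i ⟨⟨h₁, h₂⟩, h₃, h₄⟩
      have h₁ := (Nat.floor_lt (by positivity)).1 (lt_of_lt_of_le hτ hle)
      have : (ε - 2 * γ + 2 * γ) * numTest γ δ = ε * numTest γ δ := by ring
      rw [Set.mem_ofPred_eq, this]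
      exact h₁.le
  have hmarg : ∀ q : Fin (numTest γ δ) × Fin (k + 1),
      (sampleLaw D μ (numTest γ δ)).real {τ | τ q.1 ∈ bad q.2} ≤ δ / (2 * numTest γ δ * p) := by
    intro q
    refine le_trans (le_of_eq ?_) (hbad_le q.2)
    exact (measurePreserving_eval (fun _ : Fin (numTest γ δ) => maskedLaw D μ)
      q.1).measureReal_preimage MeasurableSet.of_discrete.nullMeasurableSet
  have h₁ := (measureReal_hits_ge_le (maskedLaw D μ) _ (numTest γ δ) hwit
    (s := 2 * γ) (by positivity)).trans (exp_neg_four_mul_numTest_le hγ hδ hδ₁)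
  have h₂ : (sampleLaw D μ (numTest γ δ)).real (⋃ q ∈ (Finset.univ : Finset
      (Fin (numTest γ δ) × Fin (k + 1))), {τ | τ q.1 ∈ bad q.2}) ≤ δ / 2 := by
    refine (measureReal_biUnion_finset_le _ _).trans
      ((Finset.sum_le_card_nsmul _ _ _ fun q _ => hmarg q).trans ?_)
    rw [nsmul_eq_mul, Finset.card_univ, Fintype.card_prod, Fintype.card_fin, Fintype.card_fin]
    have hk' : ((k + 1 : ℕ) : ℝ) ≤ p := by exact_mod_cast hk
    rw [Nat.cast_mul, mul_div_assoc', div_le_iff₀ (by positivity)]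
    have : (numTest γ δ : ℝ) * (k + 1 : ℕ) * δ ≤ numTest γ δ * p * δ := by gcongr
    linarith
  refine (measureReal_mono hcover).trans ((measureReal_union_le _ _).trans ?_)
  have h₁' : (sampleLaw D μ (numTest γ δ)).real {τ | (ε - 2 * γ + 2 * γ) * numTest γ δ ≤
    hits {ρ | ¬ CNF.WitnessedTrue ψ₁ ρ} τ} ≤ δ / 4 := h₁
  linarith

end Testing

/-! ### Correctness under a correlation gap -/

theorem learnRESCore_append_val (φ : CNF n) (w t₀ t₁ : ℕ) {m₀ m₁ : ℕ}
    (α : Fin m₀ → PartialAssignment n) (τ : Fin m₁ → PartialAssignment n) :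
    (learnRESCore φ w m₀ m₁ t₀ t₁ (Fin.append α τ)).val = true ↔
      hits {ρ | ¬ Refuted φ (learn w t₀ α).val w ρ} τ ≤ t₁ := by
  have h₁ : (fun i => Fin.append α τ (Fin.castAdd m₁ i)) = α :=
    funext fun i => Fin.append_left α τ i
  have h₂ : (fun i => Fin.append α τ (Fin.natAdd m₀ i)) = τ :=
    funext fun i => Fin.append_right α τ i
  rw [learnRESCore_val, h₁]
  conv_rhs => rw [← h₂]
  unfold hits
  convert Iff.rfl

theorem learnRES_val {p : ℕ} (φ : CNF n) {μ ε γ δ β : ℝ}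
    (α : Fin (numLearn n (gapWidth n p μ γ δ β) μ γ δ) → PartialAssignment n)
    (τ : Fin (numTest γ δ) → PartialAssignment n) :
    (learnRES φ p μ ε γ δ β (Fin.append α τ)).val = true ↔
      hits {ρ | ¬ Refuted φ (learn (gapWidth n p μ γ δ β)
        ⌊learnRate n (gapWidth n p μ γ δ β) μ γ *
          numLearn n (gapWidth n p μ γ δ β) μ γ δ⌋₊ α).val (gapWidth n p μ γ δ β) ρ} τ ≤
        ⌊ε * numTest γ δ⌋₊ :=
  learnRESCore_append_val φ _ _ _ α τ

/-- The first part of the sample fails with probability at most `δ/4`. Given a good first part, the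
test examples fail with probability at most `δ/2` in case (i) and `3δ/4` in case (ii). -/
theorem learnRESDecides_of_gap {p : ℕ} (D : Measure (Assignment n)) [IsProbabilityMeasure D]
    (φ : CNF n) {μ ε γ δ β : ℝ} (hn : 1 ≤ n) (hp : 1 ≤ p) (hμ : μ ∈ Set.Ioo (0 : ℝ) 1)
    (hε : ε ∈ Set.Ioo (0 : ℝ) 1) (hγ : γ ∈ Set.Ioo (0 : ℝ) 1) (hδ : δ ∈ Set.Ioo (0 : ℝ) 1)
    (hβ : β ∈ Set.Ioo (0 : ℝ) 1)
    (hD : HasCorrelationGap D (gapWidth n p μ γ δ β) β (1 - gapError n p μ γ δ β)) :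
    LearnRESDecides D φ p μ ε γ δ β := by
  have := isProbabilityMeasure_maskedLaw D hμ.1.le hμ.2.le
  have hprob : IsProbabilityMeasure (sampleLaw D μ (numExamples n p μ γ δ β)) := by
    rw [sampleLaw]; infer_instance
  have hw := gapWidth_pos hn hp hμ.1 hγ.1 hδ.1 hδ.2 hβ.1
  have hη : 0 ≤ gapError n p μ γ δ β := by
    have := hγ.1
    rw [gapError]
    positivity
  have hnη : n * gapError n p μ γ δ β = γ / (4 * (2 * n + 1 : ℝ) ^ gapWidth n p μ γ δ β) := by
    have : (n : ℝ) ≠ 0 := by positivity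
    rw [gapError]
    field_simp
  have hcompl : ∀ b : Bool, (sampleLaw D μ (numExamples n p μ γ δ β)).real
      {ρ | (learnRES φ p μ ε γ δ β ρ).val = !b} ≤ δ → 1 - δ ≤
      (sampleLaw D μ (numExamples n p μ γ δ β)).real
        {ρ | (learnRES φ p μ ε γ δ β ρ).val = b} := by
    intro b hb
    have hset : {ρ | (learnRES φ p μ ε γ δ β ρ).val = b} =
        {ρ | (learnRES φ p μ ε γ δ β ρ).val = !b}ᶜ := by
      ext ρ
      simp [Bool.eq_not]
    rw [hset, probReal_compl_eq_one_sub MeasurableSet.of_discrete]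
    linarith
  refine ⟨fun hcase => hcompl false ?_, fun hcase => hcompl true ?_⟩
  · refine (measureReal_append_le (maskedLaw D μ) _ _ _ _
      (measureReal_learns_invalid_le D hw hμ.1 hμ.2 hγ.1 hδ.1 hδ.2) (b := δ / 2)
      (fun α hα => ?_) (by linarith [hδ.1])).trans (by linarith [hδ.1])
    simp only [Set.mem_ofPred_eq, not_not] at hα
    refine (measureReal_mono fun τ hτ => (learnRES_val φ α τ).1 hτ).trans ?_
    exact measureReal_few_unrefuted_le D φ _ (fun C hC => ((mem_learn_iff α C).1 hC).1)
      (fun C hC => ((mem_learn_iff α C).1 hC).2.1) hα hμ.1 hμ.2 hε.1 hγ.1 hδ.1 hcase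
  · obtain ⟨ψ₀, ψ₁, hψ₀, hψ₁, href⟩ := hcase
    -- A probability is at least `1 - ε + 2γ` and `ε < 1`, so case (ii) itself supplies the bound on
    -- `γ` that the Chernoff estimate needs.
    have hγ₁ : γ ≤ 1 / 2 := by
      have := measureReal_le_one (μ := maskedLaw D μ) (s := {ρ | CNF.WitnessedTrue ψ₁ ρ})
      linarith [hε.2]
    refine (measureReal_append_le (maskedLaw D μ) _ _ _ _
      (measureReal_not_learnsValid_le D hn hw hμ.1 hμ.2 hγ.1 hγ₁ hδ.1 hδ.2 hnη) (b := 3 * δ / 4)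
      (fun α hα => ?_) (by linarith [hδ.1])).trans (by linarith [hδ.1])
    simp only [Set.mem_ofPred_eq, not_not] at hα
    refine (measureReal_mono fun τ hτ => not_le.1
      (mt (learnRES_val φ α τ).2 (Bool.eq_false_iff.1 hτ))).trans ?_
    refine measureReal_many_unrefuted_le D hn hp hμ.1 hμ.2 hε.1 hγ.1 hδ.1 hδ.2 hβ.2 hη gapWidth_le
      (pow_gapWidth_le hp hμ.1 hμ.2 hγ.1 hδ.1 hδ.2 hβ.1 hβ.2) (gapFunction_unsatProb hη hD) hα
      (fun C hC => ?_) hψ₁ href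
    rw [unsatProb_eq_one_sub]
    linarith [hψ₀ C hC]

/-! ### Affine distributions -/

/-- The coordinatewise sum of three assignments over `𝔽₂`. -/
def xor₃ (x y z : Assignment n) : Assignment n := fun i => (x i ^^ y i) ^^ z i

theorem xor₃_injective (y z : Assignment n) : Function.Injective fun x => xor₃ x y z := by
  intro x x' h
  funext i
  have := congrFun h i
  simpa [xor₃] using this

theorem xor₃_xor₃ (x y z : Assignment n) : xor₃ (xor₃ x y z) y z = x := by
  funext i
  simp only [xor₃]
  cases x i <;> cases y i <;> cases z i <;> rfl

/-- The sum of three solutions is again a solution, as `b + b + b = b` over `𝔽₂`. -/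
theorem mulVec_xor₃ {m : ℕ} (A : Matrix (Fin m) (Fin n) (ZMod 2)) {b : Fin m → ZMod 2}
    {x y z : Assignment n} (hx : A.mulVec (fun i => if x i then 1 else 0) = b)
    (hy : A.mulVec (fun i => if y i then 1 else 0) = b)
    (hz : A.mulVec (fun i => if z i then 1 else 0) = b) :
    A.mulVec (fun i => if xor₃ x y z i then 1 else 0) = b := by
  have hbool : ∀ a b c : Bool, (if ((a ^^ b) ^^ c) = true then (1 : ZMod 2) else 0) =
      (if a = true then 1 else 0) + (if b = true then 1 else 0) +
        (if c = true then 1 else 0) := by decide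
  have hsum : (fun i => if xor₃ x y z i then (1 : ZMod 2) else 0) =
      (fun i => if x i then (1 : ZMod 2) else 0) + (fun i => if y i then (1 : ZMod 2) else 0) +
        (fun i => if z i then (1 : ZMod 2) else 0) := by
    funext i
    exact hbool _ _ _
  rw [hsum, Matrix.mulVec_add, Matrix.mulVec_add, hx, hy, hz]
  funext j
  simp [CharTwo.add_self_eq_zero]

/-- A uniform distribution on a set that is closed under `xor₃` makes every variable constant or
unbiased. -/
theorem uniformOn_half_or_one {U : Set (Assignment n)} (hU : U.Nonempty)
    (hclosed : ∀ x ∈ U, ∀ y ∈ U, ∀ z ∈ U, xor₃ x y z ∈ U) (i : Fin n) :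
    (∀ b : Bool, (uniformOn U).real {x | x i = b} = 1 / 2) ∨
      ∃ b : Bool, (uniformOn U).real {x | x i = b} = 1 := by
  have hfin : U.Finite := Set.toFinite U
  have := isProbabilityMeasure_uniformOn hfin hU
  by_cases hconst : ∃ b : Bool, ∀ x ∈ U, x i = b
  · obtain ⟨b, hb⟩ := hconst
    right
    refine ⟨b, ?_⟩
    have hsub : U ⊆ {x | x i = b} := fun x hx => hb x hx
    rw [measureReal_def, uniformOn_eq_one_of hfin hU hsub]
    rfl
  · left
    push Not at hconst
    obtain ⟨y, hy, hyi⟩ := hconst true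
    obtain ⟨z, hz, hzi⟩ := hconst false
    -- `y` and `z` lie in `U` and differ at `i`, so adding both is an involution of `U` that swaps
    -- the two values at `i`.
    have hflip : ∀ x : Assignment n, xor₃ x y z i = !x i := by
      intro x
      simp only [Bool.not_eq_true, Bool.not_eq_false] at hyi hzi
      simp [xor₃, hyi, hzi]
    have himage : ∀ b : Bool, (fun x => xor₃ x y z) '' (U ∩ {x | x i = b}) =
        U ∩ {x | x i = !b} := by
      intro b
      ext x
      constructor
      · rintro ⟨x, ⟨hx, hxi⟩, rfl⟩
        have hxi : x i = b := hxi
        refine ⟨hclosed x hx y hy z hz, ?_⟩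
        simp [hflip, hxi]
      · rintro ⟨hx, hxi⟩
        have hxi : x i = !b := hxi
        refine ⟨xor₃ x y z, ⟨hclosed x hx y hy z hz, ?_⟩, xor₃_xor₃ x y z⟩
        simp [hflip, hxi]
    have heq : ∀ b : Bool, (uniformOn U).real {x | x i = b} =
        (uniformOn U).real {x | x i = !b} := by
      intro b
      rw [measureReal_def, measureReal_def, uniformOn, cond_apply hfin.measurableSet,
        cond_apply hfin.measurableSet, ← himage, Measure.count_injective_image (xor₃_injective y z)]
    intro b
    have hcompl := probReal_compl_eq_one_sub (μ := uniformOn U) (s := {x | x i = b})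
      MeasurableSet.of_discrete
    have hset : {x : Assignment n | x i = b}ᶜ = {x | x i = !b} := by
      ext x
      simp [Bool.eq_not]
    rw [hset, ← heq] at hcompl
    linarith

theorem IsAffineDistribution.isProbabilityMeasure {D : Measure (Assignment n)}
    (hD : IsAffineDistribution D) : IsProbabilityMeasure D := by
  obtain ⟨m, A, b, hS, rfl⟩ := hD
  exact isProbabilityMeasure_uniformOn (Set.toFinite _) hS

/-- Conditioning gives the uniform distribution on the solutions that satisfy `T`, a set still
closed under `xor₃`. Each variable is then exactly constant or exactly unbiased, so the gap holds at
every width. -/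
theorem IsAffineDistribution.hasCorrelationGap {D : Measure (Assignment n)}
    (hD : IsAffineDistribution D) (w : ℕ) {η : ℝ} (hη : 0 ≤ η) :
    HasCorrelationGap D w (1 / 2) (1 - η) := by
  obtain ⟨m, A, b, hS, rfl⟩ := hD
  intro T _ hT i
  set S : Set (Assignment n) := {x | A.mulVec (fun i => if x i then 1 else 0) = b}
  have hcond : cond (uniformOn S) (conjEvent T) = uniformOn (S ∩ conjEvent T) := by
    rw [uniformOn, uniformOn, cond_cond_eq_cond_inter MeasurableSet.of_discrete
      MeasurableSet.of_discrete]
  have hne : (S ∩ conjEvent T).Nonempty := by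
    rw [Set.nonempty_iff_ne_empty]
    intro h
    exact hT ((uniformOn_eq_zero_iff (Set.toFinite S)).2 h)
  have hclosed : ∀ x ∈ S ∩ conjEvent T, ∀ y ∈ S ∩ conjEvent T, ∀ z ∈ S ∩ conjEvent T,
      xor₃ x y z ∈ S ∩ conjEvent T := by
    intro x hx y hy z hz
    refine ⟨mulVec_xor₃ A hx.1 hy.1 hz.1, fun l hl => ?_⟩
    have h₁ : x l.1 = l.2 := hx.2 l hl
    have h₂ : y l.1 = l.2 := hy.2 l hl
    have h₃ : z l.1 = l.2 := hz.2 l hl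
    simp [Literal.Sat, xor₃, h₁, h₂, h₃]
  rw [hcond]
  rcases uniformOn_half_or_one hne hclosed i with h | ⟨b, h⟩
  · exact Or.inl fun b => (h b).ge
  · exact Or.inr ⟨b, by rw [h]; linarith⟩

/-! ### Step counts -/

theorem loop_literals_steps_le {σ : Type} (c : ℕ) (s : σ) (f : σ → Literal n → Timed σ)
    (hf : ∀ s l, (f s l).steps ≤ c) :
    (loop (literals n) s f).steps ≤ (c + 1) * (2 * n + 1) := by
  have h := loop_steps_le' c f (literals n) s fun s l _ => hf s l
  rw [length_literals] at h
  nlinarith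

theorem isFalsified_steps_le (C : Clause n) (ρ : PartialAssignment n) :
    (isFalsified C ρ).steps ≤ 4 * (2 * n + 1) :=
  loop_literals_steps_le 3 _ _ fun _ _ => le_rfl

theorem isWitnessed_steps_le (C : Clause n) (ρ : PartialAssignment n) :
    (isWitnessed C ρ).steps ≤ 4 * (2 * n + 1) :=
  loop_literals_steps_le 3 _ _ fun _ _ => le_rfl

theorem Timed.bind_steps_le {α β : Type} {x : Timed α} {f : α → Timed β} {a b : ℕ}
    (hx : x.steps ≤ a) (hf : (f x.val).steps ≤ b) : (x >>= f).steps ≤ a + b :=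
  Nat.add_le_add hx hf

theorem maskedPart_steps_le (C : Clause n) (ρ : PartialAssignment n) :
    (maskedPart C ρ).steps ≤ 4 * (2 * n + 1) :=
  loop_literals_steps_le 3 _ _ fun _ _ => Timed.bind_steps_le (a := 1) (b := 2) le_rfl
    (Timed.bind_steps_le (a := 1) (b := 1) le_rfl (Timed.ite_steps_le _ _ _ le_rfl le_rfl))

theorem restrict_steps_le (φ : CNF n) (ρ : PartialAssignment n) :
    (restrict φ ρ).steps ≤ φ.length * (8 * (2 * n + 1) + 2) + 1 :=
  loop_steps_le' (8 * (2 * n + 1) + 1) _ _ _ fun R C _ =>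
    (Timed.bind_steps_le (isWitnessed_steps_le C ρ) (Timed.ite_steps_le _ _ _ (Nat.zero_le _)
      (Timed.bind_steps_le (maskedPart_steps_le C ρ) (b := 1) le_rfl))).trans (by omega)

theorem width_steps_le (C : Clause n) : (width C).steps ≤ 3 * (2 * n + 1) :=
  loop_literals_steps_le 2 _ _ fun _ _ => Timed.bind_steps_le (a := 1) (b := 1) le_rfl
    (Timed.ite_steps_le _ _ _ le_rfl le_rfl)

theorem sameClause_steps_le (A B : Clause n) : (sameClause A B).steps ≤ 4 * (2 * n + 1) :=
  loop_literals_steps_le 3 _ _ fun _ _ => le_rfl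

theorem insertLiteral_steps_le (C : Clause n) (l : Literal n) :
    (insertLiteral C l).steps ≤ 4 * (2 * n + 1) :=
  loop_literals_steps_le 3 _ _ fun _ _ => Timed.bind_steps_le (a := 1) (b := 2) le_rfl
    (Timed.bind_steps_le (a := 1) (b := 1) le_rfl (Timed.ite_steps_le _ _ _ le_rfl le_rfl))

theorem deleteLiteral_steps_le (C : Clause n) (l : Literal n) :
    (deleteLiteral C l).steps ≤ 4 * (2 * n + 1) :=
  loop_literals_steps_le 3 _ _ fun _ _ => Timed.bind_steps_le (a := 1) (b := 2) le_rfl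
    (Timed.bind_steps_le (a := 1) (b := 1) le_rfl (Timed.ite_steps_le _ _ _ le_rfl le_rfl))

theorem resolvent_steps_le (A B : Clause n) (v : Fin n) :
    (resolvent A B v).steps ≤ 6 * (2 * n + 1) :=
  loop_literals_steps_le 5 _ _ fun _ _ => Timed.bind_steps_le (a := 1) (b := 4) le_rfl
    (Timed.bind_steps_le (a := 1) (b := 3) le_rfl (Timed.bind_steps_le (a := 1) (b := 2) le_rfl
      (Timed.bind_steps_le (a := 1) (b := 1) le_rfl (Timed.ite_steps_le _ _ _ le_rfl le_rfl))))

theorem addNew_steps_le (T : CNF n) (C : Clause n) :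
    (addNew T C).steps ≤ T.length * (4 * (2 * n + 1) + 2) + 2 :=
  Timed.bind_steps_le (a := T.length * (4 * (2 * n + 1) + 2) + 1) (b := 1)
    (loop_steps_le' (4 * (2 * n + 1) + 1) _ _ _ fun _ B _ =>
      Timed.bind_steps_le (sameClause_steps_le C B) (b := 1) le_rfl)
    (Timed.ite_steps_le _ _ _ (Nat.zero_le _) le_rfl)

/-- A table of distinct clauses of width at most `k`. -/
def IsNarrowTable (k : ℕ) (T : CNF n) : Prop := T.Nodup ∧ ∀ C ∈ T, C.card ≤ k

theorem IsNarrowTable.length_le {k : ℕ} {T : CNF n} (h : IsNarrowTable k T) :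
    T.length ≤ (2 * n + 1) ^ k := length_le_of_narrow h.1 h.2

theorem IsNarrowTable.of_extends {k : ℕ} {T T' : CNF n} (h : IsNarrowTable k T)
    (h' : Extends (fun C => C.card ≤ k) T T') : IsNarrowTable k T' := ⟨h'.nodup h.1, h'.prop h.2⟩

theorem addNarrow_steps_le {k : ℕ} {T : CNF n} (hT : IsNarrowTable k T) (C : Clause n) :
    (addNarrow k T C).steps ≤ 12 * (2 * n + 1) * (2 * n + 1) ^ k := by
  have h : (addNarrow k T C).steps ≤
      3 * (2 * n + 1) + (1 + (T.length * (4 * (2 * n + 1) + 2) + 2)) :=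
    Timed.bind_steps_le (width_steps_le C) (Timed.bind_steps_le (a := 1) le_rfl
      (Timed.ite_steps_le _ _ _ (addNew_steps_le T C) (Nat.zero_le _)))
  have hl := hT.length_le
  have h1 : 1 ≤ (2 * n + 1) ^ k := Nat.one_le_pow _ _ (by omega)
  have h2 : T.length * (4 * (2 * n + 1) + 2) ≤ (2 * n + 1) ^ k * (4 * (2 * n + 1) + 2) :=
    Nat.mul_le_mul_right _ hl
  nlinarith

/-- The loops range over the table at the start of the round, while the growing table enters only
through the search for duplicates in `addNarrow`. The invariant `IsNarrowTable` bounds both by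
`(2n+1)^k`, giving the cube. -/
theorem resolveRound_steps_le {k : ℕ} {T : CNF n} (hT : IsNarrowTable k T) :
    (resolveRound k T).steps ≤ 26 * (2 * n + 1) ^ 2 * ((2 * n + 1) ^ k) ^ 3 := by
  have hbody : ∀ A B : Clause n, ∀ T, IsNarrowTable k T → ∀ v, IsNarrowTable k (do
      let a ← op (decide ((v, true) ∈ A))
      let b ← op (decide ((v, false) ∈ B))
      if a && b then do
        let R ← resolvent A B v
        addNarrow k T R
      else pure T : Timed (CNF n)).val := by
    intro A B T hT v
    rw [resolveRound_body_val]
    exact hT.of_extends (extends_resolveStep (fun _ _ _ => id) T v)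
  have hstep : ∀ A B : Clause n, ∀ T, IsNarrowTable k T → ∀ v, (do
      let a ← op (decide ((v, true) ∈ A))
      let b ← op (decide ((v, false) ∈ B))
      if a && b then do
        let R ← resolvent A B v
        addNarrow k T R
      else pure T : Timed (CNF n)).steps ≤
      1 + (1 + (6 * (2 * n + 1) + 12 * (2 * n + 1) * (2 * n + 1) ^ k)) := by
    intro A B T hT v
    exact Timed.bind_steps_le (a := 1) le_rfl (Timed.bind_steps_le (a := 1) le_rfl
      (Timed.ite_steps_le _ _ _ (Timed.bind_steps_le (resolvent_steps_le A B v)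
        (addNarrow_steps_le hT _)) (Nat.zero_le _)))
  have hinv : ∀ A B : Clause n, ∀ T, IsNarrowTable k T →
      IsNarrowTable k ((List.finRange n).foldl (resolveStep k A B) T) := fun A B T hT =>
    hT.of_extends (Extends.foldl _ _ _ fun T v _ => extends_resolveStep (fun _ _ _ => id) T v)
  set N := 2 * n + 1 with hN
  set S := N ^ k with hS
  have hN1 : 1 ≤ N := by omega
  have hS1 : 1 ≤ S := Nat.one_le_pow _ _ (by omega)
  have hl : T.length ≤ S := hT.length_le
  have h1 : ∀ A B : Clause n, ∀ T, IsNarrowTable k T → (loop (List.finRange n) T fun T₃ v => do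
      let a ← op (decide ((v, true) ∈ A))
      let b ← op (decide ((v, false) ∈ B))
      if a && b then do
        let R ← resolvent A B v
        addNarrow k T₃ R
      else pure T₃).steps ≤ 22 * N ^ 2 * S := by
    intro A B T hT
    have h := loop_steps_le (IsNarrowTable k) _ _ (List.finRange n) T hT
      (fun T hT v _ => hbody A B T hT v) (fun T hT v _ => hstep A B T hT v)
    rw [List.length_finRange] at h
    refine h.trans ?_
    have hnN : n ≤ N := by omega
    have hNS : N ≤ N * S := Nat.le_mul_of_pos_right _ hS1
    have hNNS : 1 ≤ N * (N * S) := Nat.mul_pos hN1 (Nat.mul_pos hN1 hS1)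
    calc _ ≤ N * (21 * (N * S)) + N * (N * S) := by
          refine Nat.add_le_add (Nat.mul_le_mul hnN ?_) hNNS
          rw [mul_assoc 12 N S]
          omega
      _ = 22 * N ^ 2 * S := by ring
  have h2 : ∀ A : Clause n, ∀ T', IsNarrowTable k T' → (loop T T' fun T₂ B =>
      loop (List.finRange n) T₂ fun T₃ v => do
      let a ← op (decide ((v, true) ∈ A))
      let b ← op (decide ((v, false) ∈ B))
      if a && b then do
        let R ← resolvent A B v
        addNarrow k T₃ R
      else pure T₃).steps ≤ 24 * N ^ 2 * S ^ 2 := by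
    intro A T' hT'
    have h := loop_steps_le (IsNarrowTable k) _ _ T T' hT'
      (fun T hT B _ => by
        simp only [loop_val, resolveRound_body_val]
        exact hinv A B T hT) (fun T hT B _ => h1 A B T hT)
    refine h.trans ?_
    have hNNS : 1 ≤ N ^ 2 * S := Nat.mul_pos (Nat.pow_pos hN1) hS1
    have hSS : 1 ≤ S * (N ^ 2 * S) := Nat.mul_pos hS1 hNNS
    calc _ ≤ S * (23 * (N ^ 2 * S)) + S * (N ^ 2 * S) := by
          refine Nat.add_le_add (Nat.mul_le_mul hl ?_) hSS
          rw [mul_assoc 22 _ S]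
          omega
      _ = 24 * N ^ 2 * S ^ 2 := by ring
  have h := loop_steps_le (IsNarrowTable k) _ _ T T hT
    (fun T' hT' A _ => by
      simp only [loop_val, resolveRound_body_val]
      exact hT'.of_extends (Extends.foldl _ _ _ fun T₂ B _ => Extends.foldl _ _ _ fun T₃ v _ =>
        extends_resolveStep (fun _ _ _ => id) T₃ v)) (fun T' hT' A _ => h2 A T' hT')
  refine h.trans ?_
  have hNNS : 1 ≤ N ^ 2 * S ^ 2 := Nat.mul_pos (Nat.pow_pos hN1) (Nat.pow_pos hS1)
  have hSS : 1 ≤ S * (N ^ 2 * S ^ 2) := Nat.mul_pos hS1 hNNS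
  calc _ ≤ S * (25 * (N ^ 2 * S ^ 2)) + S * (N ^ 2 * S ^ 2) := by
        refine Nat.add_le_add (Nat.mul_le_mul hl ?_) hSS
        rw [mul_assoc 24 _ (S ^ 2)]
        omega
    _ = 26 * N ^ 2 * S ^ 3 := by ring

theorem isNarrowTable_nil (k : ℕ) : IsNarrowTable k ([] : CNF n) := ⟨List.nodup_nil, by simp⟩

theorem IsNarrowTable.addNarrow {k : ℕ} {T : CNF n} (hT : IsNarrowTable k T) (C : Clause n) :
    IsNarrowTable k (addNarrow k T C).val :=
  hT.of_extends (extends_addNarrow id T)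

theorem IsNarrowTable.resolveRound {k : ℕ} {T : CNF n} (hT : IsNarrowTable k T) :
    IsNarrowTable k (resolveRound k T).val :=
  hT.of_extends (extends_resolveRound fun _ _ _ _ _ _ _ => id)

theorem wRefute_steps_le (φ : CNF n) (k : ℕ) :
    (wRefute φ k).steps ≤ (φ.length + 1) * (50 * (2 * n + 1) ^ 2 * ((2 * n + 1) ^ k) ^ 4) := by
  have hfold : ∀ l : CNF n, ∀ T, IsNarrowTable k T →
      IsNarrowTable k (loop l T (addNarrow k)).val := by
    intro l T hT
    rw [loop_val]
    exact hT.of_extends (Extends.foldl _ _ _ fun T C _ => extends_addNarrow id T)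
  have hrounds : ∀ (l : List ℕ) (T : CNF n), IsNarrowTable k T →
      IsNarrowTable k (loop l T fun T _ => resolveRound k T).val := by
    intro l
    induction l with
    | nil => exact fun T hT => hT
    | cons a l ih => exact fun T hT => ih _ hT.resolveRound
  have h1 := loop_steps_le (IsNarrowTable k) _ (addNarrow k) φ [] (isNarrowTable_nil k)
    (fun T hT C _ => hT.addNarrow C) (fun T hT C _ => addNarrow_steps_le hT C)
  set T₀ := (loop φ [] (addNarrow k)).val with hT₀
  have hT₀' : IsNarrowTable k T₀ := hfold φ [] (isNarrowTable_nil k)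
  have h2 := loop_steps_le (IsNarrowTable k) _ (fun T _ => resolveRound k T)
    (List.range ((2 * n + 1) ^ k)) T₀ hT₀' (fun T hT _ _ => hT.resolveRound)
    (fun T hT _ _ => resolveRound_steps_le hT)
  set T₁ := (loop (List.range ((2 * n + 1) ^ k)) T₀ fun T _ => resolveRound k T).val with hT₁
  have hT₁' : IsNarrowTable k T₁ := hrounds _ _ hT₀'
  have h3 := loop_steps_le' (4 * (2 * n + 1) + 1) (fun (r : Bool) (C : Clause n) => do
    let e ← sameClause C ∅
    op (r || e)) T₁ false fun r C _ => Timed.bind_steps_le (sameClause_steps_le C ∅) (b := 1) le_rfl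
  rw [List.length_range] at h2
  refine (Timed.bind_steps_le h1 (Timed.bind_steps_le h2 h3)).trans ?_
  have hl := hT₁'.length_le
  set N := 2 * n + 1 with hN
  set S := N ^ k with hS
  have hN1 : 1 ≤ N := by omega
  have hS1 : 1 ≤ S := Nat.one_le_pow _ _ (by omega)
  have e1 : N * S ≤ N ^ 2 * S ^ 4 := Nat.mul_le_mul (Nat.le_self_pow (by norm_num) N)
    (Nat.le_self_pow (by norm_num) S)
  have e2 : 1 ≤ N * S := Nat.mul_pos hN1 hS1
  have e3 : S ≤ N * S := Nat.le_mul_of_pos_left _ hN1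
  have e4 : T₁.length * (4 * N + 1 + 1) ≤ S * (4 * N + 1 + 1) := Nat.mul_le_mul_right _ hl
  have e5 : φ.length * (12 * N * S + 1) ≤ φ.length * (13 * (N ^ 2 * S ^ 4)) := by
    refine Nat.mul_le_mul_left _ ?_
    rw [mul_assoc]
    omega
  calc _ ≤ φ.length * (13 * (N ^ 2 * S ^ 4)) + 1 +
        (S * (26 * N ^ 2 * S ^ 3 + 1) + 1 + (S * (4 * N + 1 + 1) + 1)) := by omega
    _ = φ.length * (13 * (N ^ 2 * S ^ 4)) + (26 * (N ^ 2 * S ^ 4) + 4 * (N * S) + 3 * S + 3) := by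
        ring
    _ ≤ φ.length * (13 * (N ^ 2 * S ^ 4)) + 37 * (N ^ 2 * S ^ 4) := by omega
    _ ≤ (φ.length + 1) * (50 * (N ^ 2 * S ^ 4)) := by
        rw [add_mul]
        refine Nat.add_le_add (Nat.mul_le_mul_left _ (by omega)) (by omega)
    _ = _ := by ring

/-- This is the recursion of `narrowClauses`: a clause avoids the first variable or contains it in
one of two signs. -/
theorem pow_step (m w : ℕ) : (2 * m + 1) ^ (w + 1) + 2 * (2 * m + 1) ^ w ≤
    (2 * (m + 1) + 1) ^ (w + 1) := by
  have h : (2 * m + 1) ^ w ≤ (2 * (m + 1) + 1) ^ w := Nat.pow_le_pow_left (by omega) w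
  calc _ = (2 * (m + 1) + 1) * (2 * m + 1) ^ w := by ring
    _ ≤ (2 * (m + 1) + 1) * (2 * (m + 1) + 1) ^ w := Nat.mul_le_mul_left _ h
    _ = _ := by ring

theorem length_foldl_cons_cons {α : Type} (f g : α → α) (S T : List α) :
    (S.foldl (fun R C => f C :: g C :: R) T).length = T.length + 2 * S.length := by
  induction S generalizing T with
  | nil => simp
  | cons C S ih => rw [List.foldl_cons, ih]; simp; omega

theorem narrowClauses_length_le (vs : List (Fin n)) (w : ℕ) :
    (narrowClauses vs w).val.length ≤ (2 * vs.length + 1) ^ w := by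
  induction vs generalizing w with
  | nil => cases w <;> simp [narrowClauses]
  | cons v vs ih =>
    cases w with
    | zero => simp [narrowClauses]
    | succ w =>
      simp only [narrowClauses, Timed.bind_val, loop_val, op_val, List.length_cons]
      rw [length_foldl_cons_cons]
      have h1 := ih (w + 1)
      have h2 := ih w
      have h3 := pow_step vs.length w
      omega

theorem narrowClauses_steps_le (vs : List (Fin n)) (w : ℕ) :
    (narrowClauses vs w).steps ≤ 12 * (2 * n + 1) * (2 * vs.length + 1) ^ w := by
  induction vs generalizing w with
  | nil => cases w <;> simp [narrowClauses] <;> omega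
  | cons v vs ih =>
    cases w with
    | zero => simp [narrowClauses]; omega
    | succ w =>
      have h1 := ih (w + 1)
      have h2 := ih w
      have h3 := pow_step vs.length w
      have h4 := narrowClauses_length_le vs w
      set T := narrowClauses vs (w + 1) with hT
      set S := narrowClauses vs w with hS
      have h5 := loop_steps_le' (4 * (2 * n + 1) + (4 * (2 * n + 1) + 1))
        (fun (R : CNF n) (C : Clause n) => do
          let P ← insertLiteral C (v, true)
          let N ← insertLiteral C (v, false)
          op (P :: N :: R)) S.val T.val fun R C _ =>
          Timed.bind_steps_le (insertLiteral_steps_le C _)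
            (Timed.bind_steps_le (insertLiteral_steps_le C _) (b := 1) le_rfl)
      rw [narrowClauses, List.length_cons]
      refine (Timed.bind_steps_le h1 (Timed.bind_steps_le h2 h5)).trans ?_
      have hP : 1 ≤ (2 * vs.length + 1) ^ w := Nat.one_le_pow _ _ (by omega)
      calc _ ≤ 12 * (2 * n + 1) * (2 * vs.length + 1) ^ (w + 1) +
            (12 * (2 * n + 1) * (2 * vs.length + 1) ^ w +
              ((2 * vs.length + 1) ^ w * (4 * (2 * n + 1) + (4 * (2 * n + 1) + 1) + 1) +
                (2 * vs.length + 1) ^ w)) := by gcongr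
        _ ≤ 12 * (2 * n + 1) * ((2 * vs.length + 1) ^ (w + 1) + 2 * (2 * vs.length + 1) ^ w) := by
            nlinarith
        _ ≤ _ := Nat.mul_le_mul_left _ h3

theorem learn_steps_le (w t : ℕ) {m : ℕ} (ρ : Fin m → PartialAssignment n) :
    (learn w t ρ).steps ≤ 30 * (2 * n + 1) * (2 * n + 1) ^ w * (m + 1) := by
  have h1 := narrowClauses_steps_le (List.finRange n) w
  have h2 := narrowClauses_length_le (List.finRange n) w
  rw [List.length_finRange] at h1 h2
  have h3 : ∀ C : Clause n, (loop (List.finRange m) 0 fun f i => do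
      let b ← isFalsified C (ρ i)
      if b then op (f + 1) else pure f).steps ≤ m * (4 * (2 * n + 1) + 1 + 1) + 1 := by
    intro C
    have h := loop_steps_le' (4 * (2 * n + 1) + 1) (fun (f : ℕ) (i : Fin m) => do
      let b ← isFalsified C (ρ i)
      if b then op (f + 1) else pure f) (List.finRange m) 0 fun f i _ =>
        Timed.bind_steps_le (isFalsified_steps_le C (ρ i)) (b := 1)
          (Timed.ite_steps_le _ _ _ le_rfl (Nat.zero_le _))
    rwa [List.length_finRange] at h
  have h4 := loop_steps_le' (m * (4 * (2 * n + 1) + 1 + 1) + 1 + (1 + 1))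
    (fun (ψ : CNF n) (C : Clause n) => do
      let falsified ← loop (List.finRange m) 0 fun f i => do
        let b ← isFalsified C (ρ i)
        if b then op (f + 1) else pure f
      let good ← op (decide (falsified ≤ t))
      if good then op (C :: ψ) else pure ψ) (narrowClauses (List.finRange n) w).val []
    fun ψ C _ => Timed.bind_steps_le (h3 C) (Timed.bind_steps_le (a := 1) (b := 1) le_rfl
      (Timed.ite_steps_le _ _ _ le_rfl (Nat.zero_le _)))
  refine (Timed.bind_steps_le h1 h4).trans ?_
  set N := 2 * n + 1 with hN
  have hN1 : 1 ≤ N := by omega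
  have hS1 : 1 ≤ N ^ w := Nat.one_le_pow _ _ (by omega)
  set S := N ^ w with hS
  have hmN : m ≤ N * m := Nat.le_mul_of_pos_left _ hN1
  calc _ ≤ 12 * N * S + (S * (m * (4 * N + 1 + 1) + 1 + (1 + 1) + 1) + S) := by gcongr
    _ = 12 * (N * S) + (4 * (N * m) * S + 2 * m * S + 5 * S) := by ring
    _ ≤ 12 * (N * S) + (4 * (N * m) * S + 2 * (N * m) * S + 5 * (N * S)) := by
        gcongr
        exact Nat.le_mul_of_pos_left _ hN1
    _ = N * S * (17 + 6 * m) := by ring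
    _ ≤ N * S * (30 * (m + 1)) := Nat.mul_le_mul_left _ (by omega)
    _ = _ := by ring

theorem learn_length_le (w t : ℕ) {m : ℕ} (ρ : Fin m → PartialAssignment n) :
    (learn w t ρ).val.length ≤ (2 * n + 1) ^ w := by
  have key : ∀ (f : CNF n → Clause n → Timed (CNF n)) (l ψ : CNF n),
      (∀ ψ C, (f ψ C).val.length ≤ ψ.length + 1) →
      (loop l ψ f).val.length ≤ ψ.length + l.length := by
    intro f l
    induction l with
    | nil => intro ψ _; simp [loop]
    | cons C l ih =>
      intro ψ hf
      have h1 := ih (f ψ C).val hf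
      have h2 := hf ψ C
      simp only [loop, Timed.bind_val, op_val, List.length_cons]
      omega
  have h := narrowClauses_length_le (List.finRange n) w
  rw [List.length_finRange] at h
  rw [learn, Timed.bind_val]
  refine (key _ _ [] fun ψ C => ?_).trans (by simpa using h)
  rw [Timed.bind_val, Timed.bind_val, Timed.ite_val]
  split_ifs <;> simp

theorem reduceAt_steps_le (C C' : Clause n) (l : Literal n) :
    (reduceAt C C' l).steps ≤ 11 * (2 * n + 1) := by
  have h : (reduceAt C C' l).steps ≤ 1 + (1 + (5 * (2 * n + 1) + 4 * (2 * n + 1))) :=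
    Timed.bind_steps_le le_rfl (Timed.bind_steps_le le_rfl (Timed.ite_steps_le _ _ _
      (Timed.bind_steps_le (loop_literals_steps_le 4 _ _ fun _ _ => le_rfl)
        (Timed.ite_steps_le _ _ _ (deleteLiteral_steps_le C _) (Nat.zero_le _)))
      (Nat.zero_le _)))
  omega

theorem reduceCNF_steps_le (φ ψ : CNF n) {s : ℕ} (hs : 1 ≤ s) (hψ : ψ.length ≤ s) :
    (reduceCNF φ ψ).steps ≤ (φ.length + 1) * (20 * (2 * n + 1) ^ 2 * s) := by
  have h1 : ∀ (C C' : Clause n), (loop (literals n) C fun C l => reduceAt C C' l).steps ≤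
      (11 * (2 * n + 1) + 1) * (2 * n + 1) := fun C C' =>
    loop_literals_steps_le _ _ _ fun C l => reduceAt_steps_le C C' l
  have h2 : ∀ C : Clause n, (loop ψ C fun C C' =>
      loop (literals n) C fun C l => reduceAt C C' l).steps ≤
      ψ.length * ((11 * (2 * n + 1) + 1) * (2 * n + 1) + 1) + 1 := fun C =>
    loop_steps_le' _ _ _ _ fun C C' _ => h1 C C'
  have h3 := loop_steps_le' _ (fun (R : CNF n) (C : Clause n) => do
    let C₁ ← loop ψ C fun C C' => loop (literals n) C fun C l => reduceAt C C' l
    op (C₁ :: R)) φ [] fun R C _ => Timed.bind_steps_le (h2 C) (b := 1) le_rfl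
  refine h3.trans ?_
  set N := 2 * n + 1 with hN
  have hN1 : 1 ≤ N := by omega
  have e1 : N ≤ N ^ 2 := Nat.le_self_pow (by norm_num) N
  have e2 : 1 ≤ N ^ 2 := Nat.pow_pos hN1
  have e3 : 1 ≤ N ^ 2 * s := Nat.mul_pos e2 hs
  calc _ ≤ φ.length * (s * (13 * N ^ 2) + 1 + 1 + 1) + 1 := by
        gcongr
        nlinarith
    _ ≤ φ.length * (20 * (N ^ 2 * s)) + 20 * (N ^ 2 * s) := by
        refine Nat.add_le_add (Nat.mul_le_mul_left _ ?_) (by omega)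
        rw [show s * (13 * N ^ 2) = 13 * (N ^ 2 * s) by ring]
        omega
    _ = _ := by ring

theorem length_foldl_cons {α β : Type} (f : α → β) (l : List α) (R : List β) :
    (l.foldl (fun R a => f a :: R) R).length = R.length + l.length := by
  induction l generalizing R with
  | nil => simp
  | cons a l ih => rw [List.foldl_cons, ih]; simp; omega

theorem testCNF_length (φ ψ : CNF n) : (testCNF φ ψ).length = φ.length + ψ.length := by
  rw [testCNF, length_foldl_cons (fun C => C)]
  simp only [reduceCNF, loop_val, Timed.bind_val, op_val]
  rw [length_foldl_cons]
  simp

theorem restrict_length_le (φ : CNF n) (ρ : PartialAssignment n) :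
    (restrict φ ρ).val.length ≤ φ.length := by
  have key : ∀ R : CNF n, (φ.foldl (fun R C => if (isWitnessed C ρ).val = true then R
      else (maskedPart C ρ).val :: R) R).length ≤ R.length + φ.length := by
    induction φ with
    | nil => simp
    | cons C φ ih =>
      intro R
      rw [List.foldl_cons]
      refine (ih _).trans ?_
      split_ifs <;> simp only [List.length_cons] <;> omega
  simp only [restrict, loop_val, Timed.bind_val, op_val, Timed.ite_val, Timed.pure_val]
  simpa using key []

/-- Here `N = 2n+1`, `S = N^w`, `F` and `G` count input and learned clauses, and `a`, `b` stand for
`m₀`, `m₁`. The searches dominate: `S^8` is the fourth power of the table bound `N^{2w}`, and one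
more `S` comes from the learned clauses in the tested CNF. -/
theorem phase_sum_le {N S G : ℕ} (hN : 1 ≤ N) (hS : 1 ≤ S) (hG : G ≤ S) (F a b : ℕ) :
    30 * N * S * (a + 1) + ((F + 1) * (20 * N ^ 2 * S) + (G * (1 + 1) + 1 +
      (b * ((F + G) * (8 * N + 2) + 1 + ((F + G + 1) * (50 * N ^ 2 * S ^ 8) + 1) + 1) + 1 + 1))) ≤
      (F + 1) * (256 * (N ^ 2 * S ^ 9) * (a + 1) * (b + 1)) := by
  set Z := N ^ 2 * S ^ 9 with hZ
  set W := (F + 1) * Z with hW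
  have hSS : S ≤ S ^ 9 := Nat.le_self_pow (by norm_num) S
  have hNN : N ≤ N ^ 2 := Nat.le_self_pow (by norm_num) N
  have hNS : N * S ≤ Z := Nat.mul_le_mul hNN hSS
  have hZW : Z ≤ W := Nat.le_mul_of_pos_left _ (by omega)
  have hZ1 : 1 ≤ Z := lt_of_lt_of_le (Nat.mul_pos hN hS) hNS
  have hFG : F + G + 1 ≤ (F + 1) * (2 * S) := by nlinarith
  have h1 : (F + 1) * (20 * N ^ 2 * S) ≤ 20 * W := by
    calc _ = 20 * ((F + 1) * (N ^ 2 * S)) := by ring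
      _ ≤ 20 * ((F + 1) * (N ^ 2 * S ^ 9)) := by gcongr
      _ = 20 * W := by rw [hW, hZ]
  have h2 : (F + G) * (8 * N + 2) + 1 ≤ 20 * W := by
    calc _ ≤ (F + G + 1) * (10 * N) := by nlinarith
      _ ≤ (F + 1) * (2 * S) * (10 * N) := Nat.mul_le_mul_right _ hFG
      _ = 20 * ((F + 1) * (N * S)) := by ring
      _ ≤ 20 * W := by rw [hW]; gcongr
  have h3 : (F + G + 1) * (50 * N ^ 2 * S ^ 8) ≤ 100 * W := by
    calc _ ≤ (F + 1) * (2 * S) * (50 * N ^ 2 * S ^ 8) := Nat.mul_le_mul_right _ hFG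
      _ = 100 * W := by rw [hW, hZ]; ring
  have h4 : G ≤ W := hG.trans ((Nat.le_mul_of_pos_left _ hN).trans (hNS.trans hZW))
  have h5 : b * ((F + G) * (8 * N + 2) + 1 + ((F + G + 1) * (50 * N ^ 2 * S ^ 8) + 1) + 1) ≤
      b * (122 * W) := Nat.mul_le_mul_left _ (by omega)
  have h6 : 30 * N * S * (a + 1) ≤ 30 * (W * (a + 1)) := by
    calc _ = 30 * (N * S * (a + 1)) := by ring
      _ ≤ _ := by
        gcongr
        exact hNS.trans hZW
  have h7 : W * (a + 1) ≤ W * (a + 1) * (b + 1) := Nat.le_mul_of_pos_right _ (by omega)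
  have h8 : W ≤ W * (a + 1) := Nat.le_mul_of_pos_right _ (by omega)
  have h9 : b * (122 * W) ≤ 122 * (W * (a + 1) * (b + 1)) := by
    calc b * (122 * W) = 122 * (W * b) := by ring
      _ ≤ 122 * (W * (a + 1) * (b + 1)) := by
        gcongr
        omega
  calc _ ≤ 256 * (W * (a + 1) * (b + 1)) := by omega
    _ = _ := by rw [hW]; ring

theorem learnRESCore_steps_le (φ : CNF n) (w m₀ m₁ t₀ t₁ : ℕ)
    (ρ : Fin (m₀ + m₁) → PartialAssignment n) :
    (learnRESCore φ w m₀ m₁ t₀ t₁ ρ).steps ≤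
      (φ.length + 1) * (256 * (2 * n + 1) ^ (9 * w + 2) * (m₀ + 1) * (m₁ + 1)) := by
  set ψ := (learn w t₀ fun i : Fin m₀ => ρ (Fin.castAdd m₁ i)).val with hψdef
  have hψ : ψ.length ≤ (2 * n + 1) ^ w := learn_length_le _ _ _
  have h1 := learn_steps_le w t₀ fun i : Fin m₀ => ρ (Fin.castAdd m₁ i)
  have hs : 1 ≤ (2 * n + 1) ^ w := Nat.one_le_pow _ _ (by omega)
  have h2 := reduceCNF_steps_le φ ψ hs hψ
  have h3 := loop_steps_le' 1 (fun (R : CNF n) (C : Clause n) => op (C :: R)) ψ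
    (reduceCNF φ ψ).val fun _ _ _ => le_rfl
  have hχ : (loop ψ (reduceCNF φ ψ).val fun R C => op (C :: R)).val = testCNF φ ψ := by
    rw [loop_val]
    rfl
  have h4 := loop_steps_le' (((testCNF φ ψ).length * (8 * (2 * n + 1) + 2) + 1) +
      (((testCNF φ ψ).length + 1) * (50 * (2 * n + 1) ^ 2 * ((2 * n + 1) ^ (2 * w)) ^ 4) + 1))
    (fun (f : ℕ) (i : Fin m₁) => do
      let χr ← restrict (testCNF φ ψ) (ρ (Fin.natAdd m₀ i))
      let r ← wRefute χr (2 * w)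
      if r then pure f else op (f + 1)) (List.finRange m₁) 0 fun f i _ =>
    Timed.bind_steps_le (restrict_steps_le _ _) (Timed.bind_steps_le ((wRefute_steps_le _ _).trans
      (Nat.mul_le_mul_right _ (Nat.succ_le_succ (restrict_length_le _ _))))
      (Timed.ite_steps_le _ _ _ (Nat.zero_le _) le_rfl))
  rw [List.length_finRange] at h4
  rw [← hχ] at h4
  refine (Timed.bind_steps_le h1 (Timed.bind_steps_le h2 (Timed.bind_steps_le h3
    (Timed.bind_steps_le h4 (b := 1) le_rfl)))).trans ?_
  rw [hχ, testCNF_length]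
  have e0 : ((2 * n + 1) ^ (2 * w)) ^ 4 = ((2 * n + 1) ^ w) ^ 8 := by
    rw [← pow_mul, ← pow_mul]
    congr 1
    ring
  have e1 : (2 * n + 1) ^ (9 * w + 2) = (2 * n + 1) ^ 2 * ((2 * n + 1) ^ w) ^ 9 := by
    rw [← pow_mul, ← pow_add]
    congr 1
    ring
  rw [e0, e1]
  exact phase_sum_le (by omega) hs hψ _ _ _

/-! ### The running time -/

section RunningTime

variable {p : ℕ} {μ γ δ β : ℝ}

theorem numTest_add_one_le (hγ : 0 < γ) (hγ₁ : γ < 1) (hδ : 0 < δ) (hδ₁ : δ < 1) :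
    (numTest γ δ : ℝ) + 1 ≤ 3 * (1 / (γ ^ 2 * δ)) := by
  have hlog : 0 ≤ Real.log (2 / δ) := Real.log_nonneg (by rw [le_div_iff₀ hδ]; linarith)
  have h1 : (numTest γ δ : ℝ) < 1 / (2 * γ ^ 2) * Real.log (2 / δ) + 1 :=
    Nat.ceil_lt_add_one (by positivity)
  have h2 : Real.log (2 / δ) ≤ 2 / δ :=
    (Real.log_le_sub_one_of_pos (by positivity)).trans (by linarith)
  have h3 : 1 / (2 * γ ^ 2) * Real.log (2 / δ) ≤ 1 / (γ ^ 2 * δ) := by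
    calc _ ≤ 1 / (2 * γ ^ 2) * (2 / δ) := by gcongr
      _ = 1 / (γ ^ 2 * δ) := by field_simp
  have h4 : 1 ≤ 1 / (γ ^ 2 * δ) := by
    rw [le_div_iff₀ (by positivity)]
    nlinarith [pow_le_one₀ (n := 2) hγ.le hγ₁.le]
  linarith

theorem numLearn_add_one_le {w : ℕ} (hwn : w ≤ n) (hμ : 0 < μ) (hμ₁ : μ < 1) (hγ : 0 < γ)
    (hγ₁ : γ < 1) (hδ : 0 < δ) (hδ₁ : δ < 1) :
    (numLearn n w μ γ δ : ℝ) + 1 ≤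
      10 * ((2 * n + 1 : ℝ) ^ (2 * w + 2) * (1 / μ) ^ (2 * w) * (1 / (γ ^ 2 * δ))) := by
  have hN : (1 : ℝ) ≤ 2 * n + 1 := by linarith [Nat.cast_nonneg (α := ℝ) n]
  have hlog := (log_pos_of_delta (n := n) hδ hδ₁).le
  have h1 : (numLearn n w μ γ δ : ℝ) < 2 * w * (2 * n + 1 : ℝ) ^ (2 * w) / (μ ^ (2 * w) * γ ^ 2) *
      Real.log (4 * (2 * n + 1) / δ) + 1 := Nat.ceil_lt_add_one (by positivity)
  have h2 : Real.log (4 * (2 * n + 1) / δ) ≤ 4 * (2 * n + 1) / δ :=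
    (Real.log_le_sub_one_of_pos (by positivity)).trans (by linarith)
  have hw : (w : ℝ) ≤ 2 * n + 1 := by
    have : (w : ℝ) ≤ n := by exact_mod_cast hwn
    linarith [Nat.cast_nonneg (α := ℝ) n]
  have h3 : 2 * w * (2 * n + 1 : ℝ) ^ (2 * w) / (μ ^ (2 * w) * γ ^ 2) *
      Real.log (4 * (2 * n + 1) / δ) ≤
      8 * ((2 * n + 1 : ℝ) ^ (2 * w + 2) * (1 / μ) ^ (2 * w) * (1 / (γ ^ 2 * δ))) := by
    calc _ ≤ 2 * (2 * n + 1 : ℝ) * (2 * n + 1 : ℝ) ^ (2 * w) / (μ ^ (2 * w) * γ ^ 2) *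
          (4 * (2 * n + 1) / δ) := by gcongr
      _ = _ := by
        rw [one_div μ, inv_pow]
        field_simp
        ring
  have h4 : 1 ≤ (2 * n + 1 : ℝ) ^ (2 * w + 2) * (1 / μ) ^ (2 * w) * (1 / (γ ^ 2 * δ)) := by
    have e1 : (1 : ℝ) ≤ (2 * n + 1 : ℝ) ^ (2 * w + 2) := one_le_pow₀ hN
    have e2 : (1 : ℝ) ≤ (1 / μ) ^ (2 * w) :=
      one_le_pow₀ (by rw [le_div_iff₀ hμ]; linarith)
    have e3 : 1 ≤ 1 / (γ ^ 2 * δ) := by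
      rw [le_div_iff₀ (by positivity)]
      nlinarith [pow_le_one₀ (n := 2) hγ.le hγ₁.le]
    exact one_le_mul_of_one_le_of_one_le (one_le_mul_of_one_le_of_one_le e1 e2) e3
  linarith

theorem log_two_le_log_ratio (hp : 1 ≤ p) (hγ : 0 < γ) (hγ₁ : γ ≤ 1 / 2) (hδ : 0 < δ)
    (hδ₁ : δ < 1) : Real.log 2 ≤ Real.log (p / (γ * δ)) := by
  refine Real.log_le_log (by norm_num) ?_
  have : (1 : ℝ) ≤ p := by exact_mod_cast hp
  rw [le_div_iff₀ (by positivity)]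
  nlinarith

theorem one_div_le_exp_log_ratio (hp : 1 ≤ p) (hγ : 0 < γ) (hδ : 0 < δ)
    (hδ₁ : δ < 1) : 1 / (γ ^ 2 * δ) ≤ Real.exp (2 * Real.log (p / (γ * δ))) := by
  have hp' : (1 : ℝ) ≤ p := by exact_mod_cast hp
  have hpos : 0 < p / (γ * δ) := by positivity
  rw [two_mul, Real.exp_add, Real.exp_log hpos]
  have h : 1 / (γ ^ 2 * δ) * 1 ≤ 1 / (γ ^ 2 * δ) * (p ^ 2 / δ) := by
    gcongr
    rw [le_div_iff₀ hδ]
    nlinarith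
  calc _ = 1 / (γ ^ 2 * δ) * 1 := (mul_one _).symm
    _ ≤ _ := h
    _ = _ := by field_simp

/-- The argument of the logarithm is at most the sixth power of `p/(γδ)`. Rounding up adds less than
`1 ≤ 2 * (1/(μβ)) * L`, and `6 + 2 = 8`. -/
theorem gapWidth_le_mul_log (hp : 1 ≤ p) (hμ : 0 < μ) (hμ₁ : μ < 1) (hγ : 0 < γ)
    (hγ₁ : γ ≤ 1 / 2) (hδ : 0 < δ) (hδ₁ : δ < 1) (hβ : 0 < β) (hβ₁ : β < 1) :
    (gapWidth n p μ γ δ β : ℝ) ≤ 8 * (1 / (μ * β) * Real.log (p / (γ * δ))) := by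
  have hp' : (1 : ℝ) ≤ p := by exact_mod_cast hp
  set L := Real.log (p / (γ * δ)) with hL
  have hlog2 := Real.log_two_gt_d9
  have hL2 : Real.log 2 ≤ L := log_two_le_log_ratio hp hγ hγ₁ hδ hδ₁
  have hratio := one_lt_failure_ratio hp hγ hδ hδ₁
  have hinv : 1 ≤ 1 / (μ * β) := by
    rw [le_div_iff₀ (by positivity)]
    nlinarith
  have h1 : (gapWidth n p μ γ δ β : ℝ) <
      1 / (μ * β) * Real.log (2 * numTest γ δ * p / δ) + 1 := by
    have hle : gapWidth n p μ γ δ β ≤ ⌈1 / (μ * β) * Real.log (2 * numTest γ δ * p / δ)⌉₊ :=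
      min_le_right _ _
    refine lt_of_le_of_lt (Nat.cast_le.2 hle) (Nat.ceil_lt_add_one ?_)
    have := Real.log_pos hratio
    positivity
  have h2 : 2 * numTest γ δ * p / δ ≤ Real.exp (6 * L) := by
    have e1 : (numTest γ δ : ℝ) ≤ 3 * Real.exp (2 * L) := by
      have := numTest_add_one_le hγ (by linarith) hδ hδ₁
      have := one_div_le_exp_log_ratio hp hγ hδ hδ₁
      linarith
    have e2 : p / δ ≤ Real.exp L := by
      rw [hL, Real.exp_log (by positivity)]
      refine div_le_div_of_nonneg_left (by positivity) (by positivity) ?_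
      nlinarith
    have e3 : 6 ≤ Real.exp (3 * L) := by
      calc (6 : ℝ) ≤ 2 ^ 3 := by norm_num
        _ = Real.exp (3 * Real.log 2) := by
          rw [mul_comm, Real.exp_mul, Real.exp_log (by norm_num)]
          norm_num
        _ ≤ Real.exp (3 * L) := Real.exp_le_exp.2 (by linarith)
    calc 2 * numTest γ δ * p / δ = 2 * numTest γ δ * (p / δ) := by ring
      _ ≤ 2 * (3 * Real.exp (2 * L)) * Real.exp L := by gcongr
      _ = 6 * Real.exp (3 * L) := by
          rw [show (3 : ℝ) * L = 2 * L + L by ring, Real.exp_add]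
          ring
      _ ≤ Real.exp (3 * L) * Real.exp (3 * L) := by gcongr
      _ = Real.exp (6 * L) := by
          rw [← Real.exp_add]
          congr 1
          ring
  have h3 : Real.log (2 * numTest γ δ * p / δ) ≤ 6 * L :=
    (Real.log_le_iff_le_exp (by linarith)).2 h2
  have h4 : 1 / (μ * β) * Real.log (2 * numTest γ δ * p / δ) ≤ 1 / (μ * β) * (6 * L) := by gcongr
  have h5 : 1 ≤ 2 * (1 / (μ * β) * L) := by nlinarith
  linarith

theorem exp_le_rpow_of_two_le {x : ℝ} (hx : 2 ≤ x) {a : ℝ} (ha : 0 ≤ a) :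
    Real.exp a ≤ x ^ (2 * a) := by
  rw [Real.rpow_def_of_pos (by linarith)]
  refine Real.exp_le_exp.2 ?_
  have h1 := Real.log_two_gt_d9
  have h2 : Real.log 2 ≤ Real.log x := Real.log_le_log (by norm_num) hx
  nlinarith

/-- The factor `μ^{-2w}` in the number of examples is absorbed because `w ≤ n`. -/
theorem one_div_pow_le_rpow {w : ℕ} {Y : ℝ} (hn : 2 ≤ n) (hwn : w ≤ n) (hμ : 0 < μ)
    (hw : (w : ℝ) ≤ 8 * Y) (hY : 1 / (2 * μ) ≤ Y) :
    (1 / μ) ^ (2 * w) ≤ (n : ℝ) ^ (32 * Y) := by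
  have hn' : (2 : ℝ) ≤ n := by exact_mod_cast hn
  have hYpos : 0 < Y := lt_of_lt_of_le (by positivity) hY
  -- If `1/μ ≤ n²`, the factor is at most `n^{4w}`. Otherwise `w ≤ n ≤ u` for `u = μ^{-1/2}`, so `w
  -- log u ≤ u² = 1/μ`, and the factor is at most `exp (4/μ)` with `1/μ ≤ 2Y`.
  by_cases h : 1 / μ ≤ (n : ℝ) ^ 2
  · calc (1 / μ) ^ (2 * w) ≤ ((n : ℝ) ^ 2) ^ (2 * w) := by gcongr
      _ = (n : ℝ) ^ (4 * (w : ℝ)) := by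
        rw [← pow_mul, ← Real.rpow_natCast]
        congr 1
        push_cast
        ring
      _ ≤ (n : ℝ) ^ (32 * Y) :=
        Real.rpow_le_rpow_of_exponent_le (by linarith) (by linarith)
  · push Not at h
    set u := Real.sqrt (1 / μ) with hu
    have hu2 : u ^ 2 = 1 / μ := Real.sq_sqrt (by positivity)
    have hupos : 0 < u := Real.sqrt_pos.2 (by positivity)
    have hnu : (n : ℝ) ≤ u := Real.le_sqrt_of_sq_le h.le
    have hwu : (w : ℝ) ≤ u := le_trans (by exact_mod_cast hwn) hnu
    have hlog : Real.log u ≤ u := (Real.log_le_sub_one_of_pos hupos).trans (by linarith)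
    have hlog0 : 0 ≤ Real.log u := Real.log_nonneg (by linarith)
    have hexp : (1 / μ) ^ (2 * w) = Real.exp (4 * (w * Real.log u)) := by
      rw [← hu2, ← pow_mul, show 4 * ((w : ℝ) * Real.log u) = (2 * (2 * w) : ℕ) * Real.log u by
        push_cast; ring, Real.exp_nat_mul, Real.exp_log hupos]
    have hwl : w * Real.log u ≤ 1 / μ := by
      rw [← hu2]
      nlinarith
    have hYμ : 1 / μ ≤ 2 * Y := by
      have : 1 / μ = 2 * (1 / (2 * μ)) := by field_simp
      linarith
    rw [hexp]
    calc _ ≤ Real.exp (8 * Y) := Real.exp_le_exp.2 (by linarith)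
      _ ≤ (n : ℝ) ^ (2 * (8 * Y)) := exp_le_rpow_of_two_le hn' (by linarith)
      _ ≤ _ := Real.rpow_le_rpow_of_exponent_le (by linarith) (by linarith)

theorem learnRES_steps_le (φ : CNF n) {ε : ℝ} (hn : 2 ≤ n) (hp : 1 ≤ p) (hμ : 0 < μ)
    (hμ₁ : μ < 1) (hγ : 0 < γ) (hγ₁ : γ ≤ 1 / 2) (hδ : 0 < δ) (hδ₁ : δ < 1) (hβ : 0 < β)
    (hβ₁ : β < 1) (ρ : Fin (numExamples n p μ γ δ β) → PartialAssignment n) :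
    ((learnRES φ p μ ε γ δ β ρ).steps : ℝ) ≤
      (φ.length + 1) * (n : ℝ) ^ (400 * (1 / (μ * β)) * Real.log (p / (γ * δ))) := by
  set w := gapWidth n p μ γ δ β with hwdef
  set L := Real.log (p / (γ * δ)) with hL
  set Y := 1 / (μ * β) * L with hY
  have hn' : (2 : ℝ) ≤ n := by exact_mod_cast hn
  have hn1 : (1 : ℝ) ≤ n := by linarith
  have hn0 : (0 : ℝ) < n := by linarith
  have hwn : w ≤ n := gapWidth_le
  have hw : (w : ℝ) ≤ 8 * Y := gapWidth_le_mul_log hp hμ hμ₁ hγ hγ₁ hδ hδ₁ hβ hβ₁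
  have hlog2 := Real.log_two_gt_d9
  have hL2 : Real.log 2 ≤ L := log_two_le_log_ratio hp hγ hγ₁ hδ hδ₁
  have hLpos : 0 < L := by linarith
  have hμY : 1 / μ * L ≤ Y := by
    rw [hY]
    gcongr
    nlinarith
  have hLY : L ≤ Y := by
    refine le_trans ?_ hμY
    have : 1 ≤ 1 / μ := by rw [le_div_iff₀ hμ]; linarith
    nlinarith
  have hYμ : 1 / (2 * μ) ≤ Y := by
    refine le_trans ?_ hμY
    have h : 1 / (2 * μ) = 1 / μ * (1 / 2) := by field_simp
    rw [h]
    gcongr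
    linarith
  have h1 : (learnRES φ p μ ε γ δ β ρ).steps ≤ (φ.length + 1) *
      (256 * (2 * n + 1) ^ (9 * w + 2) * (numLearn n w μ γ δ + 1) * (numTest γ δ + 1)) :=
    learnRESCore_steps_le φ w (numLearn n w μ γ δ) (numTest γ δ) _ _ ρ
  have h2 : ((learnRES φ p μ ε γ δ β ρ).steps : ℝ) ≤ (φ.length + 1) *
      (256 * (2 * n + 1 : ℝ) ^ (9 * w + 2) * (numLearn n w μ γ δ + 1) * (numTest γ δ + 1)) := by
    exact_mod_cast h1
  refine h2.trans (mul_le_mul_of_nonneg_left ?_ (by positivity))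
  have hA : 1 / (γ ^ 2 * δ) ≤ Real.exp (2 * L) := one_div_le_exp_log_ratio hp hγ hδ hδ₁
  have hm₀ := numLearn_add_one_le hwn hμ hμ₁ hγ (by linarith) hδ hδ₁
  have hm₁ := numTest_add_one_le hγ (by linarith) hδ hδ₁
  have hpowN : (2 * n + 1 : ℝ) ^ (11 * w + 4) ≤ (n : ℝ) ^ (33 * (w : ℝ) + 12) := by
    have hN : (2 * n + 1 : ℝ) ≤ (n : ℝ) ^ 3 := by nlinarith [sq_nonneg ((n : ℝ) - 2)]
    calc (2 * n + 1 : ℝ) ^ (11 * w + 4) ≤ ((n : ℝ) ^ 3) ^ (11 * w + 4) := by gcongr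
      _ = (n : ℝ) ^ (33 * (w : ℝ) + 12) := by
        rw [← pow_mul, ← Real.rpow_natCast]
        congr 1
        push_cast
        ring
  have hμw := one_div_pow_le_rpow (μ := μ) hn hwn hμ hw hYμ
  have hexp : Real.exp (4 * L) ≤ (n : ℝ) ^ (8 * L) :=
    (exp_le_rpow_of_two_le hn' (by linarith)).trans_eq (by congr 1; ring)
  have hconst : (7680 : ℝ) ≤ (n : ℝ) ^ (13 : ℝ) := by
    calc (7680 : ℝ) ≤ 2 ^ 13 := by norm_num
      _ ≤ (n : ℝ) ^ 13 := by gcongr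
      _ = (n : ℝ) ^ (13 : ℝ) := by rw [← Real.rpow_natCast]; norm_num
  calc 256 * (2 * n + 1 : ℝ) ^ (9 * w + 2) * (numLearn n w μ γ δ + 1) * (numTest γ δ + 1)
      ≤ 256 * (2 * n + 1 : ℝ) ^ (9 * w + 2) *
        (10 * ((2 * n + 1 : ℝ) ^ (2 * w + 2) * (1 / μ) ^ (2 * w) * (1 / (γ ^ 2 * δ)))) *
        (3 * (1 / (γ ^ 2 * δ))) := by gcongr
    _ ≤ 256 * (2 * n + 1 : ℝ) ^ (9 * w + 2) *
        (10 * ((2 * n + 1 : ℝ) ^ (2 * w + 2) * (1 / μ) ^ (2 * w) * Real.exp (2 * L))) *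
        (3 * Real.exp (2 * L)) := by gcongr
    _ = 7680 * (2 * n + 1 : ℝ) ^ (11 * w + 4) * (1 / μ) ^ (2 * w) * Real.exp (4 * L) := by
        rw [show (4 : ℝ) * L = 2 * L + 2 * L by ring, Real.exp_add,
          show 11 * w + 4 = (9 * w + 2) + (2 * w + 2) by ring, pow_add _ (9 * w + 2)]
        ring
    _ ≤ (n : ℝ) ^ (13 : ℝ) * (n : ℝ) ^ (33 * (w : ℝ) + 12) * (n : ℝ) ^ (32 * Y) *
        (n : ℝ) ^ (8 * L) := by gcongr
    _ = (n : ℝ) ^ (13 + (33 * (w : ℝ) + 12) + 32 * Y + 8 * L) := by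
        rw [Real.rpow_add hn0 _ (8 * L), Real.rpow_add hn0 _ (32 * Y), Real.rpow_add hn0 13]
    _ ≤ (n : ℝ) ^ (400 * (1 / (μ * β)) * L) := by
        -- Since `w ≤ 8Y` and `L ≤ Y`, the exponent is at most `25 + (264 + 32 + 8)Y`. As `Y ≥ log
        -- 2`, the constant `25` is below `37Y`, so `400` is more than enough.
        refine Real.rpow_le_rpow_of_exponent_le hn1 ?_
        rw [mul_assoc, ← hY]
        linarith

end RunningTime

end PACRes

theorem mainTheorem1 :
    ∃ K : ℝ, 0 < K ∧
      ∀ (n p : ℕ) (φ : PACRes.CNF n) (μ ε γ δ β : ℝ), 1 ≤ n → 1 ≤ p →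
        μ ∈ Set.Ioo (0 : ℝ) 1 → ε ∈ Set.Ioo (0 : ℝ) 1 → γ ∈ Set.Ioo (0 : ℝ) 1 →
        δ ∈ Set.Ioo (0 : ℝ) 1 → β ∈ Set.Ioo (0 : ℝ) 1 →
        (∀ D : MeasureTheory.Measure (PACRes.Assignment n),
          MeasureTheory.IsProbabilityMeasure D →
          PACRes.HasCorrelationGap D (PACRes.gapWidth n p μ γ δ β) β
            (1 - PACRes.gapError n p μ γ δ β) →
          PACRes.LearnRESDecides D φ p μ ε γ δ β) ∧
        (∀ D : MeasureTheory.Measure (PACRes.Assignment n),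
          PACRes.IsAffineDistribution D → β = 1 / 2 →
          PACRes.LearnRESDecides D φ p μ ε γ δ β) ∧
        (2 ≤ n → γ ≤ 1 / 2 →
          ∀ ρ : Fin (PACRes.numExamples n p μ γ δ β) → PACRes.PartialAssignment n,
            ((PACRes.learnRES φ p μ ε γ δ β ρ).steps : ℝ) ≤
              (φ.length + 1) *
                (n : ℝ) ^ (K * (1 / (μ * β)) * Real.log (p / (γ * δ)))) := by
  refine ⟨400, by norm_num, ?_⟩
  intro n p φ μ ε γ δ β hn hp hμ hε hγ hδ hβ
  refine ⟨fun D _ hgap => PACRes.learnRESDecides_of_gap D φ hn hp hμ hε hγ hδ hβ hgap, ?_, ?_⟩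
  · intro D hD hβ'
    have := hD.isProbabilityMeasure
    refine PACRes.learnRESDecides_of_gap D φ hn hp hμ hε hγ hδ hβ ?_
    subst hβ'
    refine hD.hasCorrelationGap _ ?_
    have := hγ.1
    rw [PACRes.gapError]
    positivity
  · intro hn₂ hγ₂ ρ
    exact PACRes.learnRES_steps_le φ hn₂ hp hμ.1 hμ.2 hγ.1 hγ₂ hδ.1 hδ.2 hβ.1 hβ.2 ρ
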